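/- Let $(M,g)$ be a smooth two-dimensional Riemannian manifold (without boundary), with area measure $\mu$ and one-dimensional (Hausdorff) measure $s$. Let $\theta\in(0,1]$ and $\kappa\in\mathbb{R}$, and assume that $(M,g)$ satisfies the $(\theta,\kappa)$-isoperimetric inequality, that is, $$4\pi\theta\,\mu(E)-\kappa\,\mu(E)^2\le s(\partial E)^2$$ for every compact connected domain $E\subset M$ with smooth (possibly empty) boundary. Let $\Omega\subset M$ be a nonempty open set with compact closure, $\lambda\in\mathbb{R}$, and let $u\in C^\infty(\overline\Omega)$ (that is, $u$ is smooth in $\Omega$ and $u$ and all its derivatives extend continuously to $\overline\Omega$) and $f:\Omega\to\mathbb{R}$ satisfy $$-\Delta_g u+\kappa=\lambda e^{2u}+f\ \text{ in }\Omega,\qquad u=0\ \text{ on }\partial\Omega,\qquad u>0\ \text{ in }\Omega,$$ where $\Delta_g$ is the Laplace--Beltrami operator. Set $\Theta=\frac{1}{2\pi}\int_\Omega f^+\,d\mu$, where $f^+=\max(f,0)$. Then $$4\pi(\theta-\Theta)\int_\Omega e^{2u}\,d\mu-\lambda\Big(\int_\Omega e^{2u}\,d\mu\Big)^2\le 4\pi\theta\,\mu(\Omega)-\kappa\,\mu(\Omega)^2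 .$$ In particular, if $\Theta=0$ and $0<\lambda\le\kappa$, then $$\int_\Omega e^{2u}\,d\mu+\mu(\Omega)\ge\frac{4\pi\theta}{\lambda}.$$ -/

import Mathlib

open MeasureTheory Set Filter Manifold Bundle
open scoped Topology ContDiff ENNReal MeasureTheory

noncomputable section

namespace SphereCovering

-- Vector spaces are charted by the identity, through `chartedSpaceSelf`.
attribute [-instance] TopCat.of.chartedSpace

/-- The Euclidean plane, model space of surfaces. -/
abbrev Plane : Type := EuclideanSpace ℝ (Fin 2)

/-- Partial derivative `∂ᵢ w (y)` of a function on the plane. -/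
def partialDeriv (i : Fin 2) (w : Plane → ℝ) (y : Plane) : ℝ :=
  fderiv ℝ w y (EuclideanSpace.single i 1)

section Surface

variable {M : Type*} [TopologicalSpace M] [ChartedSpace Plane M]

/-- The coordinate vector `∂ᵢ` at the point of coordinates `y` in the preferred chart around `x`:
the image of the `i`-th basis vector of the plane under the derivative of the inverse chart.
Meaningful for `y` in the target of the chart. -/
def coordVector (x : M) (y : Plane) (i : Fin 2) :
    TangentSpace (𝓡 2) ((extChartAt (𝓡 2) x).symm y) :=
  mfderiv 𝓘(ℝ, Plane) (𝓡 2) (extChartAt (𝓡 2) x).symm y (EuclideanSpace.single i (1 : ℝ))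

section Metric

variable [RiemannianBundle (fun x : M ↦ TangentSpace (𝓡 2) x)]

/-- The matrix `gᵢⱼ(y) = ⟨∂ᵢ, ∂ⱼ⟩` of the metric, at the coordinate point `y`, in the preferred chart
around `x`. -/
def gram (x : M) (y : Plane) : Matrix (Fin 2) (Fin 2) ℝ :=
  Matrix.of fun i j ↦ inner ℝ (coordVector x y i) (coordVector x y j)

/-- The area density `√(det g)` in the preferred chart around `x`. -/
def areaDensity (x : M) (y : Plane) : ℝ :=
  Real.sqrt (gram x y).det

/-- The Laplace-Beltrami operator `Δ_g u = (1/√g) ∑ᵢ ∂ᵢ (√g ∑ⱼ gⁱʲ ∂ⱼ u)`, with `√g = √(det g)`,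
evaluated at `p` in the preferred chart around `p`. -/
def laplacian (u : M → ℝ) (p : M) : ℝ :=
  (areaDensity p (extChartAt (𝓡 2) p p))⁻¹ *
    ∑ i : Fin 2, partialDeriv i
      (fun y ↦ areaDensity p y *
        ∑ j : Fin 2, (gram p y)⁻¹ i j * partialDeriv j (u ∘ (extChartAt (𝓡 2) p).symm) y)
      (extChartAt (𝓡 2) p p)

variable [MeasurableSpace M]

/-- The Riemannian area on the domain of the preferred chart around `x`, as a measure on `M`:
the push-forward of `√(det g) dy` by the inverse chart. -/
def chartArea (x : M) : Measure M :=
  ((volume.restrict (extChartAt (𝓡 2) x).target).withDensity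
    (fun y ↦ ENNReal.ofReal (areaDensity x y))).map (extChartAt (𝓡 2) x).symm

variable (M) in
/-- The Riemannian area `μ` of the surface: the least measure which dominates the areas
`chartArea x` of all the chart domains. As these agree on overlaps, it is the measure whose
restriction to each chart domain is `√(det g) dy` read in the chart. -/
def area : Measure M := ⨆ x : M, chartArea x

end Metric

/-- Compact smooth domains: compact connected sets `E` which, near each point of their boundary,
are of the form `{ρ ≤ 0}` for a smooth function `ρ` whose differential does not vanish there. -/
structure IsCompactSmoothDomain (E : Set M) : Prop where
  isCompact : IsCompact E
  isConnected : IsConnected E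
  smooth_boundary : ∀ x ∈ frontier E, ∃ (U : Set M) (ρ : M → ℝ), IsOpen U ∧ x ∈ U ∧
    ContMDiffOn (𝓡 2) 𝓘(ℝ, ℝ) ∞ ρ U ∧ mfderiv (𝓡 2) 𝓘(ℝ, ℝ) ρ x ≠ 0 ∧
    E ∩ U = {y ∈ U | ρ y ≤ 0}

/-- `u ∈ C^∞(closure Ω)` for an open set `Ω`: the function `u` is smooth in `Ω`, continuous on the
closure, and all its partial derivatives in `Ω`, read in a chart around any point of the closure,
extend continuously to this point. -/
structure SmoothOnClosure (Ω : Set M) (u : M → ℝ) : Prop where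
  contMDiffOn : ContMDiffOn (𝓡 2) 𝓘(ℝ, ℝ) ∞ u Ω
  continuousOn : ContinuousOn u (closure Ω)
  tendsto_deriv : ∀ x ∈ closure Ω, ∀ k : ℕ, ∃ L : Plane [×k]→L[ℝ] ℝ,
    Tendsto (iteratedFDeriv ℝ k (u ∘ (extChartAt (𝓡 2) x).symm))
      (𝓝[(extChartAt (𝓡 2) x).target ∩ (extChartAt (𝓡 2) x).symm ⁻¹' Ω] (extChartAt (𝓡 2) x x))
      (𝓝 L)

end Surface

/-- The `(θ, κ)`-isoperimetric inequality `4πθ μ(E) - κ μ(E)² ≤ s(∂E)²` for compact smooth domains,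
where `μ` is the Riemannian area and `s` the one-dimensional Hausdorff measure of the
Riemannian distance. -/
def IsoperimetricInequality (M : Type*) [EMetricSpace M] [ChartedSpace Plane M]
    [RiemannianBundle (fun x : M ↦ TangentSpace (𝓡 2) x)]
    [MeasurableSpace M] [BorelSpace M] (θ κ : ℝ) : Prop :=
  ∀ E : Set M, IsCompactSmoothDomain E →
    4 * Real.pi * θ * (area M).real E - κ * (area M).real E ^ 2 ≤
      (Measure.hausdorffMeasure 1 : Measure M).real (frontier E) ^ 2

end SphereCovering

end

/-!
The method of Fiala and Bol. By Sard's theorem almost every level `t > 0` is regular, so that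
`{u ≥ t}`, of area `m(t)`, is a finite disjoint union of compact smooth domains, to each of which
the isoperimetric inequality applies. By the coarea formula and Cauchy–Schwarz, the squared length
of the level line is at most `-m'(t)` times the flux `∫_{u ≥ t} -Δu` of the gradient through it, and
by the equation this flux is at most `2πΘ + ∫_{u ≥ t} (λ e^{2u} - κ)`. Hence
`4πθ m(t) - κ m(t)² ≤ -m'(t) (2πΘ + ∫_{u ≥ t} (λ e^{2u} - κ))`. Multiply by `e^{2t}` and integrate
over `t > 0`: the term `(κ/2) ∬ e^{2 min(u(x), u(y))}` appears on both sides, and what remains is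
half of the claim.
-/

noncomputable section

open scoped NNReal

namespace SphereCovering

attribute [-instance] TopCat.of.chartedSpace

section Planar

lemma eq_sum_smul_single (v : Plane) : v = ∑ i : Fin 2, v i • EuclideanSpace.single i (1 : ℝ) := by
  ext j; fin_cases j <;> simp

lemma fderiv_apply_eq_sum (w : Plane → ℝ) (y v : Plane) :
    fderiv ℝ w y v = ∑ i : Fin 2, v i * partialDeriv i w y := by
  conv_lhs => rw [eq_sum_smul_single v, map_sum]
  simp only [map_smul, smul_eq_mul, partialDeriv]

lemma det_eq_det_of_single (A : Plane →L[ℝ] Plane) :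
    A.det = (Matrix.of fun i j ↦ A (EuclideanSpace.single j 1) i).det := by
  rw [ContinuousLinearMap.det,
    ← LinearMap.det_toMatrix (EuclideanSpace.basisFun (Fin 2) ℝ).toBasis]
  congr 1

lemma contDiffOn_partialDeriv {w : Plane → ℝ} {V : Set Plane} (hV : IsOpen V) {m n : ℕ∞ω}
    (hw : ContDiffOn ℝ n w V) (hmn : m + 1 ≤ n) (i : Fin 2) :
    ContDiffOn ℝ m (partialDeriv i w) V :=
  (hw.fderiv_of_isOpen hV hmn).clm_apply contDiffOn_const

end Planar

section Coordinates

variable {M : Type*} [TopologicalSpace M] [ChartedSpace Plane M]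

/-- The part of `s` which lies in the domain of the preferred chart around `x`, read in this
chart. -/
def chartPreimage (x : M) (s : Set M) : Set Plane :=
  (extChartAt (𝓡 2) x).target ∩ (extChartAt (𝓡 2) x).symm ⁻¹' s

/-- The change of coordinates from the preferred chart around one point to that around another,
meaningful on `overlap`. -/
def transition (x x' : M) (y : Plane) : Plane :=
  extChartAt (𝓡 2) x' ((extChartAt (𝓡 2) x).symm y)

/-- The domain of the change of coordinates `transition x x'`. -/
def overlap (x x' : M) : Set Plane :=
  chartPreimage x (extChartAt (𝓡 2) x').source

lemma isOpen_chartPreimage (x : M) {s : Set M} (hs : IsOpen s) : IsOpen (chartPreimage x s) :=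
  (continuousOn_extChartAt_symm x).isOpen_inter_preimage (isOpen_extChartAt_target x) hs

lemma mem_chartPreimage_of_mem {x p : M} {s : Set M} (hp : p ∈ (extChartAt (𝓡 2) x).source)
    (hs : p ∈ s) : extChartAt (𝓡 2) x p ∈ chartPreimage x s :=
  ⟨(extChartAt (𝓡 2) x).map_source hp, by rwa [mem_preimage, (extChartAt (𝓡 2) x).left_inv hp]⟩

lemma isOpen_overlap (x x' : M) : IsOpen (overlap x x') :=
  isOpen_chartPreimage x (isOpen_extChartAt_source x')

lemma symm_transition {x x' : M} {y : Plane} (hy : y ∈ overlap x x') :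
    (extChartAt (𝓡 2) x').symm (transition x x' y) = (extChartAt (𝓡 2) x).symm y :=
  (extChartAt (𝓡 2) x').left_inv hy.2

lemma transition_mem_chartPreimage {x x' : M} {y : Plane} (hy : y ∈ overlap x x') {s : Set M}
    (hs : (extChartAt (𝓡 2) x).symm y ∈ s) : transition x x' y ∈ chartPreimage x' s :=
  ⟨(extChartAt (𝓡 2) x').map_source hy.2, by rwa [mem_preimage, symm_transition hy]⟩

lemma transition_mem_overlap {x x' : M} {y : Plane} (hy : y ∈ overlap x x') :
    transition x x' y ∈ overlap x' x :=
  transition_mem_chartPreimage hy ((extChartAt (𝓡 2) x).map_target hy.1)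

lemma transition_transition {x x' : M} {y : Plane} (hy : y ∈ overlap x x') :
    transition x' x (transition x x' y) = y := by
  rw [transition, symm_transition hy, (extChartAt (𝓡 2) x).right_inv hy.1]

variable [IsManifold (𝓡 2) ∞ M]

lemma contDiffOn_transition (x x' : M) :
    ContDiffOn ℝ ∞ (transition x x') (overlap x x') := by
  rw [← contMDiffOn_iff_contDiffOn]
  exact (contMDiffOn_extChartAt (I := 𝓡 2) (x := x')).comp
    ((contMDiffOn_extChartAt_symm (I := 𝓡 2) (n := ∞) x).mono inter_subset_left)
    (fun y hy ↦ by simpa using hy.2)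

lemma differentiableAt_transition {x x' : M} {y : Plane} (hy : y ∈ overlap x x') :
    DifferentiableAt ℝ (transition x x') y :=
  ((contDiffOn_transition x x').contDiffAt ((isOpen_overlap x x').mem_nhds hy)).differentiableAt
    (by simp)

lemma fderiv_transition_comp {x x' : M} {y : Plane} (hy : y ∈ overlap x x') :
    (fderiv ℝ (transition x' x) (transition x x' y)).comp (fderiv ℝ (transition x x') y) =
      ContinuousLinearMap.id ℝ Plane := by
  have hid : transition x' x ∘ transition x x' =ᶠ[𝓝 y] id := by
    filter_upwards [(isOpen_overlap x x').mem_nhds hy] with z hz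
    exact transition_transition hz
  rw [← fderiv_comp y (differentiableAt_transition (transition_mem_overlap hy))
    (differentiableAt_transition hy), hid.fderiv_eq, fderiv_id]

/-- The Jacobian matrix of the change of coordinates `transition x x'`. -/
def jacobian (x x' : M) (y : Plane) : Matrix (Fin 2) (Fin 2) ℝ :=
  Matrix.of fun i j ↦ fderiv ℝ (transition x x') y (EuclideanSpace.single j 1) i

omit [IsManifold (𝓡 2) ∞ M] in
lemma det_jacobian (x x' : M) (y : Plane) :
    (jacobian x x' y).det = (fderiv ℝ (transition x x') y).det :=
  (det_eq_det_of_single _).symm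

lemma isUnit_det_jacobian {x x' : M} {y : Plane} (hy : y ∈ overlap x x') :
    IsUnit (jacobian x x' y).det := by
  have h : (fderiv ℝ (transition x' x) (transition x x' y)).det *
      (fderiv ℝ (transition x x') y).det = 1 := by
    simpa [ContinuousLinearMap.det] using
      congrArg ContinuousLinearMap.det (fderiv_transition_comp hy)
  rw [det_jacobian]
  exact IsUnit.of_mul_eq_one_right _ h

lemma contDiffAt_comp_symm {x : M} {y : Plane} (hy : y ∈ (extChartAt (𝓡 2) x).target)
    {u : M → ℝ} {n : ℕ∞ω} (hn : n ≤ (∞ : ℕ∞ω))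
    (hu : ContMDiffAt (𝓡 2) 𝓘(ℝ, ℝ) n u ((extChartAt (𝓡 2) x).symm y)) :
    ContDiffAt ℝ n (u ∘ (extChartAt (𝓡 2) x).symm) y := by
  rw [← contMDiffAt_iff_contDiffAt]
  exact hu.comp y (((contMDiffOn_extChartAt_symm (I := 𝓡 2) (n := ∞) x).contMDiffAt
    ((isOpen_extChartAt_target x).mem_nhds hy)).of_le hn)

lemma contDiffOn_comp_symm (x : M) {u : M → ℝ} {Ω : Set M} (hΩ : IsOpen Ω) {n : ℕ∞ω}
    (hn : n ≤ (∞ : ℕ∞ω)) (hu : ContMDiffOn (𝓡 2) 𝓘(ℝ, ℝ) n u Ω) :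
    ContDiffOn ℝ n (u ∘ (extChartAt (𝓡 2) x).symm) (chartPreimage x Ω) := fun _ hy ↦
  (contDiffAt_comp_symm hy.1 hn (hu.contMDiffAt (hΩ.mem_nhds hy.2))).contDiffWithinAt

lemma fderiv_comp_symm_transition {x x' : M} {y : Plane} (hy : y ∈ overlap x x') {u : M → ℝ}
    (hu : ContMDiffAt (𝓡 2) 𝓘(ℝ, ℝ) 1 u ((extChartAt (𝓡 2) x).symm y)) :
    fderiv ℝ (u ∘ (extChartAt (𝓡 2) x).symm) y =
      (fderiv ℝ (u ∘ (extChartAt (𝓡 2) x').symm) (transition x x' y)).comp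
        (fderiv ℝ (transition x x') y) := by
  have hcomp : u ∘ (extChartAt (𝓡 2) x).symm =ᶠ[𝓝 y]
      (u ∘ (extChartAt (𝓡 2) x').symm) ∘ transition x x' := by
    filter_upwards [(isOpen_overlap x x').mem_nhds hy] with z hz
    simp only [Function.comp, symm_transition hz]
  have hd : DifferentiableAt ℝ (u ∘ (extChartAt (𝓡 2) x').symm) (transition x x' y) :=
    (contDiffAt_comp_symm (transition_mem_overlap hy).1 (by simp)
      (by rwa [symm_transition hy])).differentiableAt one_ne_zero
  rw [hcomp.fderiv_eq, fderiv_comp y hd (differentiableAt_transition hy)]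

lemma partialDeriv_transition {x x' : M} {y : Plane} (hy : y ∈ overlap x x') {u : M → ℝ}
    (hu : ContMDiffAt (𝓡 2) 𝓘(ℝ, ℝ) 1 u ((extChartAt (𝓡 2) x).symm y)) :
    (fun i ↦ partialDeriv i (u ∘ (extChartAt (𝓡 2) x).symm) y) =
      (jacobian x x' y).transpose.mulVec fun j ↦
        partialDeriv j (u ∘ (extChartAt (𝓡 2) x').symm) (transition x x' y) := by
  funext i
  rw [partialDeriv, fderiv_comp_symm_transition hy hu, ContinuousLinearMap.comp_apply,
    fderiv_apply_eq_sum]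
  rfl

/-- The derivative of the inverse of the preferred chart around `x`, at the coordinate point `y`. -/
def symmDeriv (x : M) (y : Plane) :
    Plane →L[ℝ] TangentSpace (𝓡 2) ((extChartAt (𝓡 2) x).symm y) :=
  mfderiv 𝓘(ℝ, Plane) (𝓡 2) (extChartAt (𝓡 2) x).symm y

lemma mdifferentiableAt_symm (x : M) {y : Plane} (hy : y ∈ (extChartAt (𝓡 2) x).target) :
    MDifferentiableAt 𝓘(ℝ, Plane) (𝓡 2) (extChartAt (𝓡 2) x).symm y :=
  ((contMDiffOn_extChartAt_symm (I := 𝓡 2) (n := ∞) x).contMDiffAt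
    ((isOpen_extChartAt_target x).mem_nhds hy)).mdifferentiableAt (by simp)

/-- An equality in the plane: `TangentSpace` carries a base point which differs on the two sides. -/
lemma symmDeriv_eq_comp {x x' : M} {y : Plane} (hy : y ∈ overlap x x') :
    (symmDeriv x y : Plane →L[ℝ] Plane) =
      ContinuousLinearMap.comp (symmDeriv x' (transition x x' y) : Plane →L[ℝ] Plane)
        (fderiv ℝ (transition x x') y) := by
  have hsymm : (extChartAt (𝓡 2) x).symm =ᶠ[𝓝 y]
      (extChartAt (𝓡 2) x').symm ∘ transition x x' := by
    filter_upwards [(isOpen_overlap x x').mem_nhds hy] with z hz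
    exact (symm_transition hz).symm
  have hchain := ((mdifferentiableAt_symm x' (transition_mem_overlap hy).1).hasMFDerivAt.comp y
    (differentiableAt_transition hy).mdifferentiableAt.hasMFDerivAt).congr_of_eventuallyEq hsymm
  rw [mfderiv_eq_fderiv] at hchain
  exact hchain.mfderiv

lemma symmDeriv_injective (x : M) {y : Plane} (hy : y ∈ (extChartAt (𝓡 2) x).target) :
    Function.Injective (symmDeriv x y) := by
  have h := (isInvertible_mfderivWithin_extChartAt_symm (I := 𝓡 2) hy).injective
  rwa [ModelWithCorners.range_eq_univ, mfderivWithin_univ] at h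

lemma contMDiffOn_coordVector (x : M) (i : Fin 2) :
    ContMDiffOn 𝓘(ℝ, Plane) ((𝓡 2).prod 𝓘(ℝ, Plane)) ∞
      (fun y ↦ (TotalSpace.mk' Plane ((extChartAt (𝓡 2) x).symm y) (coordVector x y i) :
        TangentBundle (𝓡 2) M))
      (extChartAt (𝓡 2) x).target := by
  have hsymm := (contMDiffOn_extChartAt_symm (I := 𝓡 2) (n := ∞) x).contMDiffOn_tangentMapWithin
    (m := ∞) (by simp) (isOpen_extChartAt_target x).uniqueMDiffOn
  have hsingle : ContMDiff 𝓘(ℝ, Plane) (𝓘(ℝ, Plane).prod 𝓘(ℝ, Plane)) ∞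
      (fun y ↦ (TotalSpace.mk' Plane y (EuclideanSpace.single i (1 : ℝ)) :
        TangentBundle 𝓘(ℝ, Plane) Plane)) := by
    intro y
    rw [contMDiffAt_totalSpace]
    exact ⟨contMDiffAt_id, by simpa using contMDiffAt_const⟩
  refine (hsymm.comp (hsingle.contMDiffOn (s := (extChartAt (𝓡 2) x).target))
    fun y hy ↦ by simpa using hy).congr fun y hy ↦ ?_
  simp only [Function.comp, tangentMapWithin, coordVector]
  rw [mfderivWithin_of_isOpen (isOpen_extChartAt_target x) hy]

end Coordinates

section Metric

variable {M : Type*} [TopologicalSpace M] [ChartedSpace Plane M]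
  [RiemannianBundle (fun x : M ↦ TangentSpace (𝓡 2) x)]

/-- The Riemannian metric at the point of coordinates `y` in the preferred chart around `x`, as a
form on the plane. -/
def chartMetric (x : M) (y v w : Plane) : ℝ :=
  inner ℝ (symmDeriv x y v) (symmDeriv x y w)

lemma chartMetric_self (x : M) (y v : Plane) : chartMetric x y v v = ‖symmDeriv x y v‖ ^ 2 :=
  real_inner_self_eq_norm_sq _

lemma gram_apply (x : M) (y : Plane) (i j : Fin 2) :
    gram x y i j = chartMetric x y (EuclideanSpace.single i 1) (EuclideanSpace.single j 1) := rfl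

lemma chartMetric_eq_sum (x : M) (y v w : Plane) :
    chartMetric x y v w = ∑ i : Fin 2, ∑ j : Fin 2, v i * w j * gram x y i j := by
  conv_lhs => rw [chartMetric, eq_sum_smul_single v, eq_sum_smul_single w, map_sum, map_sum]
  simp only [Fin.sum_univ_two, map_smul, inner_add_left, inner_add_right, real_inner_smul_left,
    real_inner_smul_right, gram_apply, chartMetric]
  ring

variable [IsManifold (𝓡 2) ∞ M]

lemma chartMetric_transition {x x' : M} {y : Plane} (hy : y ∈ overlap x x') (v w : Plane) :
    chartMetric x y v w = chartMetric x' (transition x x' y) (fderiv ℝ (transition x x') y v)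
      (fderiv ℝ (transition x x') y w) := by
  have hpoint : ∀ p q : M, p = q → ∀ a b : Plane,
      @inner ℝ (TangentSpace (𝓡 2) p) _ a b = @inner ℝ (TangentSpace (𝓡 2) q) _ a b := by
    rintro p _ rfl a b; rfl
  have hchain := DFunLike.congr_fun (symmDeriv_eq_comp hy)
  exact (hpoint _ _ (symm_transition hy).symm _ _).trans
    (congrArg₂ (@inner ℝ (TangentSpace (𝓡 2) _) _) (hchain v) (hchain w))

lemma chartMetric_self_pos (x : M) {y v : Plane} (hy : y ∈ (extChartAt (𝓡 2) x).target)
    (hv : v ≠ 0) : 0 < chartMetric x y v v :=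
  real_inner_self_pos.2 ((map_ne_zero_iff _ (symmDeriv_injective x hy)).2 hv)

lemma posDef_gram (x : M) {y : Plane} (hy : y ∈ (extChartAt (𝓡 2) x).target) :
    (gram x y).PosDef := by
  have hbasis : coordVector x y = symmDeriv x y ∘ (EuclideanSpace.basisFun (Fin 2) ℝ).toBasis := by
    funext i
    exact congrArg (symmDeriv x y) (by simp)
  have hindep : LinearIndependent ℝ (coordVector x y) := by
    rw [hbasis]
    exact (EuclideanSpace.basisFun (Fin 2) ℝ).toBasis.linearIndependent.map'
      (symmDeriv x y).toLinearMap (LinearMap.ker_eq_bot.2 (symmDeriv_injective x hy))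
  exact Matrix.posDef_gram_of_linearIndependent hindep

lemma gram_transition {x x' : M} {y : Plane} (hy : y ∈ overlap x x') :
    gram x y = (jacobian x x' y).transpose * gram x' (transition x x' y) * jacobian x x' y := by
  ext i j
  rw [gram_apply, chartMetric_transition hy, chartMetric_eq_sum]
  simp only [Matrix.mul_apply, Matrix.transpose_apply, jacobian, Matrix.of_apply,
    Fin.sum_univ_two]
  ring

lemma areaDensity_pos (x : M) {y : Plane} (hy : y ∈ (extChartAt (𝓡 2) x).target) :
    0 < areaDensity x y := Real.sqrt_pos.2 (posDef_gram x hy).det_pos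

lemma areaDensity_transition {x x' : M} {y : Plane} (hy : y ∈ overlap x x') :
    areaDensity x y =
      |(fderiv ℝ (transition x x') y).det| * areaDensity x' (transition x x' y) := by
  have hdet : (gram x y).det =
      (fderiv ℝ (transition x x') y).det ^ 2 * (gram x' (transition x x' y)).det := by
    rw [gram_transition hy, Matrix.det_mul, Matrix.det_mul, Matrix.det_transpose, det_jacobian]
    ring
  rw [areaDensity, hdet, Real.sqrt_mul (sq_nonneg _), Real.sqrt_sq_eq_abs, areaDensity]

variable [IsContMDiffRiemannianBundle (𝓡 2) ∞ Plane (fun x : M ↦ TangentSpace (𝓡 2) x)]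

lemma contDiffOn_gram (x : M) (i j : Fin 2) :
    ContDiffOn ℝ ∞ (fun y ↦ gram x y i j) (extChartAt (𝓡 2) x).target := by
  rw [← contMDiffOn_iff_contDiffOn]
  exact (contMDiffOn_coordVector x i).inner_bundle (contMDiffOn_coordVector x j)

lemma contDiffOn_gram_det (x : M) :
    ContDiffOn ℝ ∞ (fun y ↦ (gram x y).det) (extChartAt (𝓡 2) x).target := by
  simp only [Matrix.det_fin_two]
  exact ((contDiffOn_gram x 0 0).mul (contDiffOn_gram x 1 1)).sub
    ((contDiffOn_gram x 0 1).mul (contDiffOn_gram x 1 0))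

lemma contDiffOn_areaDensity (x : M) :
    ContDiffOn ℝ ∞ (areaDensity x) (extChartAt (𝓡 2) x).target :=
  (contDiffOn_gram_det x).sqrt fun _ hy ↦ (posDef_gram x hy).det_pos.ne'

lemma contDiffOn_gram_inv (x : M) (i j : Fin 2) :
    ContDiffOn ℝ ∞ (fun y ↦ (gram x y)⁻¹ i j) (extChartAt (𝓡 2) x).target := by
  simp only [Matrix.inv_def, Ring.inverse_eq_inv', Matrix.smul_apply, smul_eq_mul,
    Matrix.adjugate_fin_two]
  refine ((contDiffOn_gram_det x).inv fun y hy ↦ (posDef_gram x hy).det_pos.ne').mul ?_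
  fin_cases i <;> fin_cases j
  · exact contDiffOn_gram x 1 1
  · exact (contDiffOn_gram x 0 1).neg
  · exact (contDiffOn_gram x 1 0).neg
  · exact contDiffOn_gram x 0 0

lemma continuousOn_chartMetric_self (x : M) :
    ContinuousOn (fun q : Plane × Plane ↦ chartMetric x q.1 q.2 q.2)
      ((extChartAt (𝓡 2) x).target ×ˢ univ) := by
  simp only [chartMetric_eq_sum]
  refine continuousOn_finsetSum _ fun i _ ↦ continuousOn_finsetSum _ fun j _ ↦ ?_
  exact ContinuousOn.mul (by fun_prop)
    ((contDiffOn_gram x i j).continuousOn.comp continuousOn_fst fun q hq ↦ hq.1)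

end Metric

lemma restrict_iSup_le {ι α : Type*} [MeasurableSpace α] {m : ι → Measure α} {ν : Measure α}
    {s : Set α} (hs : MeasurableSet s) (h : ∀ i, (m i).restrict s ≤ ν) :
    (⨆ i, m i).restrict s ≤ ν := by
  have hle : ⨆ i, m i ≤ ν + (⨆ i, m i).restrict sᶜ := by
    refine iSup_le fun i ↦ ?_
    rw [← Measure.restrict_add_restrict_compl (μ := m i) hs]
    exact add_le_add (h i) (Measure.restrict_mono le_rfl (le_iSup m i))
  refine (Measure.restrict_mono (le_refl s) hle).trans ?_
  rw [Measure.restrict_add, Measure.restrict_restrict hs, inter_compl_self, Measure.restrict_empty,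
    add_zero]
  exact Measure.restrict_le_self

section Area

variable {M : Type*} [TopologicalSpace M] [ChartedSpace Plane M] [MeasurableSpace M] [BorelSpace M]

lemma measurableSet_source (x : M) : MeasurableSet (extChartAt (𝓡 2) x).source :=
  (isOpen_extChartAt_source x).measurableSet

omit [MeasurableSpace M] [BorelSpace M] in
lemma measurableSet_target (x : M) : MeasurableSet (extChartAt (𝓡 2) x).target :=
  (isOpen_extChartAt_target x).measurableSet

lemma measurableSet_chartPreimage (x : M) {s : Set M} (hs : MeasurableSet s) :
    MeasurableSet (chartPreimage x s) := by
  have h := (measurableSet_target x).subtype_image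
    ((continuousOn_extChartAt_symm (I := 𝓡 2) x).domRestrict.measurable hs)
  rwa [domRestrict_eq, preimage_comp, Subtype.image_preimage_coe] at h

lemma aemeasurable_symm (x : M) : AEMeasurable (extChartAt (𝓡 2) x).symm
    (volume.restrict (extChartAt (𝓡 2) x).target) :=
  (continuousOn_extChartAt_symm x).aemeasurable (measurableSet_target x)

omit [MeasurableSpace M] [BorelSpace M] in
lemma transition_image_chartPreimage (x x' : M) {s : Set M}
    (hs : s ⊆ (extChartAt (𝓡 2) x).source) (hs' : s ⊆ (extChartAt (𝓡 2) x').source) :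
    transition x x' '' chartPreimage x s = chartPreimage x' s := by
  refine Subset.antisymm ?_ fun z hz ↦ ?_
  · rintro _ ⟨y, hy, rfl⟩
    exact transition_mem_chartPreimage ⟨hy.1, hs' hy.2⟩ hy.2
  · have hz' : z ∈ overlap x' x := ⟨hz.1, hs hz.2⟩
    exact ⟨transition x' x z, transition_mem_chartPreimage hz' hz.2, transition_transition hz'⟩

variable [IsManifold (𝓡 2) ∞ M] [RiemannianBundle (fun x : M ↦ TangentSpace (𝓡 2) x)]
  [IsContMDiffRiemannianBundle (𝓡 2) ∞ Plane (fun x : M ↦ TangentSpace (𝓡 2) x)]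

omit [MeasurableSpace M] [BorelSpace M] in
lemma aemeasurable_areaDensity (x : M) :
    AEMeasurable (areaDensity x) (volume.restrict (extChartAt (𝓡 2) x).target) :=
  (contDiffOn_areaDensity x).continuousOn.aemeasurable (measurableSet_target x)

lemma setLIntegral_chartArea (x : M) {s : Set M} (hs : MeasurableSet s) {F : M → ℝ≥0∞}
    (hF : Measurable F) :
    ∫⁻ p in s, F p ∂chartArea x = ∫⁻ y in chartPreimage x s,
      ENNReal.ofReal (areaDensity x y) * F ((extChartAt (𝓡 2) x).symm y) := by
  have hsymm := (aemeasurable_symm x).mono_ac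
    (withDensity_absolutelyContinuous _ fun y ↦ ENNReal.ofReal (areaDensity x y))
  rw [← lintegral_indicator hs, chartArea,
    lintegral_map' (hF.indicator hs).aemeasurable hsymm,
    lintegral_withDensity_eq_lintegral_mul₀' (aemeasurable_areaDensity x).ennreal_ofReal
      (g := fun y ↦ s.indicator F ((extChartAt (𝓡 2) x).symm y))
      ((hF.indicator hs).comp_aemeasurable hsymm),
    ← lintegral_indicator (measurableSet_target x),
    ← lintegral_indicator (measurableSet_chartPreimage x hs)]
  rw [chartPreimage, ← indicator_indicator]
  refine lintegral_congr fun y ↦ congrFun (congrArg (indicator _) (funext fun y ↦ ?_)) y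
  exact (indicator_mul_right ((extChartAt (𝓡 2) x).symm ⁻¹' s)
    (fun y ↦ ENNReal.ofReal (areaDensity x y)) fun y ↦ F ((extChartAt (𝓡 2) x).symm y)).symm

lemma chartArea_apply (x : M) {s : Set M} (hs : MeasurableSet s) :
    chartArea x s = ∫⁻ y in chartPreimage x s, ENNReal.ofReal (areaDensity x y) := by
  simpa using setLIntegral_chartArea x hs (F := 1) measurable_one

lemma chartArea_eq_of_subset (x x' : M) {s : Set M} (hm : MeasurableSet s)
    (hs : s ⊆ (extChartAt (𝓡 2) x).source) (hs' : s ⊆ (extChartAt (𝓡 2) x').source) :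
    chartArea x s = chartArea x' s := by
  have hsub : ∀ y ∈ chartPreimage x s, y ∈ overlap x x' := fun y hy ↦ ⟨hy.1, hs' hy.2⟩
  have hinj : InjOn (transition x x') (chartPreimage x s) := fun y hy z hz h ↦ by
    rw [← transition_transition (hsub y hy), h, transition_transition (hsub z hz)]
  rw [chartArea_apply x hm, chartArea_apply x' hm, ← transition_image_chartPreimage x x' hs hs',
    lintegral_image_eq_lintegral_abs_det_fderiv_mul volume (measurableSet_chartPreimage x hm)
      (fun y hy ↦ (differentiableAt_transition (hsub y hy)).hasFDerivAt.hasFDerivWithinAt) hinj]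
  refine setLIntegral_congr_fun (measurableSet_chartPreimage x hm) fun y hy ↦ ?_
  rw [areaDensity_transition (hsub y hy), ENNReal.ofReal_mul (abs_nonneg _)]

lemma chartArea_restrict_source (x : M) :
    (chartArea x).restrict (extChartAt (𝓡 2) x).source = chartArea x := by
  refine Measure.restrict_eq_self_of_ae_mem ?_
  change chartArea x (extChartAt (𝓡 2) x).sourceᶜ = 0
  have hempty : chartPreimage x (extChartAt (𝓡 2) x).sourceᶜ = ∅ :=
    eq_empty_of_forall_notMem fun y hy ↦ hy.2 ((extChartAt (𝓡 2) x).map_target hy.1)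
  rw [chartArea_apply x (measurableSet_source x).compl, hempty, setLIntegral_empty]

lemma area_restrict_source (x : M) :
    (area M).restrict (extChartAt (𝓡 2) x).source = chartArea x := by
  refine le_antisymm ?_ ?_
  · refine restrict_iSup_le (measurableSet_source x) fun x' ↦ Measure.le_iff.2 fun s hs ↦ ?_
    rw [Measure.restrict_apply hs, ← chartArea_restrict_source x',
      Measure.restrict_apply (hs.inter (measurableSet_source x)),
      chartArea_eq_of_subset x' x
        ((hs.inter (measurableSet_source x)).inter (measurableSet_source x'))
        inter_subset_right (inter_subset_left.trans inter_subset_right)]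
    exact measure_mono (inter_subset_left.trans inter_subset_left)
  · rw [← chartArea_restrict_source x]
    exact Measure.restrict_mono le_rfl (le_iSup chartArea x)

lemma setLIntegral_area (x : M) {s : Set M} (hs : MeasurableSet s)
    (hsx : s ⊆ (extChartAt (𝓡 2) x).source) {F : M → ℝ≥0∞} (hF : Measurable F) :
    ∫⁻ p in s, F p ∂area M = ∫⁻ y in chartPreimage x s,
      ENNReal.ofReal (areaDensity x y) * F ((extChartAt (𝓡 2) x).symm y) := by
  rw [← setLIntegral_chartArea x hs hF, ← area_restrict_source,
    Measure.restrict_restrict hs, inter_eq_left.2 hsx]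

lemma area_apply (x : M) {s : Set M} (hs : MeasurableSet s)
    (hsx : s ⊆ (extChartAt (𝓡 2) x).source) :
    area M s = ∫⁻ y in chartPreimage x s, ENNReal.ofReal (areaDensity x y) := by
  simpa using setLIntegral_area x hs hsx (F := 1) measurable_one

lemma integral_area_eq (x : M) {F : M → ℝ} (hF : AEStronglyMeasurable F (area M))
    (hFx : Function.support F ⊆ (extChartAt (𝓡 2) x).source) :
    ∫ p, F p ∂area M =
      ∫ y in (extChartAt (𝓡 2) x).target, areaDensity x y * F ((extChartAt (𝓡 2) x).symm y) := by
  have hF' := hF.restrict (s := (extChartAt (𝓡 2) x).source)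
  rw [← setIntegral_eq_integral_of_forall_compl_eq_zero
    fun p hp ↦ Function.notMem_support.1 fun h ↦ hp (hFx h)]
  rw [area_restrict_source, chartArea] at hF' ⊢
  rw [integral_map ((aemeasurable_symm x).mono_ac (withDensity_absolutelyContinuous _ _)) hF',
    integral_withDensity_eq_integral_toReal_smul₀ (aemeasurable_areaDensity x).ennreal_ofReal
      (by simp)]
  refine setIntegral_congr_fun (measurableSet_target x) fun y hy ↦ ?_
  simp only [ENNReal.toReal_ofReal (areaDensity_pos x hy).le, smul_eq_mul]

instance isLocallyFiniteMeasure_area : IsLocallyFiniteMeasure (area M) := by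
  refine ⟨fun p ↦ ?_⟩
  obtain ⟨r, hr, hrt⟩ := Metric.nhds_basis_closedBall.mem_iff.1
    (extChartAt_target_mem_nhds (I := 𝓡 2) p)
  have hopen : IsOpen ((extChartAt (𝓡 2) p).source ∩
      extChartAt (𝓡 2) p ⁻¹' Metric.ball (extChartAt (𝓡 2) p p) r) :=
    (continuousOn_extChartAt p).isOpen_inter_preimage (isOpen_extChartAt_source p)
      Metric.isOpen_ball
  refine ⟨_, hopen.mem_nhds ⟨mem_extChartAt_source p, Metric.mem_ball_self hr⟩, ?_⟩
  rw [area_apply p hopen.measurableSet inter_subset_left]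
  have hint : IntegrableOn (areaDensity p) (Metric.closedBall (extChartAt (𝓡 2) p p) r) :=
    ((contDiffOn_areaDensity p).continuousOn.mono hrt).integrableOn_compact
      (isCompact_closedBall _ r)
  refine lt_of_le_of_lt (lintegral_mono_set ?_) hint.lintegral_lt_top
  rintro z ⟨hz, -, hzr⟩
  rw [mem_preimage, (extChartAt (𝓡 2) p).right_inv hz] at hzr
  exact Metric.ball_subset_closedBall hzr

instance isOpenPosMeasure_area : (area M).IsOpenPosMeasure := by
  refine ⟨fun U hU ⟨p, hp⟩ h0 ↦ ?_⟩
  have hV : IsOpen (chartPreimage p U) := isOpen_chartPreimage p hU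
  have hzero : chartArea p U = 0 :=
    le_antisymm ((Measure.le_iff'.1 (le_iSup chartArea p) U).trans h0.le) bot_le
  rw [chartArea_apply p hU.measurableSet, setLIntegral_eq_zero_iff' hV.measurableSet
    ((aemeasurable_areaDensity p).ennreal_ofReal.mono_set inter_subset_left)] at hzero
  have hsub : chartPreimage p U ⊆
      {y | ¬ (y ∈ chartPreimage p U → ENNReal.ofReal (areaDensity p y) = 0)} := fun y hy h ↦
    (ENNReal.ofReal_pos.2 (areaDensity_pos p hy.1)).ne' (h hy)
  exact (hV.measure_pos volume ⟨_, mem_chartPreimage_of_mem (mem_extChartAt_source p) hp⟩).ne'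
    (measure_mono_null hsub (ae_iff.1 hzero))

end Area

section Gradient

/-- The gradient of `w` rotated by a right angle, which is tangent to the level lines of `w`. -/
def levelDir (w : Plane → ℝ) (y : Plane) : Plane :=
  !₂[- partialDeriv 1 w y, partialDeriv 0 w y]

variable {M : Type*} [TopologicalSpace M] [ChartedSpace Plane M]
  [RiemannianBundle (fun x : M ↦ TangentSpace (𝓡 2) x)]

/-- The pairing `⟨∇u, ∇φ⟩ = ∑ gⁱʲ ∂ᵢφ ∂ⱼu`, read in the preferred chart around `x`. -/
def chartGradInner (x : M) (u φ : M → ℝ) (y : Plane) : ℝ :=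
  ∑ i : Fin 2, ∑ j : Fin 2, (gram x y)⁻¹ i j *
    partialDeriv i (φ ∘ (extChartAt (𝓡 2) x).symm) y *
    partialDeriv j (u ∘ (extChartAt (𝓡 2) x).symm) y

/-- The pairing `⟨∇u, ∇φ⟩` of the gradients of two functions on a Riemannian surface. -/
def gradInner (u φ : M → ℝ) (p : M) : ℝ :=
  chartGradInner p u φ (extChartAt (𝓡 2) p p)

/-- The `i`-th component `√g ∑ⱼ gⁱʲ ∂ⱼu` of the weighted gradient, in the preferred chart around
`x`. -/
def chartFlux (x : M) (u : M → ℝ) (i : Fin 2) (y : Plane) : ℝ :=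
  areaDensity x y * ∑ j : Fin 2, (gram x y)⁻¹ i j *
    partialDeriv j (u ∘ (extChartAt (𝓡 2) x).symm) y

/-- The Laplace-Beltrami operator read in the preferred chart around `x`. -/
def chartLaplacian (x : M) (u : M → ℝ) (y : Plane) : ℝ :=
  (areaDensity x y)⁻¹ * ∑ i : Fin 2, partialDeriv i (chartFlux x u i) y

lemma chartGradInner_eq_dotProduct (x : M) (u φ : M → ℝ) (y : Plane) :
    chartGradInner x u φ y =
      (fun i ↦ partialDeriv i (φ ∘ (extChartAt (𝓡 2) x).symm) y) ⬝ᵥ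
        ((gram x y)⁻¹.mulVec fun j ↦ partialDeriv j (u ∘ (extChartAt (𝓡 2) x).symm) y) := by
  simp only [chartGradInner, dotProduct, Matrix.mulVec, Fin.sum_univ_two]
  ring

lemma areaDensity_mul_chartGradInner (x : M) (u φ : M → ℝ) (y : Plane) :
    areaDensity x y * chartGradInner x u φ y =
      ∑ i : Fin 2, chartFlux x u i y * partialDeriv i (φ ∘ (extChartAt (𝓡 2) x).symm) y := by
  simp only [chartGradInner, chartFlux, Fin.sum_univ_two]
  ring

omit [RiemannianBundle (fun x : M ↦ TangentSpace (𝓡 2) x)] in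
lemma partialDeriv_comp_symm_eq_zero {φ : M → ℝ} {x : M} {y : Plane}
    (hy : y ∈ (extChartAt (𝓡 2) x).target)
    (hφ : (extChartAt (𝓡 2) x).symm y ∉ tsupport φ) (i : Fin 2) :
    partialDeriv i (φ ∘ (extChartAt (𝓡 2) x).symm) y = 0 := by
  have hzero : φ ∘ (extChartAt (𝓡 2) x).symm =ᶠ[𝓝 y] fun _ ↦ (0 : ℝ) :=
    (notMem_tsupport_iff_eventuallyEq.1 hφ).comp_tendsto
      ((continuousOn_extChartAt_symm x).continuousAt ((isOpen_extChartAt_target x).mem_nhds hy))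
  rw [partialDeriv, hzero.fderiv_eq, fderiv_fun_const, Pi.zero_apply, zero_apply]

lemma gradInner_eq_zero {u φ : M → ℝ} {p : M} (hp : p ∉ tsupport φ) : gradInner u φ p = 0 := by
  have hzero : ∀ i, partialDeriv i (φ ∘ (extChartAt (𝓡 2) p).symm) (extChartAt (𝓡 2) p p) = 0 :=
    partialDeriv_comp_symm_eq_zero (mem_extChartAt_target p) (by rwa [extChartAt_to_inv])
  simp only [gradInner, chartGradInner, hzero, mul_zero, zero_mul, Finset.sum_const_zero]

variable [IsManifold (𝓡 2) ∞ M]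

lemma chartGradInner_transition {x x' : M} {y : Plane} (hy : y ∈ overlap x x') {u φ : M → ℝ}
    (hu : ContMDiffAt (𝓡 2) 𝓘(ℝ, ℝ) 1 u ((extChartAt (𝓡 2) x).symm y))
    (hφ : ContMDiffAt (𝓡 2) 𝓘(ℝ, ℝ) 1 φ ((extChartAt (𝓡 2) x).symm y)) :
    chartGradInner x u φ y = chartGradInner x' u φ (transition x x' y) := by
  rw [chartGradInner_eq_dotProduct, chartGradInner_eq_dotProduct, partialDeriv_transition hy hu,
    partialDeriv_transition hy hφ, gram_transition hy]
  have hJ := isUnit_det_jacobian hy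
  set J := jacobian x x' y
  rw [Matrix.mul_inv_rev, Matrix.mul_inv_rev, Matrix.mulVec_mulVec, Matrix.mul_assoc,
    Matrix.mul_assoc, Matrix.nonsing_inv_mul _ (by rwa [Matrix.det_transpose]), Matrix.mul_one,
    ← Matrix.mulVec_mulVec, Matrix.mulVec_transpose, ← Matrix.dotProduct_mulVec,
    Matrix.mulVec_mulVec, Matrix.mul_nonsing_inv _ hJ, Matrix.one_mulVec]

lemma gradInner_eq_chartGradInner {x p : M} (hp : p ∈ (extChartAt (𝓡 2) x).source) {u φ : M → ℝ}
    (hu : ContMDiffAt (𝓡 2) 𝓘(ℝ, ℝ) 1 u p) (hφ : ContMDiffAt (𝓡 2) 𝓘(ℝ, ℝ) 1 φ p) :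
    gradInner u φ p = chartGradInner x u φ (extChartAt (𝓡 2) x p) := by
  have hmem : extChartAt (𝓡 2) p p ∈ overlap p x :=
    mem_chartPreimage_of_mem (mem_extChartAt_source p) hp
  rw [gradInner, chartGradInner_transition hmem (by rwa [extChartAt_to_inv])
    (by rwa [extChartAt_to_inv]), transition, extChartAt_to_inv]

lemma areaDensity_sq_mul_chartGradInner_self {x : M} {y : Plane}
    (hy : y ∈ (extChartAt (𝓡 2) x).target) (u : M → ℝ) :
    areaDensity x y ^ 2 * chartGradInner x u u y =
      chartMetric x y (levelDir (u ∘ (extChartAt (𝓡 2) x).symm) y)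
        (levelDir (u ∘ (extChartAt (𝓡 2) x).symm) y) := by
  have hdet := (posDef_gram x hy).det_pos
  rw [areaDensity, Real.sq_sqrt hdet.le, chartMetric_eq_sum, chartGradInner]
  simp only [Fin.sum_univ_two, Matrix.inv_def, Matrix.adjugate_fin_two, Matrix.smul_apply,
    Ring.inverse_eq_inv', smul_eq_mul, levelDir, Matrix.of_apply, Matrix.cons_val',
    Matrix.cons_val_zero, Matrix.cons_val_one, Matrix.cons_val_fin_one]
  field_simp
  ring

lemma gradInner_self_nonneg (u : M → ℝ) (p : M) : 0 ≤ gradInner u u p := by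
  have hy := mem_extChartAt_target (I := 𝓡 2) p
  refine nonneg_of_mul_nonneg_right (a := areaDensity p (extChartAt (𝓡 2) p p) ^ 2) ?_
    (pow_pos (areaDensity_pos p hy) 2)
  rw [gradInner, areaDensity_sq_mul_chartGradInner_self hy, chartMetric_self]
  positivity

lemma gradInner_finset_sum {ι : Type*} (s : Finset ι) {u : M → ℝ} {φ : ι → M → ℝ} {p : M}
    (hφ : ∀ k ∈ s, ContMDiffAt (𝓡 2) 𝓘(ℝ, ℝ) 1 (φ k) p) :
    gradInner u (fun q ↦ ∑ k ∈ s, φ k q) p = ∑ k ∈ s, gradInner u (φ k) p := by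
  set e := extChartAt (𝓡 2) p
  have hsum : ∀ i, partialDeriv i ((fun q ↦ ∑ k ∈ s, φ k q) ∘ e.symm) (e p) =
      ∑ k ∈ s, partialDeriv i (φ k ∘ e.symm) (e p) := fun i ↦ by
    change fderiv ℝ (fun y ↦ ∑ k ∈ s, (φ k ∘ e.symm) y) (e p) _ = _
    rw [fderiv_fun_sum fun k hk ↦ ContDiffAt.differentiableAt (contDiffAt_comp_symm
      (mem_extChartAt_target p) (by simp) (by rw [extChartAt_to_inv]; exact hφ k hk)) one_ne_zero,
      sum_apply]
    rfl
  simp only [gradInner, chartGradInner, e, hsum, Fin.sum_univ_two, Finset.mul_sum, Finset.sum_mul,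
    ← Finset.sum_add_distrib]

lemma gradInner_comp {u : M → ℝ} {p : M} {ψ : ℝ → ℝ} {d : ℝ}
    (hu : ContMDiffAt (𝓡 2) 𝓘(ℝ, ℝ) 1 u p) (hψ : HasDerivAt ψ d (u p)) :
    gradInner u (ψ ∘ u) p = d * gradInner u u p := by
  set e := extChartAt (𝓡 2) p
  have hchain : ∀ i, partialDeriv i ((ψ ∘ u) ∘ e.symm) (e p) =
      d * partialDeriv i (u ∘ e.symm) (e p) := fun i ↦ by
    have hu' : HasFDerivAt (u ∘ e.symm) (fderiv ℝ (u ∘ e.symm) (e p)) (e p) :=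
      ((contDiffAt_comp_symm (mem_extChartAt_target p) (by simp)
        (by rwa [extChartAt_to_inv])).differentiableAt one_ne_zero).hasFDerivAt
    have hψ' : HasDerivAt ψ d ((u ∘ e.symm) (e p)) := by
      rwa [Function.comp, extChartAt_to_inv]
    rw [partialDeriv, Function.comp_assoc, (hψ'.comp_hasFDerivAt (e p) hu').fderiv]
    rfl
  simp only [gradInner, chartGradInner, e, hchain, Finset.mul_sum]
  refine Finset.sum_congr rfl fun i _ ↦ Finset.sum_congr rfl fun j _ ↦ ?_
  ring

variable [IsContMDiffRiemannianBundle (𝓡 2) ∞ Plane (fun x : M ↦ TangentSpace (𝓡 2) x)]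

lemma continuousOn_chartGradInner (x : M) {u φ : M → ℝ} {Ω : Set M} (hΩ : IsOpen Ω)
    (hu : ContMDiffOn (𝓡 2) 𝓘(ℝ, ℝ) 1 u Ω) (hφ : ContMDiffOn (𝓡 2) 𝓘(ℝ, ℝ) 1 φ Ω) :
    ContinuousOn (chartGradInner x u φ) (chartPreimage x Ω) := by
  have hpartial : ∀ {w : M → ℝ}, ContMDiffOn (𝓡 2) 𝓘(ℝ, ℝ) 1 w Ω → ∀ i,
      ContinuousOn (partialDeriv i (w ∘ (extChartAt (𝓡 2) x).symm)) (chartPreimage x Ω) :=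
    fun hw i ↦ (contDiffOn_partialDeriv (isOpen_chartPreimage x hΩ)
      (contDiffOn_comp_symm x hΩ (by simp) hw) (m := 0) (by simp) i).continuousOn
  refine continuousOn_finsetSum _ fun i _ ↦ continuousOn_finsetSum _ fun j _ ↦ ?_
  exact (((contDiffOn_gram_inv x i j).continuousOn.mono inter_subset_left).mul
    (hpartial hφ i)).mul (hpartial hu j)

omit [IsManifold (𝓡 2) ∞ M] [RiemannianBundle (fun x : M ↦ TangentSpace (𝓡 2) x)]
  [IsContMDiffRiemannianBundle (𝓡 2) ∞ Plane (fun x : M ↦ TangentSpace (𝓡 2) x)] in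
lemma continuousOn_comp_extChartAt (x : M) {F : Plane → ℝ} {Ω : Set M}
    (hF : ContinuousOn F (chartPreimage x Ω)) :
    ContinuousOn (fun p ↦ F (extChartAt (𝓡 2) x p)) ((extChartAt (𝓡 2) x).source ∩ Ω) :=
  hF.comp ((continuousOn_extChartAt x).mono inter_subset_left)
    fun _ hq ↦ mem_chartPreimage_of_mem hq.1 hq.2

lemma continuousOn_gradInner {u φ : M → ℝ} {Ω : Set M} (hΩ : IsOpen Ω)
    (hu : ContMDiffOn (𝓡 2) 𝓘(ℝ, ℝ) 1 u Ω) (hφ : ContMDiffOn (𝓡 2) 𝓘(ℝ, ℝ) 1 φ Ω) :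
    ContinuousOn (gradInner u φ) Ω := by
  intro p hp
  have hmem : (extChartAt (𝓡 2) p).source ∩ Ω ∈ 𝓝 p :=
    inter_mem (extChartAt_source_mem_nhds p) (hΩ.mem_nhds hp)
  have hc := (continuousOn_comp_extChartAt p (continuousOn_chartGradInner p hΩ hu hφ)).continuousAt
    hmem
  refine (hc.congr ?_).continuousWithinAt
  filter_upwards [hmem] with q hq
  exact (gradInner_eq_chartGradInner hq.1 (hu.contMDiffAt (hΩ.mem_nhds hq.2))
    (hφ.contMDiffAt (hΩ.mem_nhds hq.2))).symm

lemma contDiffOn_chartFlux (x : M) {u : M → ℝ} {Ω : Set M} (hΩ : IsOpen Ω)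
    (hu : ContMDiffOn (𝓡 2) 𝓘(ℝ, ℝ) ∞ u Ω) (i : Fin 2) :
    ContDiffOn ℝ ∞ (chartFlux x u i) (chartPreimage x Ω) := by
  refine ((contDiffOn_areaDensity x).mono inter_subset_left).mul (ContDiffOn.sum fun j _ ↦ ?_)
  exact ((contDiffOn_gram_inv x i j).mono inter_subset_left).mul
    (contDiffOn_partialDeriv (isOpen_chartPreimage x hΩ) (contDiffOn_comp_symm x hΩ le_rfl hu)
      (by simp) j)

lemma continuousOn_chartLaplacian (x : M) {u : M → ℝ} {Ω : Set M} (hΩ : IsOpen Ω)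
    (hu : ContMDiffOn (𝓡 2) 𝓘(ℝ, ℝ) ∞ u Ω) :
    ContinuousOn (fun p ↦ chartLaplacian x u (extChartAt (𝓡 2) x p))
      ((extChartAt (𝓡 2) x).source ∩ Ω) := by
  refine continuousOn_comp_extChartAt x ?_
  refine (((contDiffOn_areaDensity x).continuousOn.mono inter_subset_left).inv₀
    fun y hy ↦ (areaDensity_pos x hy.1).ne').mul (continuousOn_finsetSum _ fun i _ ↦ ?_)
  exact (contDiffOn_partialDeriv (isOpen_chartPreimage x hΩ) (contDiffOn_chartFlux x hΩ hu i)
    (m := ∞) (by simp) i).continuousOn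

end Gradient

section WeakForm

lemma integrable_mul_of_tsupport_subset {X : Type*} [TopologicalSpace X] [T2Space X]
    [MeasurableSpace X] [BorelSpace X] {ν : Measure X} [IsFiniteMeasureOnCompacts ν] {V : Set X}
    {h φ : X → ℝ} (hh : ContinuousOn h V) (hφ : Continuous φ) (hc : HasCompactSupport φ)
    (hV : tsupport φ ⊆ V) : Integrable (fun x ↦ h x * φ x) ν := by
  have hint : IntegrableOn (fun x ↦ h x * φ x) (tsupport φ) ν :=
    ((hh.mono hV).mul hφ.continuousOn).integrableOn_compact hc
  refine (integrableOn_iff_integrable_of_support_subset ?_).1 hint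
  exact (Function.support_mul_subset_right h φ).trans (subset_tsupport φ)

lemma continuous_of_continuousOn_of_eq_zero {X : Type*} [TopologicalSpace X] {K V : Set X}
    {F : X → ℝ} (hK : IsClosed K) (hV : IsOpen V) (hKV : K ⊆ V) (hF : ContinuousOn F V)
    (hzero : ∀ x ∉ K, F x = 0) : Continuous F := by
  rw [continuous_iff_continuousAt]
  intro x
  by_cases hx : x ∈ K
  · exact hF.continuousAt (hV.mem_nhds (hKV hx))
  · refine continuousAt_const.congr (f := fun _ ↦ (0 : ℝ)) ?_
    filter_upwards [hK.isOpen_compl.mem_nhds hx] with z hz using (hzero z hz).symm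

lemma integral_sum_mul_partialDeriv {V : Set Plane} (hV : IsOpen V) {F : Fin 2 → Plane → ℝ}
    {φ : Plane → ℝ} (hF : ∀ i, ContDiffOn ℝ 1 (F i) V) (hφ : ContDiff ℝ 1 φ)
    (hc : HasCompactSupport φ) (hsub : tsupport φ ⊆ V) :
    ∫ y, ∑ i, F i y * partialDeriv i φ y = - ∫ y, (∑ i, partialDeriv i (F i) y) * φ y := by
  have hleft : ∀ i, Integrable fun y ↦ F i y * partialDeriv i φ y := fun i ↦
    integrable_mul_of_tsupport_subset (hF i).continuousOn
      ((hφ.continuous_fderiv one_ne_zero).clm_apply continuous_const) (hc.fderiv_apply ℝ _)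
      ((tsupport_fderiv_apply_subset ℝ _).trans hsub)
  have hright : ∀ i, Integrable fun y ↦ partialDeriv i (F i) y * φ y := fun i ↦
    integrable_mul_of_tsupport_subset
      (contDiffOn_partialDeriv hV (hF i) (m := 0) (by simp) i).continuousOn hφ.continuous hc hsub
  have hparts : ∀ i, ∫ y, F i y * partialDeriv i φ y = - ∫ y, partialDeriv i (F i) y * φ y :=
    fun i ↦ integral_mul_fderiv_eq_neg_fderiv_mul_of_integrable (hright i) (hleft i)
      (integrable_mul_of_tsupport_subset (hF i).continuousOn hφ.continuous hc hsub)
      (fun y hy ↦ ((hF i).contDiffAt (hV.mem_nhds (hsub hy))).differentiableAt one_ne_zero)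
      (fun y _ ↦ hφ.differentiable one_ne_zero y)
  simp only [Finset.sum_mul]
  rw [integral_finsetSum _ fun i _ ↦ hleft i, integral_finsetSum _ fun i _ ↦ hright i]
  simp only [hparts, Finset.sum_neg_distrib]

variable {M : Type*} [TopologicalSpace M] [ChartedSpace Plane M]

/-- A function on `M`, read in the preferred chart around `x` and extended by zero. -/
def chartPull (x : M) (φ : M → ℝ) : Plane → ℝ :=
  (extChartAt (𝓡 2) x).target.indicator (φ ∘ (extChartAt (𝓡 2) x).symm)

lemma chartPull_apply {x : M} {y : Plane} (hy : y ∈ (extChartAt (𝓡 2) x).target) (φ : M → ℝ) :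
    chartPull x φ y = φ ((extChartAt (𝓡 2) x).symm y) :=
  indicator_of_mem hy _

lemma chartPull_eventuallyEq {x : M} {y : Plane} (hy : y ∈ (extChartAt (𝓡 2) x).target)
    (φ : M → ℝ) : chartPull x φ =ᶠ[𝓝 y] φ ∘ (extChartAt (𝓡 2) x).symm := by
  filter_upwards [(isOpen_extChartAt_target x).mem_nhds hy] with z hz using chartPull_apply hz φ

lemma isCompact_image_tsupport {x : M} {φ : M → ℝ} (hc : HasCompactSupport φ)
    (hsub : tsupport φ ⊆ (extChartAt (𝓡 2) x).source) :
    IsCompact (extChartAt (𝓡 2) x '' tsupport φ) :=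
  IsCompact.image_of_continuousOn hc ((continuousOn_extChartAt x).mono hsub)

lemma tsupport_chartPull_subset_image {x : M} {φ : M → ℝ} (hc : HasCompactSupport φ)
    (hsub : tsupport φ ⊆ (extChartAt (𝓡 2) x).source) :
    tsupport (chartPull x φ) ⊆ extChartAt (𝓡 2) x '' tsupport φ := by
  refine closure_minimal (fun y hy ↦ ?_) (isCompact_image_tsupport hc hsub).isClosed
  have hyt : y ∈ (extChartAt (𝓡 2) x).target := by
    by_contra h
    exact hy (indicator_of_notMem h _)
  rw [Function.mem_support, chartPull_apply hyt] at hy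
  exact ⟨(extChartAt (𝓡 2) x).symm y, subset_tsupport φ hy, (extChartAt (𝓡 2) x).right_inv hyt⟩

lemma tsupport_chartPull_subset {x : M} {φ : M → ℝ} {Ω : Set M} (hc : HasCompactSupport φ)
    (hsub : tsupport φ ⊆ (extChartAt (𝓡 2) x).source ∩ Ω) :
    tsupport (chartPull x φ) ⊆ chartPreimage x Ω := by
  refine (tsupport_chartPull_subset_image hc (hsub.trans inter_subset_left)).trans ?_
  rintro _ ⟨p, hp, rfl⟩
  exact mem_chartPreimage_of_mem (hsub hp).1 (hsub hp).2

lemma hasCompactSupport_chartPull {x : M} {φ : M → ℝ} (hc : HasCompactSupport φ)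
    (hsub : tsupport φ ⊆ (extChartAt (𝓡 2) x).source) : HasCompactSupport (chartPull x φ) :=
  (isCompact_image_tsupport hc hsub).of_isClosed_subset (isClosed_tsupport _)
    (tsupport_chartPull_subset_image hc hsub)

lemma contDiff_chartPull [IsManifold (𝓡 2) ∞ M] {x : M} {φ : M → ℝ}
    (hφ : ContMDiff (𝓡 2) 𝓘(ℝ, ℝ) 1 φ) (hc : HasCompactSupport φ)
    (hsub : tsupport φ ⊆ (extChartAt (𝓡 2) x).source) : ContDiff ℝ 1 (chartPull x φ) := by
  rw [contDiff_iff_contDiffAt]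
  intro y
  by_cases hy : y ∈ (extChartAt (𝓡 2) x).target
  · exact (contDiffAt_comp_symm hy (by simp) hφ.contMDiffAt).congr_of_eventuallyEq
      (chartPull_eventuallyEq hy φ)
  · have hsupp : y ∉ tsupport (chartPull x φ) := fun h ↦ by
      obtain ⟨p, hp, rfl⟩ := tsupport_chartPull_subset_image hc hsub h
      exact hy ((extChartAt (𝓡 2) x).map_source (hsub hp))
    exact contDiffAt_const.congr_of_eventuallyEq (notMem_tsupport_iff_eventuallyEq.1 hsupp)

lemma exists_finset_sum_eq_of_hasCompactSupport [T2Space M]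
    [SecondCountableTopology M] [IsManifold (𝓡 2) ∞ M] {φ : M → ℝ}
    (hφ : ContMDiff (𝓡 2) 𝓘(ℝ, ℝ) 1 φ) (hc : HasCompactSupport φ) :
    ∃ (s : Finset M) (ψ : M → M → ℝ), (φ = fun p ↦ ∑ x ∈ s, ψ x p) ∧
      ∀ x, ContMDiff (𝓡 2) 𝓘(ℝ, ℝ) 1 (ψ x) ∧ HasCompactSupport (ψ x) ∧
        tsupport (ψ x) ⊆ (extChartAt (𝓡 2) x).source ∩ tsupport φ := by
  have : LocallyCompactSpace M := ChartedSpace.locallyCompactSpace Plane M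
  obtain ⟨ρ, hρ⟩ := SmoothPartitionOfUnity.exists_isSubordinate (𝓡 2) (s := (univ : Set M))
    isClosed_univ (fun x : M ↦ (extChartAt (𝓡 2) x).source) (fun x ↦ isOpen_extChartAt_source x)
    (fun x _ ↦ mem_iUnion.2 ⟨x, mem_extChartAt_source x⟩)
  have hfin : {x | (Function.support (ρ x) ∩ tsupport φ).Nonempty}.Finite :=
    ρ.locallyFinite.finite_nonempty_inter_compact hc
  refine ⟨hfin.toFinset, fun x p ↦ ρ x p * φ p, funext fun p ↦ ?_, fun x ↦
    ⟨((ρ x).contMDiff.of_le (by simp)).mul hφ, hc.mul_left,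
      subset_inter (tsupport_mul_subset_left.trans (hρ x)) tsupport_mul_subset_right⟩⟩
  by_cases hp : p ∈ tsupport φ
  · rw [← Finset.sum_mul, ← finsum_eq_sum_of_support_subset, ρ.sum_eq_one (mem_univ p), one_mul]
    exact fun x hx ↦ hfin.mem_toFinset.2 ⟨p, hx, hp⟩
  · simp only [image_eq_zero_of_notMem_tsupport hp, mul_zero, Finset.sum_const_zero]

variable [RiemannianBundle (fun x : M ↦ TangentSpace (𝓡 2) x)] [IsManifold (𝓡 2) ∞ M]
  {u φ : M → ℝ} {Ω : Set M}

lemma areaDensity_mul_gradInner_symm {x : M} (hΩ : IsOpen Ω)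
    (hu : ContMDiffOn (𝓡 2) 𝓘(ℝ, ℝ) 1 u Ω) (hφ : ContMDiff (𝓡 2) 𝓘(ℝ, ℝ) 1 φ)
    (hsub : tsupport φ ⊆ Ω) {y : Plane} (hy : y ∈ (extChartAt (𝓡 2) x).target) :
    areaDensity x y * gradInner u φ ((extChartAt (𝓡 2) x).symm y) =
      ∑ i, chartFlux x u i y * partialDeriv i (chartPull x φ) y := by
  have hpull : ∀ i, partialDeriv i (chartPull x φ) y =
      partialDeriv i (φ ∘ (extChartAt (𝓡 2) x).symm) y := fun i ↦ by
    rw [partialDeriv, (chartPull_eventuallyEq hy φ).fderiv_eq, partialDeriv]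
  simp only [hpull]
  by_cases hp : (extChartAt (𝓡 2) x).symm y ∈ tsupport φ
  · rw [gradInner_eq_chartGradInner ((extChartAt (𝓡 2) x).map_target hy)
      (hu.contMDiffAt (hΩ.mem_nhds (hsub hp))) hφ.contMDiffAt, (extChartAt (𝓡 2) x).right_inv hy,
      areaDensity_mul_chartGradInner]
  · simp only [gradInner_eq_zero hp, partialDeriv_comp_symm_eq_zero hy hp, mul_zero,
      Finset.sum_const_zero]

variable [IsContMDiffRiemannianBundle (𝓡 2) ∞ Plane (fun x : M ↦ TangentSpace (𝓡 2) x)]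

lemma continuous_gradInner (hΩ : IsOpen Ω) (hu : ContMDiffOn (𝓡 2) 𝓘(ℝ, ℝ) 1 u Ω)
    (hφ : ContMDiff (𝓡 2) 𝓘(ℝ, ℝ) 1 φ) (hsub : tsupport φ ⊆ Ω) : Continuous (gradInner u φ) :=
  continuous_of_continuousOn_of_eq_zero (isClosed_tsupport φ) hΩ hsub
    (continuousOn_gradInner hΩ hu hφ.contMDiffOn) fun _ ↦ gradInner_eq_zero

lemma setIntegral_sum_chartFlux_mul_partialDeriv (x : M) (hΩ : IsOpen Ω)
    (hu : ContMDiffOn (𝓡 2) 𝓘(ℝ, ℝ) ∞ u Ω) (hφ : ContMDiff (𝓡 2) 𝓘(ℝ, ℝ) 1 φ)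
    (hc : HasCompactSupport φ) (hsub : tsupport φ ⊆ (extChartAt (𝓡 2) x).source ∩ Ω) :
    ∫ y in (extChartAt (𝓡 2) x).target, ∑ i, chartFlux x u i y * partialDeriv i (chartPull x φ) y =
      - ∫ y in (extChartAt (𝓡 2) x).target,
          (∑ i, partialDeriv i (chartFlux x u i) y) * chartPull x φ y := by
  have hsource := hsub.trans inter_subset_left
  rw [setIntegral_eq_integral_of_forall_compl_eq_zero (f := fun y ↦ ∑ i, _),
    setIntegral_eq_integral_of_forall_compl_eq_zero (f := fun y ↦ _ * chartPull x φ y)]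
  · exact integral_sum_mul_partialDeriv (isOpen_chartPreimage x hΩ)
      (fun i ↦ (contDiffOn_chartFlux x hΩ hu i).of_le (by simp))
      (contDiff_chartPull hφ hc hsource) (hasCompactSupport_chartPull hc hsource)
      (tsupport_chartPull_subset hc hsub)
  · intro y hy
    rw [chartPull, indicator_of_notMem hy, mul_zero]
  · refine fun y hy ↦ Finset.sum_eq_zero fun i _ ↦ ?_
    rw [image_eq_zero_of_notMem_tsupport (f := partialDeriv i (chartPull x φ)) fun h ↦
      hy (tsupport_chartPull_subset hc hsub (tsupport_fderiv_apply_subset ℝ _ h)).1, mul_zero]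

variable [MeasurableSpace M] [BorelSpace M]

lemma integral_gradInner_of_tsupport_subset_source (x : M) (hΩ : IsOpen Ω)
    (hu : ContMDiffOn (𝓡 2) 𝓘(ℝ, ℝ) ∞ u Ω) (hφ : ContMDiff (𝓡 2) 𝓘(ℝ, ℝ) 1 φ)
    (hc : HasCompactSupport φ) (hsub : tsupport φ ⊆ (extChartAt (𝓡 2) x).source ∩ Ω) :
    ∫ p, gradInner u φ p ∂(area M) =
      - ∫ p, chartLaplacian x u (extChartAt (𝓡 2) x p) * φ p ∂(area M) := by
  set e := extChartAt (𝓡 2) x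
  have hsource := hsub.trans inter_subset_left
  have hsubΩ := hsub.trans inter_subset_right
  have hu1 := hu.of_le (m := 1) (by simp)
  have hlap : Continuous fun p ↦ chartLaplacian x u (e p) * φ p :=
    continuous_of_continuousOn_of_eq_zero (isClosed_tsupport φ)
      ((isOpen_extChartAt_source x).inter hΩ) hsub
      ((continuousOn_chartLaplacian x hΩ hu).mul hφ.continuous.continuousOn)
      fun p hp ↦ by rw [image_eq_zero_of_notMem_tsupport hp, mul_zero]
  calc ∫ p, gradInner u φ p ∂(area M)
      = ∫ y in e.target, areaDensity x y * gradInner u φ (e.symm y) :=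
        integral_area_eq x (continuous_gradInner hΩ hu1 hφ hsubΩ).aestronglyMeasurable
          fun p hp ↦ hsource (by_contra fun h ↦ hp (gradInner_eq_zero h))
    _ = ∫ y in e.target, ∑ i, chartFlux x u i y * partialDeriv i (chartPull x φ) y :=
        setIntegral_congr_fun (measurableSet_target x) fun y hy ↦
          areaDensity_mul_gradInner_symm hΩ hu1 hφ hsubΩ hy
    _ = - ∫ y in e.target, (∑ i, partialDeriv i (chartFlux x u i) y) * chartPull x φ y :=
        setIntegral_sum_chartFlux_mul_partialDeriv x hΩ hu hφ hc hsub
    _ = - ∫ y in e.target, areaDensity x y *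
          (chartLaplacian x u (e (e.symm y)) * φ (e.symm y)) := by
        refine congrArg Neg.neg (setIntegral_congr_fun (measurableSet_target x) fun y hy ↦ ?_)
        have hpos := (areaDensity_pos x hy).ne'
        simp only [chartPull_apply hy, e, (extChartAt (𝓡 2) x).right_inv hy, chartLaplacian]
        field_simp
    _ = - ∫ p, chartLaplacian x u (e p) * φ p ∂(area M) := by
        rw [integral_area_eq x (F := fun p ↦ chartLaplacian x u (e p) * φ p)
          hlap.aestronglyMeasurable]
        exact (Function.support_mul_subset_right _ φ).trans ((subset_tsupport φ).trans hsource)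

variable [T2Space M]

lemma integral_smul_sub_chartLaplacian_eq_zero (x x' : M) (hΩ : IsOpen Ω)
    (hu : ContMDiffOn (𝓡 2) 𝓘(ℝ, ℝ) ∞ u Ω) (hφ : ContMDiff (𝓡 2) 𝓘(ℝ, ℝ) 1 φ)
    (hc : HasCompactSupport φ)
    (hsub : tsupport φ ⊆ (extChartAt (𝓡 2) x).source ∩ (extChartAt (𝓡 2) x').source ∩ Ω) :
    ∫ p, φ p • (chartLaplacian x u (extChartAt (𝓡 2) x p) -
      chartLaplacian x' u (extChartAt (𝓡 2) x' p)) ∂(area M) = 0 := by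
  have hx : tsupport φ ⊆ (extChartAt (𝓡 2) x).source ∩ Ω :=
    hsub.trans (inter_subset_inter_left _ inter_subset_left)
  have hx' : tsupport φ ⊆ (extChartAt (𝓡 2) x').source ∩ Ω :=
    hsub.trans (inter_subset_inter_left _ inter_subset_right)
  simp only [smul_eq_mul, mul_comm (φ _), sub_mul]
  rw [integral_sub
    (integrable_mul_of_tsupport_subset (continuousOn_chartLaplacian x hΩ hu) hφ.continuous hc hx)
    (integrable_mul_of_tsupport_subset (continuousOn_chartLaplacian x' hΩ hu) hφ.continuous hc
      hx'), sub_eq_zero, ← neg_inj,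
    ← integral_gradInner_of_tsupport_subset_source x hΩ hu hφ hc hx,
    ← integral_gradInner_of_tsupport_subset_source x' hΩ hu hφ hc hx']

end WeakForm

section Laplacian

variable {M : Type*} [TopologicalSpace M] [T2Space M] [SecondCountableTopology M]
  [ChartedSpace Plane M] [IsManifold (𝓡 2) ∞ M]
  [RiemannianBundle (fun x : M ↦ TangentSpace (𝓡 2) x)]
  [IsContMDiffRiemannianBundle (𝓡 2) ∞ Plane (fun x : M ↦ TangentSpace (𝓡 2) x)]
  {u φ : M → ℝ} {Ω : Set M}

-- The weak form does not depend on the chart, and it determines the Laplacian.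
lemma eqOn_chartLaplacian (x x' : M) (hΩ : IsOpen Ω) (hu : ContMDiffOn (𝓡 2) 𝓘(ℝ, ℝ) ∞ u Ω) :
    EqOn (fun p ↦ chartLaplacian x u (extChartAt (𝓡 2) x p))
      (fun p ↦ chartLaplacian x' u (extChartAt (𝓡 2) x' p))
      ((extChartAt (𝓡 2) x).source ∩ (extChartAt (𝓡 2) x').source ∩ Ω) := by
  borelize M
  have : LocallyCompactSpace M := ChartedSpace.locallyCompactSpace Plane M
  set U := (extChartAt (𝓡 2) x).source ∩ (extChartAt (𝓡 2) x').source ∩ Ω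
  have hU : IsOpen U :=
    ((isOpen_extChartAt_source x).inter (isOpen_extChartAt_source x')).inter hΩ
  have hcont := (continuousOn_chartLaplacian x hΩ hu).mono
    (inter_subset_inter_left Ω inter_subset_left : U ⊆ _)
  have hcont' := (continuousOn_chartLaplacian x' hΩ hu).mono
    (inter_subset_inter_left Ω inter_subset_right : U ⊆ _)
  refine Measure.eqOn_open_of_ae_eq (μ := area M) ?_ hU hcont hcont'
  have hae := hU.ae_eq_zero_of_integral_contMDiff_smul_eq_zero (𝓡 2) (μ := area M)
    ((hcont.sub hcont').locallyIntegrableOn hU.measurableSet) fun φ hφ hc hsub ↦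
      integral_smul_sub_chartLaplacian_eq_zero x x' hΩ hu (hφ.of_le (by simp)) hc hsub
  rw [EventuallyEq, ae_restrict_iff' hU.measurableSet]
  filter_upwards [hae] with p hp hpU using sub_eq_zero.1 (hp hpU)

lemma eqOn_laplacian_source (x : M) (hΩ : IsOpen Ω) (hu : ContMDiffOn (𝓡 2) 𝓘(ℝ, ℝ) ∞ u Ω) :
    EqOn (laplacian u) (fun p ↦ chartLaplacian x u (extChartAt (𝓡 2) x p))
      ((extChartAt (𝓡 2) x).source ∩ Ω) := fun p hp ↦
  eqOn_chartLaplacian p x hΩ hu ⟨⟨mem_extChartAt_source p, hp.1⟩, hp.2⟩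

lemma continuousOn_laplacian (hΩ : IsOpen Ω) (hu : ContMDiffOn (𝓡 2) 𝓘(ℝ, ℝ) ∞ u Ω) :
    ContinuousOn (laplacian u) Ω := by
  intro p hp
  have hmem : (extChartAt (𝓡 2) p).source ∩ Ω ∈ 𝓝 p :=
    inter_mem (extChartAt_source_mem_nhds p) (hΩ.mem_nhds hp)
  exact (((continuousOn_chartLaplacian p hΩ hu).continuousAt hmem).congr
    ((eqOn_laplacian_source p hΩ hu).symm.eventuallyEq_of_mem hmem)).continuousWithinAt

lemma integral_gradInner [MeasurableSpace M] [BorelSpace M] (hΩ : IsOpen Ω)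
    (hu : ContMDiffOn (𝓡 2) 𝓘(ℝ, ℝ) ∞ u Ω) (hφ : ContMDiff (𝓡 2) 𝓘(ℝ, ℝ) 1 φ)
    (hc : HasCompactSupport φ) (hsub : tsupport φ ⊆ Ω) :
    ∫ p, gradInner u φ p ∂(area M) = - ∫ p, laplacian u p * φ p ∂(area M) := by
  obtain ⟨s, ψ, hsum, hψ⟩ := exists_finset_sum_eq_of_hasCompactSupport hφ hc
  have hψΩ : ∀ x, tsupport (ψ x) ⊆ Ω := fun x ↦ ((hψ x).2.2.trans inter_subset_right).trans hsub
  have hgrad : ∀ x, Integrable (gradInner u (ψ x)) (area M) := fun x ↦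
    (continuous_gradInner hΩ (hu.of_le (by simp)) (hψ x).1
      (hψΩ x)).integrable_of_hasCompactSupport
      (HasCompactSupport.intro' (hψ x).2.1 (isClosed_tsupport _) fun _ ↦ gradInner_eq_zero)
  have hlap : ∀ x, Integrable (fun p ↦ laplacian u p * ψ x p) (area M) := fun x ↦
    integrable_mul_of_tsupport_subset (continuousOn_laplacian hΩ hu) (hψ x).1.continuous
      (hψ x).2.1 (hψΩ x)
  have hlocal : ∀ x, ∫ p, gradInner u (ψ x) p ∂(area M) =
      - ∫ p, laplacian u p * ψ x p ∂(area M) := fun x ↦ by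
    have hsource := (hψ x).2.2.trans (inter_subset_inter_right _ hsub)
    rw [integral_gradInner_of_tsupport_subset_source x hΩ hu (hψ x).1 (hψ x).2.1 hsource]
    refine congrArg Neg.neg (integral_congr_ae (Eventually.of_forall fun p ↦ ?_))
    by_cases hp : p ∈ tsupport (ψ x)
    · simp only [eqOn_laplacian_source x hΩ hu (hsource hp)]
    · simp only [image_eq_zero_of_notMem_tsupport hp, mul_zero]
  calc ∫ p, gradInner u φ p ∂(area M)
      = ∫ p, ∑ x ∈ s, gradInner u (ψ x) p ∂(area M) := by
        rw [hsum]
        exact integral_congr_ae (Eventually.of_forall fun p ↦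
          gradInner_finset_sum s fun x _ ↦ (hψ x).1.contMDiffAt)
    _ = - ∫ p, ∑ x ∈ s, laplacian u p * ψ x p ∂(area M) := by
        rw [integral_finsetSum _ fun x _ ↦ hgrad x, integral_finsetSum _ fun x _ ↦ hlap x,
          ← Finset.sum_neg_distrib]
        exact Finset.sum_congr rfl fun x _ ↦ hlocal x
    _ = - ∫ p, laplacian u p * φ p ∂(area M) := by
        simp only [← Finset.mul_sum, hsum]

end Laplacian

section BoundedLaplacian

open Asymptotics

lemma isBigO_partialDeriv_of_tendsto {l : Filter Plane} {w : Plane → ℝ}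
    {L : Plane [×1]→L[ℝ] ℝ} (hL : Tendsto (iteratedFDeriv ℝ 1 w) l (𝓝 L)) (j : Fin 2) :
    partialDeriv j w =O[l] fun _ ↦ (1 : ℝ) := by
  refine IsBigO.trans (IsBigO.of_bound 1 (Eventually.of_forall fun y ↦ ?_)) (hL.isBigO_one ℝ)
  have hle := (fderiv ℝ w y).le_opNorm (EuclideanSpace.single j 1)
  rw [one_mul, ← norm_iteratedFDeriv_fderiv, norm_iteratedFDeriv_zero]
  simpa [partialDeriv] using hle

lemma isBigO_partialDeriv_partialDeriv_of_tendsto {l : Filter Plane} {w : Plane → ℝ}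
    {L : Plane [×2]→L[ℝ] ℝ} (hL : Tendsto (iteratedFDeriv ℝ 2 w) l (𝓝 L))
    (hw : ∀ᶠ y in l, DifferentiableAt ℝ (fderiv ℝ w) y) (i j : Fin 2) :
    partialDeriv i (partialDeriv j w) =O[l] fun _ ↦ (1 : ℝ) := by
  refine IsBigO.trans (IsBigO.of_bound 1 ?_) (hL.isBigO_one ℝ)
  filter_upwards [hw] with y hy
  have hsecond : partialDeriv i (partialDeriv j w) y =
      fderiv ℝ (fderiv ℝ w) y (EuclideanSpace.single i 1) (EuclideanSpace.single j 1) := by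
    change fderiv ℝ (fun z ↦ fderiv ℝ w z (EuclideanSpace.single j 1)) y _ = _
    rw [fderiv_clm_apply hy (by fun_prop)]
    simp
  have hle := (fderiv ℝ (fderiv ℝ w) y).le_opNorm₂ (EuclideanSpace.single i 1)
    (EuclideanSpace.single j 1)
  rw [hsecond, one_mul, ← norm_iteratedFDeriv_fderiv, ← norm_iteratedFDeriv_fderiv,
    norm_iteratedFDeriv_zero]
  simpa using hle

lemma partialDeriv_sum_mul {ι : Type*} (s : Finset ι) {a b : ι → Plane → ℝ} {y : Plane}
    (ha : ∀ j ∈ s, DifferentiableAt ℝ (a j) y) (hb : ∀ j ∈ s, DifferentiableAt ℝ (b j) y)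
    (i : Fin 2) :
    partialDeriv i (fun z ↦ ∑ j ∈ s, a j z * b j z) y =
      ∑ j ∈ s, (partialDeriv i (a j) y * b j y + a j y * partialDeriv i (b j) y) := by
  rw [partialDeriv, fderiv_fun_sum fun j hj ↦ (ha j hj).fun_mul (hb j hj), sum_apply]
  refine Finset.sum_congr rfl fun j hj ↦ ?_
  rw [fderiv_fun_mul (ha j hj) (hb j hj)]
  simp only [partialDeriv, add_apply, smul_apply, smul_eq_mul]
  ring

lemma exists_bound_of_isBigO_one {X : Type*} [TopologicalSpace X] {s : Set X}
    (hs : IsCompact (closure s)) {F : X → ℝ}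
    (hF : ∀ x ∈ closure s, F =O[𝓝[s] x] fun _ ↦ (1 : ℝ)) : ∃ C, ∀ x ∈ s, |F x| ≤ C := by
  suffices h : ∃ C, ∀ x ∈ closure s ∩ s, |F x| ≤ C by
    simpa only [inter_eq_self_of_subset_right subset_closure] using h
  refine hs.induction_on (p := fun t ↦ ∃ C, ∀ x ∈ t ∩ s, |F x| ≤ C) ⟨0, by simp⟩
    (fun _ _ hst ⟨C, hC⟩ ↦ ⟨C, fun x hx ↦ hC x ⟨hst hx.1, hx.2⟩⟩) ?_ fun x hx ↦ ?_
  · rintro t t' ⟨C, hC⟩ ⟨D, hD⟩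
    refine ⟨max C D, ?_⟩
    rintro x ⟨hx | hx, hxs⟩
    exacts [(hC x ⟨hx, hxs⟩).trans (le_max_left _ _), (hD x ⟨hx, hxs⟩).trans (le_max_right _ _)]
  · obtain ⟨C, hC⟩ := (hF x hx).bound
    simp only [norm_one, mul_one, Real.norm_eq_abs] at hC
    obtain ⟨t, ht, htx⟩ := mem_nhdsWithin_iff_exists_mem_nhds_inter.1 hC
    exact ⟨t, mem_nhdsWithin_of_mem_nhds ht, C, fun p hp ↦ htx hp⟩

variable {M : Type*} [TopologicalSpace M] [ChartedSpace Plane M]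

lemma tendsto_extChartAt_nhdsWithin (x : M) (Ω : Set M) :
    Tendsto (extChartAt (𝓡 2) x) (𝓝[Ω] x) (𝓝[chartPreimage x Ω] (extChartAt (𝓡 2) x x)) := by
  refine tendsto_nhdsWithin_iff.2
    ⟨(continuousAt_extChartAt x).tendsto.mono_left nhdsWithin_le_nhds, ?_⟩
  filter_upwards [self_mem_nhdsWithin,
    nhdsWithin_le_nhds (extChartAt_source_mem_nhds (I := 𝓡 2) x)] with q hqΩ hqx
  exact mem_chartPreimage_of_mem hqx hqΩ

variable [RiemannianBundle (fun x : M ↦ TangentSpace (𝓡 2) x)] [IsManifold (𝓡 2) ∞ M]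
  [IsContMDiffRiemannianBundle (𝓡 2) ∞ Plane (fun x : M ↦ TangentSpace (𝓡 2) x)]
  {Ω : Set M} {u : M → ℝ}

lemma partialDeriv_chartFlux {x : M} (hΩ : IsOpen Ω) (hu : ContMDiffOn (𝓡 2) 𝓘(ℝ, ℝ) ∞ u Ω)
    {y : Plane} (hy : y ∈ chartPreimage x Ω) (i : Fin 2) :
    partialDeriv i (chartFlux x u i) y = ∑ j,
      (partialDeriv i (fun z ↦ areaDensity x z * (gram x z)⁻¹ i j) y *
          partialDeriv j (u ∘ (extChartAt (𝓡 2) x).symm) y +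
        areaDensity x y * (gram x y)⁻¹ i j *
          partialDeriv i (partialDeriv j (u ∘ (extChartAt (𝓡 2) x).symm)) y) := by
  have hflux : chartFlux x u i = fun z ↦ ∑ j, areaDensity x z * (gram x z)⁻¹ i j *
      partialDeriv j (u ∘ (extChartAt (𝓡 2) x).symm) z := by
    ext z
    simp only [chartFlux, Finset.mul_sum, mul_assoc]
  rw [hflux]
  refine partialDeriv_sum_mul Finset.univ (a := fun j z ↦ areaDensity x z * (gram x z)⁻¹ i j)
    (fun j _ ↦ ?_) (fun j _ ↦ ?_) i
  · exact (((contDiffOn_areaDensity x).mul (contDiffOn_gram_inv x i j)).contDiffAt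
      ((isOpen_extChartAt_target x).mem_nhds hy.1)).differentiableAt (by simp)
  · exact ((contDiffOn_partialDeriv (isOpen_chartPreimage x hΩ)
      (contDiffOn_comp_symm x hΩ le_rfl hu) (m := ∞) (by simp) j).contDiffAt
      ((isOpen_chartPreimage x hΩ).mem_nhds hy)).differentiableAt (by simp)

lemma isBigO_chartLaplacian (hΩ : IsOpen Ω) (hu : SmoothOnClosure Ω u) {x : M}
    (hx : x ∈ closure Ω) :
    chartLaplacian x u =O[𝓝[chartPreimage x Ω] (extChartAt (𝓡 2) x x)] fun _ ↦ (1 : ℝ) := by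
  set e := extChartAt (𝓡 2) x
  set l := 𝓝[chartPreimage x Ω] (e x)
  obtain ⟨L₁, hL₁⟩ := hu.tendsto_deriv x hx 1
  obtain ⟨L₂, hL₂⟩ := hu.tendsto_deriv x hx 2
  have hfirst := isBigO_partialDeriv_of_tendsto hL₁
  have hsecond := isBigO_partialDeriv_partialDeriv_of_tendsto hL₂ (by
    filter_upwards [self_mem_nhdsWithin] with y hy
    exact (((contDiffOn_comp_symm x hΩ le_rfl hu.contMDiffOn).fderiv_of_isOpen
      (isOpen_chartPreimage x hΩ) (m := ∞) (by simp)).contDiffAt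
      ((isOpen_chartPreimage x hΩ).mem_nhds hy)).differentiableAt (by simp))
  have hcoeff : ∀ {a : Plane → ℝ}, ContinuousOn a e.target → a =O[l] fun _ ↦ (1 : ℝ) :=
    fun ha ↦ ((ha.continuousAt (extChartAt_target_mem_nhds x)).tendsto.mono_left
      nhdsWithin_le_nhds).isBigO_one ℝ
  have hmul : ∀ {a b : Plane → ℝ}, a =O[l] (fun _ ↦ (1 : ℝ)) → b =O[l] (fun _ ↦ (1 : ℝ)) →
      (fun y ↦ a y * b y) =O[l] fun _ ↦ (1 : ℝ) := fun ha hb ↦ by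
    simpa only [mul_one] using ha.mul hb
  have hsmooth : ∀ i j, ContDiffOn ℝ ∞ (fun y ↦ areaDensity x y * (gram x y)⁻¹ i j) e.target :=
    fun i j ↦ (contDiffOn_areaDensity x).mul (contDiffOn_gram_inv x i j)
  have hflux : ∀ i, partialDeriv i (chartFlux x u i) =O[l] fun _ ↦ (1 : ℝ) := fun i ↦ by
    refine IsBigO.congr' (IsBigO.fun_sum (s := Finset.univ) fun j _ ↦ IsBigO.add
      (hmul (hcoeff (contDiffOn_partialDeriv (isOpen_extChartAt_target x) (hsmooth i j) (m := ∞)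
        (by simp) i).continuousOn) (hfirst j))
      (hmul (hcoeff (hsmooth i j).continuousOn) (hsecond i j))) ?_ EventuallyEq.rfl
    filter_upwards [self_mem_nhdsWithin] with y hy
    exact (partialDeriv_chartFlux hΩ hu.contMDiffOn hy i).symm
  exact hmul (hcoeff ((contDiffOn_areaDensity x).continuousOn.inv₀
    fun y hy ↦ (areaDensity_pos x hy).ne')) (IsBigO.fun_sum fun i _ ↦ hflux i)

variable [T2Space M] [SecondCountableTopology M]

lemma exists_bound_laplacian (hΩ : IsOpen Ω) (hc : IsCompact (closure Ω))
    (hu : SmoothOnClosure Ω u) : ∃ C, ∀ p ∈ Ω, |laplacian u p| ≤ C := by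
  refine exists_bound_of_isBigO_one hc fun x hx ↦ ?_
  refine IsBigO.congr' ((isBigO_chartLaplacian hΩ hu hx).comp_tendsto
    (tendsto_extChartAt_nhdsWithin x Ω)) ?_ EventuallyEq.rfl
  filter_upwards [self_mem_nhdsWithin,
    nhdsWithin_le_nhds (extChartAt_source_mem_nhds (I := 𝓡 2) x)] with q hqΩ hqx
  exact (eqOn_laplacian_source x hΩ hu.contMDiffOn ⟨hqx, hqΩ⟩).symm

end BoundedLaplacian

section Sard

lemma exists_mem_segment_fderiv_eq_zero {E : Type*} [NormedAddCommGroup E] [NormedSpace ℝ E]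
    {w : E → ℝ} {y y' : E} (hw : ∀ z ∈ segment ℝ y y', DifferentiableAt ℝ w z) (h : w y = w y') :
    ∃ z ∈ segment ℝ y y', fderiv ℝ w z (y' - y) = 0 := by
  obtain ⟨z, hz, hmvt⟩ := domain_mvt (fun z hz ↦ (hw z hz).hasFDerivAt.hasFDerivWithinAt)
    (convex_segment y y') (left_mem_segment ℝ y y') (right_mem_segment ℝ y y')
  exact ⟨z, hz, by rw [← hmvt, h, sub_self]⟩

lemma inner_levelDir_smul {w : Plane → ℝ} {z δ : Plane} (h : fderiv ℝ w z δ = 0) (v : Plane) :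
    inner ℝ v (levelDir w z) • δ = inner ℝ v δ • levelDir w z := by
  rw [fderiv_apply_eq_sum, Fin.sum_univ_two] at h
  ext i
  fin_cases i <;> simp only [levelDir, PiLp.inner_apply, Fin.sum_univ_two, PiLp.smul_apply,
    smul_eq_mul, RCLike.inner_apply, conj_trivial, Fin.zero_eta, Fin.mk_one, Matrix.cons_val_zero,
    Matrix.cons_val_one]
  · linear_combination v 1 * h
  · linear_combination -v 0 * h

lemma continuousOn_levelDir {w : Plane → ℝ} {V : Set Plane} (hV : IsOpen V)
    (hw : ContDiffOn ℝ 1 w V) : ContinuousOn (levelDir w) V := by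
  have h := fun i ↦ (contDiffOn_partialDeriv hV hw (m := 0) (by simp) i).continuousOn
  refine (PiLp.continuous_toLp 2 _).comp_continuousOn (continuousOn_pi.2 fun i ↦ ?_)
  fin_cases i
  · exact (h 1).neg
  · exact h 0

lemma levelDir_ne_zero {w : Plane → ℝ} {y : Plane} (h : fderiv ℝ w y ≠ 0) : levelDir w y ≠ 0 := by
  contrapose! h
  have h1 : partialDeriv 1 w y = 0 := by
    simpa [levelDir] using congrArg (fun v : Plane ↦ v 0) h
  have h0 : partialDeriv 0 w y = 0 := by
    simpa [levelDir] using congrArg (fun v : Plane ↦ v 1) h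
  ext v
  rw [fderiv_apply_eq_sum, Fin.sum_univ_two, h0, h1]
  simp

lemma dimH_le_one_of_antilipschitzWith {X : Type*} [EMetricSpace X] {S : Set X} {g : X → ℝ}
    {K : ℝ≥0} (hg : AntilipschitzWith K (S.domRestrict g)) : dimH S ≤ 1 :=
  calc dimH S = dimH (univ : Set S) := by
        rw [← (isometry_subtype_coe (s := S)).dimH_image, image_univ, Subtype.range_coe]
    _ ≤ dimH (S.domRestrict g '' univ) := hg.le_dimH_image univ
    _ ≤ 1 := Real.dimH_univ ▸ dimH_mono (subset_univ _)

/- By the mean value theorem the chord between two zeros is orthogonal to the gradient at some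
intermediate point, so the projection of the zero set to its tangent line at `y₀` is
bi-Lipschitz. -/
lemma exists_nhds_dimH_zeroSet_le_one {w : Plane → ℝ} {V : Set Plane} (hV : IsOpen V)
    (hw : ContDiffOn ℝ 1 w V) {y₀ : Plane} (hy₀ : y₀ ∈ V) (h : fderiv ℝ w y₀ ≠ 0) :
    ∃ U ∈ 𝓝 y₀, dimH {y ∈ U | w y = 0} ≤ 1 := by
  have hVn := hV.mem_nhds hy₀
  set r := levelDir w
  have hr : ContinuousAt r y₀ := (continuousOn_levelDir hV hw).continuousAt hVn
  have hpos : 0 < inner ℝ (r y₀) (r y₀) := real_inner_self_pos.2 (levelDir_ne_zero h)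
  have hnear : ∀ᶠ z in 𝓝 y₀, inner ℝ (r y₀) (r y₀) / 2 < inner ℝ (r y₀) (r z) ∧
      ‖r z‖ < ‖r y₀‖ + 1 :=
    ((continuousAt_const.inner hr).eventually_const_lt (half_lt_self hpos)).and
      (hr.norm.eventually_lt_const (lt_add_one _))
  obtain ⟨ε, hε, hball⟩ := Metric.eventually_nhds_iff_ball.1 (hnear.and hVn)
  refine ⟨Metric.ball y₀ ε, Metric.ball_mem_nhds _ hε, ?_⟩
  refine dimH_le_one_of_antilipschitzWith (g := fun y ↦ inner ℝ (r y₀) y)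
    (K := NNReal.mk ((‖r y₀‖ + 1) / (inner ℝ (r y₀) (r y₀) / 2)) (by positivity))
    (AntilipschitzWith.of_le_mul_dist ?_)
  rintro ⟨y', hy', hwy'⟩ ⟨y, hy, hwy⟩
  have hseg := (convex_ball y₀ ε).segment_subset hy hy'
  obtain ⟨z, hz, hdz⟩ := exists_mem_segment_fderiv_eq_zero
    (fun z hz ↦ (hw.contDiffAt (hV.mem_nhds (hball z (hseg hz)).2)).differentiableAt (by simp))
    (hwy.trans hwy'.symm)
  obtain ⟨hlower, hupper⟩ := (hball z (hseg hz)).1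
  have hparallel := congrArg norm (inner_levelDir_smul hdz (r y₀))
  rw [norm_smul, norm_smul, Real.norm_of_nonneg (by linarith), inner_sub_right] at hparallel
  change dist y' y ≤ (‖r y₀‖ + 1) / (inner ℝ (r y₀) (r y₀) / 2) *
    dist (inner ℝ (r y₀) y') (inner ℝ (r y₀) y)
  rw [dist_eq_norm, dist_eq_norm, div_mul_eq_mul_div, le_div_iff₀ (by positivity)]
  calc ‖y' - y‖ * (inner ℝ (r y₀) (r y₀) / 2)
      ≤ inner ℝ (r y₀) (r z) * ‖y' - y‖ := by rw [mul_comm]; gcongr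
    _ ≤ (‖r y₀‖ + 1) * ‖inner ℝ (r y₀) y' - inner ℝ (r y₀) y‖ := by
        rw [hparallel, mul_comm]; gcongr

lemma volume_image_eq_zero_of_edist_le_pow {X : Type*} [EMetricSpace X] {w : X → ℝ} {S : Set X}
    {k d : ℕ} (hdim : dimH S ≤ d) (hdk : d < k) {L : ℝ≥0}
    (h : ∀ y ∈ S, ∀ y' ∈ S, edist (w y) (w y') ≤ L * edist y y' ^ k) :
    volume (w '' S) = 0 := by
  have hk : 0 < k := by lia
  have hholder : HolderOnWith L (k : ℝ≥0) w S := fun y hy y' hy' ↦ by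
    simpa using h y hy y' hy'
  rw [← hausdorffMeasure_real]
  refine hausdorffMeasure_of_dimH_lt (d := 1) ?_
  calc dimH (w '' S) ≤ dimH S / (k : ℝ≥0) := hholder.dimH_image_le (by exact_mod_cast hk)
    _ ≤ d / (k : ℝ≥0) := ENNReal.div_le_div_right hdim _
    _ < (1 : ℝ≥0) := by
        rw [ENNReal.div_lt_iff (by simp [hk.ne']) (by simp)]
        simpa using hdk

section Taylor

variable {E F : Type*} [NormedAddCommGroup E] [NormedSpace ℝ E] [NormedAddCommGroup F]
  [NormedSpace ℝ F]

lemma norm_image_sub_le_pow {f : E → F} {y y' : E} {L : ℝ} (hL : 0 ≤ L) {k : ℕ}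
    (hf : ∀ z ∈ segment ℝ y y', DifferentiableAt ℝ f z)
    (hb : ∀ z ∈ segment ℝ y y', ‖fderiv ℝ f z‖ ≤ L * ‖z - y‖ ^ k) :
    ‖f y' - f y‖ ≤ L * ‖y' - y‖ ^ (k + 1) := by
  rw [pow_succ, ← mul_assoc]
  refine (convex_segment y y').norm_image_sub_le_of_norm_fderiv_le hf (fun z hz ↦ ?_)
    (left_mem_segment ℝ y y') (right_mem_segment ℝ y y')
  refine (hb z hz).trans ?_
  gcongr
  obtain ⟨t, ht, rfl⟩ := (segment_eq_image' ℝ y y').le hz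
  simp only [add_sub_cancel_left, norm_smul, Real.norm_eq_abs, abs_of_nonneg ht.1]
  exact mul_le_of_le_one_left (norm_nonneg _) ht.2

omit [NormedSpace ℝ E] [NormedSpace ℝ F] in
lemma edist_le_of_norm_sub_le_pow {a b : F} {y y' : E} {L : ℝ≥0} {k : ℕ}
    (h : ‖b - a‖ ≤ L * ‖y' - y‖ ^ k) : edist a b ≤ L * edist y y' ^ k := by
  rw [edist_comm a, edist_comm y, edist_eq_enorm_sub, edist_eq_enorm_sub, enorm_eq_nnnorm,
    enorm_eq_nnnorm]
  exact_mod_cast h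

variable {f : E → F} {V : Set E} {y₀ : E}

lemma exists_ball_edist_le_sq (hV : IsOpen V) (hf : ContDiffOn ℝ 2 f V) (hy₀ : y₀ ∈ V) :
    ∃ L : ℝ≥0, ∃ ε > 0, Metric.ball y₀ ε ⊆ V ∧ ∀ y ∈ Metric.ball y₀ ε, fderiv ℝ f y = 0 →
      ∀ y' ∈ Metric.ball y₀ ε, edist (f y) (f y') ≤ L * edist y y' ^ 2 := by
  have hVn := hV.mem_nhds hy₀
  obtain ⟨L, t, ht, hL⟩ := ((hf.fderiv_of_isOpen hV (m := 1) (by norm_num)).contDiffAt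
    hVn).exists_lipschitzOnWith
  obtain ⟨ε, hε, hball⟩ := Metric.nhds_basis_ball.mem_iff.1 (inter_mem ht hVn)
  refine ⟨L, ε, hε, fun y hy ↦ (hball hy).2, fun y hy hcrit y' hy' ↦ ?_⟩
  have hseg := (convex_ball y₀ ε).segment_subset hy hy'
  refine edist_le_of_norm_sub_le_pow (norm_image_sub_le_pow L.2 (fun z hz ↦ ?_) fun z hz ↦ ?_)
  · exact (hf.contDiffAt (hV.mem_nhds (hball (hseg hz)).2)).differentiableAt (by simp)
  · simpa [hcrit] using hL.norm_sub_le (hball (hseg hz)).1 (hball hy).1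

lemma exists_ball_edist_le_cube (hV : IsOpen V) (hf : ContDiffOn ℝ 3 f V) (hy₀ : y₀ ∈ V) :
    ∃ L : ℝ≥0, ∃ ε > 0, Metric.ball y₀ ε ⊆ V ∧ ∀ y ∈ Metric.ball y₀ ε, fderiv ℝ f y = 0 →
      fderiv ℝ (fderiv ℝ f) y = 0 →
        ∀ y' ∈ Metric.ball y₀ ε, edist (f y) (f y') ≤ L * edist y y' ^ 3 := by
  obtain ⟨L, ε, hε, hεV, hL⟩ := exists_ball_edist_le_sq hV
    (hf.fderiv_of_isOpen hV (m := 2) (by norm_num)) hy₀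
  refine ⟨L, ε, hε, hεV, fun y hy hcrit hflat y' hy' ↦ ?_⟩
  have hseg := (convex_ball y₀ ε).segment_subset hy hy'
  refine edist_le_of_norm_sub_le_pow (norm_image_sub_le_pow L.2 (fun z hz ↦ ?_) fun z hz ↦ ?_)
  · exact (hf.contDiffAt (hV.mem_nhds (hεV (hseg hz)))).differentiableAt (by simp)
  · have hdist := hL y hy hflat z (hseg hz)
    rw [hcrit, edist_comm y, edist_zero_left, edist_eq_enorm_sub, enorm_eq_nnnorm (z - y)] at hdist
    exact_mod_cast hdist

end Taylor

lemma measure_image_eq_zero_of_locally {X Y : Type*} [TopologicalSpace X]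
    [SecondCountableTopology X] [MeasurableSpace Y] {μ : Measure Y} {f : X → Y} {S : Set X}
    (h : ∀ x ∈ S, ∃ U ∈ 𝓝 x, μ (f '' (S ∩ U)) = 0) : μ (f '' S) = 0 :=
  measure_null_of_locally_null (μ := OuterMeasure.comap f μ.toOuterMeasure) S fun x hx ↦
    let ⟨U, hU, hnull⟩ := h x hx
    ⟨S ∩ U, inter_mem_nhdsWithin S hU, hnull⟩

variable {w : Plane → ℝ} {V : Set Plane} {y₀ : Plane}

lemma exists_fderiv_partialDeriv_ne_zero (hV : IsOpen V) (hw : ContDiffOn ℝ 2 w V) (hy₀ : y₀ ∈ V)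
    (h : fderiv ℝ (fderiv ℝ w) y₀ ≠ 0) : ∃ i, fderiv ℝ (partialDeriv i w) y₀ ≠ 0 := by
  contrapose! h
  have hdiff : DifferentiableAt ℝ (fderiv ℝ w) y₀ :=
    ((hw.fderiv_of_isOpen hV (m := 1) (by norm_num)).contDiffAt
      (hV.mem_nhds hy₀)).differentiableAt (by simp)
  have hpartial : ∀ i v, fderiv ℝ (fderiv ℝ w) y₀ v (EuclideanSpace.single i 1) = 0 := by
    intro i v
    have hv : fderiv ℝ (fun z ↦ fderiv ℝ w z (EuclideanSpace.single i 1)) y₀ v = 0 :=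
      DFunLike.congr_fun (h i) v
    rw [fderiv_clm_apply hdiff (by fun_prop)] at hv
    simpa using hv
  ext v v'
  rw [eq_sum_smul_single v', map_sum]
  simp [hpartial]

lemma volume_image_nondegenerate_critical_eq_zero (hV : IsOpen V) (hw : ContDiffOn ℝ 2 w V) :
    volume (w '' {y ∈ V | fderiv ℝ w y = 0 ∧ fderiv ℝ (fderiv ℝ w) y ≠ 0}) = 0 := by
  refine measure_image_eq_zero_of_locally fun y₀ ⟨hy₀, _, hne⟩ ↦ ?_
  obtain ⟨i, hi⟩ := exists_fderiv_partialDeriv_ne_zero hV hw hy₀ hne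
  obtain ⟨U, hU, hdim⟩ := exists_nhds_dimH_zeroSet_le_one hV
    (contDiffOn_partialDeriv hV hw (m := 1) (by norm_num) i) hy₀ hi
  obtain ⟨L, ε, hε, -, hball⟩ := exists_ball_edist_le_sq hV hw hy₀
  refine ⟨U ∩ Metric.ball y₀ ε, inter_mem hU (Metric.ball_mem_nhds _ hε),
    volume_image_eq_zero_of_edist_le_pow (d := 1) (k := 2) (L := L) ?_ one_lt_two
      fun y ⟨hy, hyU⟩ y' hy' ↦ hball y hyU.2 hy.2.1 y' hy'.2.2⟩
  rw [Nat.cast_one]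
  refine (dimH_mono ?_).trans hdim
  rintro y ⟨⟨-, hcrit, -⟩, hyU⟩
  exact ⟨hyU.1, by rw [partialDeriv, hcrit, zero_apply]⟩

lemma volume_image_flat_eq_zero (hV : IsOpen V) (hw : ContDiffOn ℝ 3 w V) :
    volume (w '' {y ∈ V | fderiv ℝ w y = 0 ∧ fderiv ℝ (fderiv ℝ w) y = 0}) = 0 := by
  refine measure_image_eq_zero_of_locally fun y₀ ⟨hy₀, _⟩ ↦ ?_
  obtain ⟨L, ε, hε, -, hball⟩ := exists_ball_edist_le_cube hV hw hy₀
  refine ⟨Metric.ball y₀ ε, Metric.ball_mem_nhds _ hε,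
    volume_image_eq_zero_of_edist_le_pow (d := 2) (k := 3) (L := L) ?_ (by norm_num)
      fun y ⟨hy, hyε⟩ y' hy' ↦ hball y hyε hy.2.1 hy.2.2 y' hy'.2⟩
  refine (dimH_mono (subset_univ _)).trans ?_
  rw [Real.dimH_univ_eq_finrank, finrank_euclideanSpace_fin]

theorem volume_image_critical_eq_zero (hV : IsOpen V) (hw : ContDiffOn ℝ 3 w V) :
    volume (w '' {y ∈ V | fderiv ℝ w y = 0}) = 0 := by
  refine measure_mono_null ?_ (measure_union_null
    (volume_image_nondegenerate_critical_eq_zero hV (hw.of_le (by norm_num)))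
    (volume_image_flat_eq_zero hV hw))
  rintro _ ⟨y, ⟨hy, hcrit⟩, rfl⟩
  by_cases hflat : fderiv ℝ (fderiv ℝ w) y = 0
  · exact Or.inr ⟨y, ⟨hy, hcrit, hflat⟩, rfl⟩
  · exact Or.inl ⟨y, ⟨hy, hcrit, hflat⟩, rfl⟩

variable {M : Type*} [TopologicalSpace M] [ChartedSpace Plane M] [IsManifold (𝓡 2) ∞ M]

lemma mfderiv_eq_zero_iff {u : M → ℝ} {x p : M} (hp : p ∈ (extChartAt (𝓡 2) x).source)
    (hu : MDifferentiableAt (𝓡 2) 𝓘(ℝ, ℝ) u p) :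
    mfderiv (𝓡 2) 𝓘(ℝ, ℝ) u p = 0 ↔
      fderiv ℝ (u ∘ (extChartAt (𝓡 2) x).symm) (extChartAt (𝓡 2) x p) = 0 := by
  set e := extChartAt (𝓡 2) x
  have hinv : e.symm (e p) = p := e.left_inv hp
  have he : MDifferentiableAt (𝓡 2) 𝓘(ℝ, Plane) e p :=
    mdifferentiableAt_extChartAt (by rwa [← extChartAt_source (𝓡 2)])
  have hsymm := mdifferentiableAt_symm x (e.map_source hp)
  have hu' : MDifferentiableAt (𝓡 2) 𝓘(ℝ, ℝ) u (e.symm (e p)) := hinv.symm ▸ hu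
  have hcomp := hu'.comp (e p) hsymm
  rw [← mfderiv_eq_fderiv]
  constructor <;> intro h
  · rw [mfderiv_comp (e p) hu' hsymm, show mfderiv (𝓡 2) 𝓘(ℝ, ℝ) u (e.symm (e p)) = 0 by
      convert h, ContinuousLinearMap.zero_comp]
    rfl
  · have hlocal : u =ᶠ[𝓝 p] (u ∘ e.symm) ∘ e := by
      filter_upwards [extChartAt_source_mem_nhds' hp] with q hq
      exact congrArg u (e.left_inv hq).symm
    rw [hlocal.mfderiv_eq, mfderiv_comp p hcomp he]
    ext v
    exact DFunLike.congr_fun h (mfderiv (𝓡 2) 𝓘(ℝ, Plane) e p v)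

variable [SecondCountableTopology M]

theorem volume_image_mfderiv_eq_zero {u : M → ℝ} {Ω : Set M} (hΩ : IsOpen Ω)
    (hu : ContMDiffOn (𝓡 2) 𝓘(ℝ, ℝ) ∞ u Ω) :
    volume (u '' {p ∈ Ω | mfderiv (𝓡 2) 𝓘(ℝ, ℝ) u p = 0}) = 0 := by
  refine measure_image_eq_zero_of_locally fun x _ ↦ ⟨_,
    extChartAt_source_mem_nhds (I := 𝓡 2) x, ?_⟩
  refine measure_mono_null ?_ (volume_image_critical_eq_zero (isOpen_chartPreimage x hΩ)
    ((contDiffOn_comp_symm x hΩ le_rfl hu).of_le (by norm_cast)))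
  rintro _ ⟨p, ⟨⟨hpΩ, hcrit⟩, hpx⟩, rfl⟩
  refine ⟨extChartAt (𝓡 2) x p, ⟨mem_chartPreimage_of_mem hpx hpΩ, ?_⟩, ?_⟩
  · exact (mfderiv_eq_zero_iff hpx
      ((hu.contMDiffAt (hΩ.mem_nhds hpΩ)).mdifferentiableAt (by simp))).1 hcrit
  · rw [Function.comp_apply, (extChartAt (𝓡 2) x).left_inv hpx]

end Sard

section ChartDistance

variable {M : Type*} [EMetricSpace M] [ChartedSpace Plane M] [IsManifold (𝓡 2) ∞ M]

lemma mfderiv_symm_comp_lineMap (x : M) {y y' : Plane} {t : ℝ}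
    (h : AffineMap.lineMap y y' t ∈ (extChartAt (𝓡 2) x).target) :
    mfderiv 𝓘(ℝ, ℝ) (𝓡 2) ((extChartAt (𝓡 2) x).symm ∘ AffineMap.lineMap y y') t 1 =
      symmDeriv x (AffineMap.lineMap y y' t) (y' - y) := by
  rw [((mdifferentiableAt_symm x h).hasMFDerivAt.comp t
    AffineMap.hasDerivAt_lineMap.hasFDerivAt.hasMFDerivAt).mfderiv]
  change symmDeriv x (AffineMap.lineMap y y' t) ((1 : ℝ) • (y' - y)) = _
  rw [one_smul]

variable [RiemannianBundle (fun x : M ↦ TangentSpace (𝓡 2) x)]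

omit [IsManifold (𝓡 2) ∞ M] in
lemma norm_symmDeriv (x : M) (y v : Plane) : ‖symmDeriv x y v‖ = √(chartMetric x y v v) := by
  rw [chartMetric_self, Real.sqrt_sq (norm_nonneg _)]

lemma edist_symm_le [IsRiemannianManifold (𝓡 2) M] (x : M) {y y' : Plane}
    (hseg : segment ℝ y y' ⊆ (extChartAt (𝓡 2) x).target) {S : ℝ}
    (hS : ∀ z ∈ segment ℝ y y', ‖symmDeriv x z (y' - y)‖ ≤ S) :
    edist ((extChartAt (𝓡 2) x).symm y) ((extChartAt (𝓡 2) x).symm y') ≤ ENNReal.ofReal S := by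
  set γ : ℝ → M := (extChartAt (𝓡 2) x).symm ∘ AffineMap.lineMap y y'
  have hmaps : MapsTo (AffineMap.lineMap y y' : ℝ → Plane) (Icc 0 1) (segment ℝ y y') :=
    fun t ht ↦ segment_eq_image_lineMap ℝ y y' ▸ mem_image_of_mem _ ht
  have hsmooth : ContMDiff 𝓘(ℝ, ℝ) 𝓘(ℝ, Plane) 1 (AffineMap.lineMap y y' : ℝ → Plane) :=
    ContDiff.contMDiff <| by
      simp only [AffineMap.coe_lineMap, vsub_eq_sub, vadd_eq_add]
      fun_prop
  have hγ : ContMDiffOn 𝓘(ℝ, ℝ) (𝓡 2) 1 γ (Icc 0 1) :=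
    ((contMDiffOn_extChartAt_symm (I := 𝓡 2) (n := ∞) x).of_le (by norm_cast)).comp
      hsmooth.contMDiffOn fun t ht ↦ hseg (hmaps ht)
  calc edist ((extChartAt (𝓡 2) x).symm y) ((extChartAt (𝓡 2) x).symm y')
      ≤ pathELength (𝓡 2) γ 0 1 := by
        rw [IsRiemannianManifold.out (I := 𝓡 2)]
        exact riemannianEDist_le_pathELength hγ (by simp [γ]) (by simp [γ]) zero_le_one
    _ = ∫⁻ t in Ioo (0 : ℝ) 1, ‖mfderiv 𝓘(ℝ, ℝ) (𝓡 2) γ t 1‖ₑ :=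
        pathELength_eq_lintegral_mfderiv_Ioo
    _ ≤ ∫⁻ _ in Ioo (0 : ℝ) 1, ENNReal.ofReal S := by
        refine setLIntegral_mono' measurableSet_Ioo fun t ht ↦ ?_
        have hz := hmaps (Ioo_subset_Icc_self ht)
        rw [mfderiv_symm_comp_lineMap x (hseg hz), ← ofReal_norm]
        exact ENNReal.ofReal_le_ofReal (hS _ hz)
    _ = ENNReal.ofReal S := by simp

lemma continuousOn_norm_symmDeriv [IsContMDiffRiemannianBundle (𝓡 2) ∞ Plane
      (fun x : M ↦ TangentSpace (𝓡 2) x)] (x : M) :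
    ContinuousOn (fun q : Plane × Plane ↦ ‖symmDeriv x q.1 q.2‖)
      ((extChartAt (𝓡 2) x).target ×ˢ univ) := by
  simpa only [norm_symmDeriv] using (continuousOn_chartMetric_self x).sqrt

end ChartDistance

section Slices

/-- The two coordinates on `Plane`, as a measurable equivalence. -/
def planeEquiv : Plane ≃ᵐ ℝ × ℝ :=
  (MeasurableEquiv.toLp 2 (Fin 2 → ℝ)).symm.trans MeasurableEquiv.finTwoArrow

lemma measurePreserving_planeEquiv : MeasurePreserving planeEquiv :=
  (PiLp.volume_preserving_ofLp (Fin 2)).trans (volume_preserving_finTwoArrow ℝ)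

lemma planeEquiv_symm_apply (a t : ℝ) : planeEquiv.symm (a, t) = !₂[a, t] := by
  rw [MeasurableEquiv.symm_apply_eq]
  rfl

/-- The horizontal slice of a planar set at height `t`. -/
def slice (S : Set Plane) (t : ℝ) : Set ℝ := {a | !₂[a, t] ∈ S}

variable {S : Set Plane}

lemma slice_eq_preimage (S : Set Plane) (t : ℝ) :
    slice S t = (fun a ↦ (a, t)) ⁻¹' (planeEquiv.symm ⁻¹' S) := by
  ext a
  simp only [slice, mem_ofPred_eq, mem_preimage, planeEquiv_symm_apply]

lemma measurable_volume_slice (hS : MeasurableSet S) :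
    Measurable fun t ↦ volume (slice S t) := by
  simp only [slice_eq_preimage]
  exact measurable_measure_prodMk_right (planeEquiv.symm.measurable hS)

lemma setLIntegral_volume_slice (hS : MeasurableSet S) {B : Set ℝ} (hB : MeasurableSet B) :
    ∫⁻ t in B, volume (slice S t) = volume (S ∩ {y | y 1 ∈ B}) := by
  have hSB : MeasurableSet (S ∩ {y : Plane | y 1 ∈ B}) :=
    hS.inter ((measurable_snd.comp planeEquiv.measurable) hB)
  have hpre : planeEquiv.symm ⁻¹' S ∩ univ ×ˢ B =
      planeEquiv.symm ⁻¹' (S ∩ {y : Plane | y 1 ∈ B}) := by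
    ext ⟨a, t⟩
    simp [planeEquiv_symm_apply]
  simp only [slice_eq_preimage]
  rw [← Measure.prod_apply_symm (planeEquiv.symm.measurable hS),
    ← (measurePreserving_planeEquiv.symm _).measure_preimage hSB.nullMeasurableSet, ← hpre,
    ← Measure.restrict_apply (planeEquiv.symm.measurable hS), Measure.volume_eq_prod,
    ← Measure.prod_restrict, Measure.restrict_univ]

end Slices

section Straightening

/-- The map `y ↦ (⟪v, y⟫, w y)`, which straightens the level lines of `w` when they are transverse
to the lines orthogonal to `v`. -/
def straighten (v : Plane) (w : Plane → ℝ) (y : Plane) : Plane :=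
  !₂[inner ℝ v y, w y]

/-- The derivative of `straighten v w`. -/
def straightenDeriv (v : Plane) (w : Plane → ℝ) (y : Plane) : Plane →L[ℝ] Plane :=
  (PiLp.continuousLinearEquiv 2 ℝ (fun _ : Fin 2 ↦ ℝ)).symm.toContinuousLinearMap.comp
    (ContinuousLinearMap.pi ![innerSL ℝ v, fderiv ℝ w y])

lemma hasFDerivAt_straighten (v : Plane) {w : Plane → ℝ} {y : Plane}
    (hw : DifferentiableAt ℝ w y) :
    HasFDerivAt (straighten v w) (straightenDeriv v w y) y := by
  refine (PiLp.continuousLinearEquiv 2 ℝ (fun _ : Fin 2 ↦ ℝ)).symm.hasFDerivAt.comp y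
    (f := fun y ↦ ![inner ℝ v y, w y]) (hasFDerivAt_pi.2 fun i ↦ ?_)
  fin_cases i
  · exact (innerSL ℝ v).hasFDerivAt
  · exact hw.hasFDerivAt

lemma det_straightenDeriv (v : Plane) (w : Plane → ℝ) (y : Plane) :
    (straightenDeriv v w y).det = - inner ℝ v (levelDir w y) := by
  rw [det_eq_det_of_single, Matrix.det_fin_two]
  simp [straightenDeriv, levelDir, PiLp.inner_apply, Fin.sum_univ_two, partialDeriv]
  ring

variable {M : Type*} [EMetricSpace M] [ChartedSpace Plane M] [IsManifold (𝓡 2) ∞ M]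
  [RiemannianBundle (fun x : M ↦ TangentSpace (𝓡 2) x)]

/-- On the convex subset `N` of the chart around `x`, the linear functional `⟪v, ·⟫` parametrizes
the level lines of `w`, with Riemannian speed at most `K`. The speed bound allows the metric and the
direction of the level line to be taken at different points of `N`, so that it applies to chords. -/
structure IsLevelCoordinate (x : M) (w : Plane → ℝ) (v : Plane) (K : ℝ) (N : Set Plane) :
    Prop where
  convex : Convex ℝ N
  subset_target : N ⊆ (extChartAt (𝓡 2) x).target
  differentiableAt : ∀ z ∈ N, DifferentiableAt ℝ w z
  inner_pos : ∀ z ∈ N, 0 < inner ℝ v (levelDir w z)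
  norm_le : ∀ z ∈ N, ∀ z' ∈ N, ‖symmDeriv x z (levelDir w z')‖ ≤ K * inner ℝ v (levelDir w z')

section

variable [IsContMDiffRiemannianBundle (𝓡 2) ∞ Plane (fun x : M ↦ TangentSpace (𝓡 2) x)]

lemma continuousAt_norm_symmDeriv_levelDir (x : M) {w : Plane → ℝ} {V : Set Plane} (hV : IsOpen V)
    (hVt : V ⊆ (extChartAt (𝓡 2) x).target) (hw : ContDiffOn ℝ 1 w V) {q : Plane × Plane}
    (hq : q ∈ V ×ˢ V) :
    ContinuousAt (fun q : Plane × Plane ↦ ‖symmDeriv x q.1 (levelDir w q.2)‖) q :=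
  ((continuousOn_norm_symmDeriv x).comp (s := V ×ˢ V)
    (continuousOn_fst.prodMk ((continuousOn_levelDir hV hw).comp continuousOn_snd
      fun _ h ↦ h.2)) fun _ h ↦ ⟨hVt h.1, mem_univ _⟩).continuousAt ((hV.prod hV).mem_nhds hq)

lemma exists_isLevelCoordinate (x : M) {w : Plane → ℝ} {V : Set Plane} (hV : IsOpen V)
    (hVt : V ⊆ (extChartAt (𝓡 2) x).target) (hw : ContDiffOn ℝ 1 w V) {y₀ : Plane} (hy₀ : y₀ ∈ V)
    (hne : fderiv ℝ w y₀ ≠ 0) {c : ℝ} (hc : 1 < c) :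
    ∃ K > 0, ∃ ε > 0, Metric.ball y₀ ε ⊆ V ∧
      IsLevelCoordinate x w (levelDir w y₀) K (Metric.ball y₀ ε) ∧ ∀ z ∈ Metric.ball y₀ ε,
        K * inner ℝ (levelDir w y₀) (levelDir w z) ≤ c * ‖symmDeriv x z (levelDir w z)‖ := by
  have hVn := hV.mem_nhds hy₀
  set r := levelDir w
  have hr0 : r y₀ ≠ 0 := levelDir_ne_zero hne
  set v := r y₀
  set s : Plane × Plane → ℝ := fun q ↦ ‖symmDeriv x q.1 (r q.2)‖
  have hs : ContinuousAt s (y₀, y₀) :=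
    continuousAt_norm_symmDeriv_levelDir x hV hVt hw ⟨hy₀, hy₀⟩
  have hs0 : 0 < s (y₀, y₀) := by
    simpa only [s, norm_symmDeriv] using Real.sqrt_pos.2 (chartMetric_self_pos x (hVt hy₀) hr0)
  have hvv : 0 < inner ℝ v v := real_inner_self_pos.2 hr0
  have hin : ContinuousAt (fun z ↦ inner ℝ v (r z)) y₀ :=
    continuousAt_const.inner ((continuousOn_levelDir hV hw).continuousAt hVn)
  obtain ⟨K, hK0, hK⟩ : ∃ K > 0, K * inner ℝ v v = (1 + c) / 2 * s (y₀, y₀) :=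
    ⟨(1 + c) / 2 * s (y₀, y₀) / inner ℝ v v, by positivity, by field_simp⟩
  have hpos : ∀ᶠ z in 𝓝 y₀, 0 < inner ℝ v (r z) := hin.eventually_const_lt hvv
  have hupper : ∀ᶠ z in 𝓝 y₀, K * inner ℝ v (r z) < c * s (z, z) :=
    (continuousAt_const.mul hin).eventually_lt (continuousAt_const.mul
      (ContinuousAt.comp (f := fun z ↦ (z, z)) hs (by fun_prop)))
      (show K * inner ℝ v v < c * s (y₀, y₀) by rw [hK]; nlinarith)
  have hlower : ∀ᶠ q in 𝓝 (y₀, y₀), s q < K * inner ℝ v (r q.2) :=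
    hs.eventually_lt (continuousAt_const.mul
      (ContinuousAt.comp (g := fun z ↦ inner ℝ v (r z)) hin continuousAt_snd))
      (show s (y₀, y₀) < K * inner ℝ v v by rw [hK]; nlinarith)
  rw [nhds_prod_eq, Metric.nhds_basis_ball.prod_self.eventually_iff] at hlower
  obtain ⟨ε₁, hε₁, hball₁⟩ := Metric.eventually_nhds_iff_ball.1 ((hpos.and hupper).and hVn)
  obtain ⟨ε₂, hε₂, hball₂⟩ := hlower
  have h₁ : ∀ z ∈ Metric.ball y₀ (min ε₁ ε₂), z ∈ Metric.ball y₀ ε₁ :=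
    Metric.ball_subset_ball (min_le_left _ _)
  have h₂ : ∀ z ∈ Metric.ball y₀ (min ε₁ ε₂), z ∈ Metric.ball y₀ ε₂ :=
    Metric.ball_subset_ball (min_le_right _ _)
  refine ⟨K, hK0, min ε₁ ε₂, lt_min hε₁ hε₂, fun z hz ↦ (hball₁ z (h₁ z hz)).2,
    ⟨convex_ball _ _, fun z hz ↦ hVt (hball₁ z (h₁ z hz)).2, fun z hz ↦ ?_,
      fun z hz ↦ (hball₁ z (h₁ z hz)).1.1,
      fun z hz z' hz' ↦ (@hball₂ (z, z') ⟨h₂ z hz, h₂ z' hz'⟩).le⟩,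
    fun z hz ↦ (hball₁ z (h₁ z hz)).1.2.le⟩
  exact (hw.contDiffAt (hV.mem_nhds (hball₁ z (h₁ z hz)).2)).differentiableAt (by simp)

end

namespace IsLevelCoordinate

variable [IsRiemannianManifold (𝓡 2) M] {x : M} {w : Plane → ℝ} {v : Plane} {K : ℝ} {N : Set Plane}

lemma edist_symm_le (h : IsLevelCoordinate x w v K N) {y y' : Plane} (hy : y ∈ N) (hy' : y' ∈ N)
    (hw : w y = w y') :
    edist ((extChartAt (𝓡 2) x).symm y) ((extChartAt (𝓡 2) x).symm y') ≤
      ENNReal.ofReal (|inner ℝ v (y' - y)| * K) := by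
  have hseg : segment ℝ y y' ⊆ N := h.convex.segment_subset hy hy'
  obtain ⟨z', hz', hd⟩ := exists_mem_segment_fderiv_eq_zero
    (fun z hz ↦ h.differentiableAt z (hseg hz)) hw
  refine SphereCovering.edist_symm_le x (hseg.trans h.subset_target) fun z hz ↦ ?_
  have hpos := h.inner_pos z' (hseg hz')
  have hchord := congrArg (fun q ↦ ‖symmDeriv x z q‖) (inner_levelDir_smul hd v)
  simp only [map_smul, norm_smul, Real.norm_eq_abs, abs_of_pos hpos] at hchord
  refine le_of_mul_le_mul_left ?_ hpos
  calc inner ℝ v (levelDir w z') * ‖symmDeriv x z (y' - y)‖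
      = |inner ℝ v (y' - y)| * ‖symmDeriv x z (levelDir w z')‖ := hchord
    _ ≤ |inner ℝ v (y' - y)| * (K * inner ℝ v (levelDir w z')) := by
        gcongr
        exact h.norm_le z (hseg hz) z' (hseg hz')
    _ = inner ℝ v (levelDir w z') * (|inner ℝ v (y' - y)| * K) := by ring

lemma injOn_straighten (h : IsLevelCoordinate x w v K N) : InjOn (straighten v w) N := by
  intro y hy y' hy' hyy'
  have h0 : inner ℝ v y = inner ℝ v y' := congrArg (fun q : Plane ↦ q 0) hyy'
  have h1 : w y = w y' := congrArg (fun q : Plane ↦ q 1) hyy'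
  have hdist := h.edist_symm_le hy hy' h1
  rw [inner_sub_right, h0, sub_self, abs_zero, zero_mul, ENNReal.ofReal_zero] at hdist
  exact (extChartAt (𝓡 2) x).symm.injOn (h.subset_target hy) (h.subset_target hy')
    (edist_le_zero.1 hdist)

lemma measurableSet_image_straighten (h : IsLevelCoordinate x w v K N) {T : Set Plane}
    (hT : MeasurableSet T) (hTN : T ⊆ N) : MeasurableSet (straighten v w '' T) :=
  measurable_image_of_fderivWithin hT (fun y hy ↦
    (hasFDerivAt_straighten v (h.differentiableAt y (hTN hy))).hasFDerivWithinAt)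
    (h.injOn_straighten.mono hTN)

lemma setLIntegral_slice (h : IsLevelCoordinate x w v K N) {T : Set Plane}
    (hT : MeasurableSet T) (hTN : T ⊆ N) {B : Set ℝ} (hB : MeasurableSet B)
    (hTB : MeasurableSet (T ∩ w ⁻¹' B)) :
    ∫⁻ t in B, volume (slice (straighten v w '' T) t) =
      ∫⁻ y in T ∩ w ⁻¹' B, ENNReal.ofReal (inner ℝ v (levelDir w y)) := by
  have himage : straighten v w '' T ∩ {y | y 1 ∈ B} = straighten v w '' (T ∩ w ⁻¹' B) :=
    image_inter_preimage (straighten v w) T {y | y 1 ∈ B} |>.symm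
  have hN : T ∩ w ⁻¹' B ⊆ N := inter_subset_left.trans hTN
  rw [setLIntegral_volume_slice (h.measurableSet_image_straighten hT hTN) hB, himage,
    ← lintegral_abs_det_fderiv_eq_addHaar_image volume hTB (fun y hy ↦
      (hasFDerivAt_straighten v (h.differentiableAt y (hN hy))).hasFDerivWithinAt)
      (h.injOn_straighten.mono hN)]
  refine setLIntegral_congr_fun hTB fun y hy ↦ ?_
  simp only [det_straightenDeriv, abs_neg, abs_of_pos (h.inner_pos y (hN hy))]

end IsLevelCoordinate

lemma hausdorffMeasure_one_le_of_antilipschitzWith {X : Type*} [EMetricSpace X]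
    [MeasurableSpace X] [BorelSpace X] {S : Set X} {g : X → ℝ} {K : ℝ≥0}
    (hg : AntilipschitzWith K (S.domRestrict g)) : μH[1] S ≤ K * volume (g '' S) :=
  calc μH[1] S = μH[1] (univ : Set S) := by
        rw [← (isometry_subtype_coe (s := S)).hausdorffMeasure_image (Or.inl zero_le_one),
          image_univ, Subtype.range_coe]
    _ ≤ K * volume (g '' S) := by
        simpa [hausdorffMeasure_real] using hg.le_hausdorffMeasure_image zero_le_one univ

lemma IsLevelCoordinate.hausdorffMeasure_level_le [IsRiemannianManifold (𝓡 2) M]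
    [MeasurableSpace M] [BorelSpace M] {x : M} {u : M → ℝ} {v : Plane} {K : ℝ} {N : Set Plane}
    (h : IsLevelCoordinate x (u ∘ (extChartAt (𝓡 2) x).symm) v K N) {D : Set M}
    (hD : D ⊆ (extChartAt (𝓡 2) x).source) (hDN : chartPreimage x D ⊆ N) (t : ℝ) :
    μH[1] (D ∩ u ⁻¹' {t}) ≤ ENNReal.ofReal K *
      volume (slice (straighten v (u ∘ (extChartAt (𝓡 2) x).symm) '' chartPreimage x D) t) := by
  set e := extChartAt (𝓡 2) x
  set g : M → ℝ := fun p ↦ inner ℝ v (e p)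
  have hmem : ∀ p ∈ D, e p ∈ chartPreimage x D := fun p hp ↦
    mem_chartPreimage_of_mem (hD hp) hp
  have hu : ∀ p ∈ D, u (e.symm (e p)) = u p := fun p hp ↦ congrArg u (e.left_inv (hD hp))
  have hanti : AntilipschitzWith K.toNNReal ((D ∩ u ⁻¹' {t}).domRestrict g) := by
    rintro ⟨p, hp, hpt⟩ ⟨q, hq, hqt⟩
    have hdist := h.edist_symm_le (hDN (hmem q hq)) (hDN (hmem p hp))
      ((hu q hq).trans (hqt.trans ((hu p hp).trans hpt).symm))
    rw [e.left_inv (hD hq), e.left_inv (hD hp), inner_sub_right, mul_comm,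
      ENNReal.ofReal_mul' (abs_nonneg _), edist_comm] at hdist
    change edist p q ≤ ENNReal.ofReal K * edist (g p) (g q)
    rwa [edist_dist (g p), Real.dist_eq]
  refine (hausdorffMeasure_one_le_of_antilipschitzWith hanti).trans (mul_le_mul_right ?_ _)
  refine measure_mono ?_
  rintro _ ⟨p, ⟨hp, hpt⟩, rfl⟩
  exact ⟨e p, hmem p hp, by rw [straighten, Function.comp_apply, hu p hp, hpt]⟩

end Straightening

section CoareaMajorant

variable {X : Type*} [EMetricSpace X] [MeasurableSpace X] [BorelSpace X] {u : X → ℝ} {S S' : Set X}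
  {ν ν' : Measure X}

/-- A measurable majorant of the lengths of the level sets of `u` in `S` whose integral over any set
of levels is controlled by `ν`. This is the inequality in the coarea formula that the isoperimetric
argument needs; asking only for a majorant avoids the measurability of the lengths themselves. -/
def HasCoareaMajorant (u : X → ℝ) (S : Set X) (ν : Measure X) : Prop :=
  ∃ L : ℝ → ℝ≥0∞, Measurable L ∧ (∀ t, μH[1] (S ∩ u ⁻¹' {t}) ≤ L t) ∧
    ∀ B, MeasurableSet B → ∫⁻ t in B, L t ≤ ν (u ⁻¹' B)

namespace HasCoareaMajorant

lemma mono_measure (h : HasCoareaMajorant u S ν) (hν : ν ≤ ν') : HasCoareaMajorant u S ν' := by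
  obtain ⟨L, hLm, hL, hint⟩ := h
  exact ⟨L, hLm, hL, fun B hB ↦ (hint B hB).trans (hν _)⟩

lemma of_subset_iUnion {ι : Type*} [Countable ι] {D : ι → Set X} {νs : ι → Measure X}
    (hS : S ⊆ ⋃ i, D i) (h : ∀ i, HasCoareaMajorant u (D i) (νs i)) :
    HasCoareaMajorant u S (Measure.sum νs) := by
  choose L hLm hL hint using h
  refine ⟨fun t ↦ ∑' i, L i t, .tsum hLm, fun t ↦ ?_, fun B hB ↦ ?_⟩
  · calc μH[1] (S ∩ u ⁻¹' {t}) ≤ μH[1] (⋃ i, D i ∩ u ⁻¹' {t}) := by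
          rw [← iUnion_inter]
          exact measure_mono (inter_subset_inter_left _ hS)
      _ ≤ ∑' i, μH[1] (D i ∩ u ⁻¹' {t}) := measure_iUnion_le _
      _ ≤ ∑' i, L i t := ENNReal.tsum_le_tsum fun i ↦ hL i t
  · rw [lintegral_tsum fun i ↦ (hLm i).aemeasurable]
    exact (ENNReal.tsum_le_tsum fun i ↦ hint i B hB).trans (Measure.le_sum_apply _ _)

lemma of_locally [SecondCountableTopology X] (h : ∀ p ∈ S, ∃ U, IsOpen U ∧ p ∈ U ∧
      ∀ D ⊆ U, MeasurableSet D → HasCoareaMajorant u D (ν.restrict D)) :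
    HasCoareaMajorant u S ν := by
  choose! U hUo hpU hU using h
  obtain ⟨s, hsS, hsc, hcov⟩ := TopologicalSpace.countable_cover_nhdsWithin
    fun p hp ↦ mem_nhdsWithin_of_mem_nhds ((hUo p hp).mem_nhds (hpU p hp))
  rcases s.eq_empty_or_nonempty with rfl | hsne
  · have hS : S ⊆ ∅ := by simpa using hcov
    refine ⟨0, measurable_const, fun t ↦ ?_, fun _ _ ↦ by simp⟩
    simp [subset_empty_iff.1 hS]
  obtain ⟨f, rfl⟩ := hsc.exists_eq_range hsne
  rw [biUnion_range, ← iUnion_disjointed] at hcov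
  have hf : ∀ n, f n ∈ S := fun n ↦ hsS (mem_range_self n)
  have hD : ∀ n, MeasurableSet (disjointed (fun n ↦ U (f n)) n) :=
    fun n ↦ .disjointed (fun n ↦ (hUo _ (hf n)).measurableSet) n
  refine (of_subset_iUnion hcov fun n ↦
    hU (f n) (hf n) _ (disjointed_subset _ n) (hD n)).mono_measure ?_
  rw [← Measure.restrict_iUnion (disjoint_disjointed _) hD]
  exact Measure.restrict_le_self

lemma of_forall_smul (h : ∀ c : ℝ, 1 < c → HasCoareaMajorant u S (ENNReal.ofReal c • ν)) :
    HasCoareaMajorant u S ν := by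
  have hc : ∀ n : ℕ, 1 < 1 + 1 / ((n : ℝ) + 1) := fun n ↦ lt_add_of_pos_right 1 (by positivity)
  choose L hLm hL hint using fun n ↦ h _ (hc n)
  refine ⟨fun t ↦ ⨅ n, L n t, .iInf hLm, fun t ↦ le_iInf fun n ↦ hL n t, fun B hB ↦ ?_⟩
  have hlim : Tendsto (fun n : ℕ ↦ ENNReal.ofReal (1 + 1 / ((n : ℝ) + 1)) * ν (u ⁻¹' B)) atTop
      (𝓝 (ν (u ⁻¹' B))) := by
    have h1 := ENNReal.tendsto_ofReal (tendsto_one_div_add_atTop_nhds_zero_nat.const_add (1 : ℝ))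
    rw [add_zero, ENNReal.ofReal_one] at h1
    simpa only [one_mul] using ENNReal.Tendsto.mul_const h1 (Or.inl one_ne_zero)
  exact ge_of_tendsto' hlim fun n ↦ (lintegral_mono fun t ↦ iInf_le _ n).trans (hint n B hB)

end HasCoareaMajorant

end CoareaMajorant

section Coarea

lemma measurable_indicator_of_continuousOn {X : Type*} [TopologicalSpace X] [MeasurableSpace X]
    [BorelSpace X] {Ω : Set X} (hΩ : MeasurableSet Ω) {F : X → ℝ} (hF : ContinuousOn F Ω) :
    Measurable (Ω.indicator F) := by
  classical
  rw [← piecewise_eq_indicator]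
  exact hF.measurable_piecewise continuousOn_const hΩ

lemma measurableSet_inter_preimage_of_continuousOn {X : Type*} [TopologicalSpace X]
    [MeasurableSpace X] [BorelSpace X] {u : X → ℝ} {D : Set X} (hD : MeasurableSet D)
    (hu : ContinuousOn u D) {B : Set ℝ} (hB : MeasurableSet B) : MeasurableSet (D ∩ u ⁻¹' B) := by
  have h := hD.subtype_image (hu.domRestrict.measurable hB)
  rwa [domRestrict_eq, preimage_comp, Subtype.image_preimage_coe] at h

variable {M : Type*} [EMetricSpace M] [ChartedSpace Plane M] [IsManifold (𝓡 2) ∞ M]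
  [RiemannianBundle (fun x : M ↦ TangentSpace (𝓡 2) x)]

lemma norm_symmDeriv_levelDir {x : M} {y : Plane} (hy : y ∈ (extChartAt (𝓡 2) x).target)
    (u : M → ℝ) : ‖symmDeriv x y (levelDir (u ∘ (extChartAt (𝓡 2) x).symm) y)‖ =
      areaDensity x y * √(chartGradInner x u u y) := by
  rw [norm_symmDeriv, ← areaDensity_sq_mul_chartGradInner_self hy,
    Real.sqrt_mul (sq_nonneg _), Real.sqrt_sq (areaDensity_pos x hy).le]

variable [IsContMDiffRiemannianBundle (𝓡 2) ∞ Plane (fun x : M ↦ TangentSpace (𝓡 2) x)]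
  [MeasurableSpace M] [BorelSpace M]

/-- The norm of the gradient of `u` in `Ω`, extended by zero. -/
def gradNorm (Ω : Set M) (u : M → ℝ) : M → ℝ :=
  Ω.indicator fun p ↦ √(gradInner u u p)

lemma measurable_gradNorm {u : M → ℝ} {Ω : Set M} (hΩ : IsOpen Ω)
    (hu : ContMDiffOn (𝓡 2) 𝓘(ℝ, ℝ) 1 u Ω) : Measurable (gradNorm Ω u) :=
  measurable_indicator_of_continuousOn hΩ.measurableSet (continuousOn_gradInner hΩ hu hu).sqrt

variable [IsRiemannianManifold (𝓡 2) M]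

lemma IsLevelCoordinate.hasCoareaMajorant {x : M} {u : M → ℝ} {v : Plane} {K : ℝ} (hK : 0 ≤ K)
    {N : Set Plane} (h : IsLevelCoordinate x (u ∘ (extChartAt (𝓡 2) x).symm) v K N) {D : Set M}
    (hD : MeasurableSet D) (hDx : D ⊆ (extChartAt (𝓡 2) x).source) (hDN : chartPreimage x D ⊆ N)
    (hu : ContinuousOn u D) {F : M → ℝ≥0∞} (hF : Measurable F)
    (hKF : ∀ y ∈ chartPreimage x D,
      ENNReal.ofReal (K * inner ℝ v (levelDir (u ∘ (extChartAt (𝓡 2) x).symm) y)) ≤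
        ENNReal.ofReal (areaDensity x y) * F ((extChartAt (𝓡 2) x).symm y)) :
    HasCoareaMajorant u D (((area M).restrict D).withDensity F) := by
  set w := u ∘ (extChartAt (𝓡 2) x).symm
  have hT := measurableSet_chartPreimage x hD
  refine ⟨fun t ↦ ENNReal.ofReal K * volume (slice (straighten v w '' chartPreimage x D) t),
    (measurable_volume_slice (h.measurableSet_image_straighten hT hDN)).const_mul _,
    h.hausdorffMeasure_level_le hDx hDN, fun B hB ↦ ?_⟩
  have hDB := measurableSet_inter_preimage_of_continuousOn hD hu hB
  have hTB : chartPreimage x D ∩ w ⁻¹' B = chartPreimage x (D ∩ u ⁻¹' B) := inter_assoc _ _ _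
  have hTBm := measurableSet_chartPreimage x hDB
  calc ∫⁻ t in B, ENNReal.ofReal K * volume (slice (straighten v w '' chartPreimage x D) t)
      = ∫⁻ y in chartPreimage x (D ∩ u ⁻¹' B),
          ENNReal.ofReal (K * inner ℝ v (levelDir w y)) := by
        rw [lintegral_const_mul' _ _ ENNReal.ofReal_ne_top,
          h.setLIntegral_slice hT hDN hB (hTB ▸ hTBm), hTB,
          ← lintegral_const_mul' _ _ ENNReal.ofReal_ne_top]
        simp only [ENNReal.ofReal_mul hK]
    _ ≤ ∫⁻ y in chartPreimage x (D ∩ u ⁻¹' B),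
          ENNReal.ofReal (areaDensity x y) * F ((extChartAt (𝓡 2) x).symm y) :=
        setLIntegral_mono' hTBm fun y hy ↦ hKF y ⟨hy.1, hy.2.1⟩
    _ = ((area M).restrict D).withDensity F (u ⁻¹' B) := by
        rw [← setLIntegral_area x hDB (inter_subset_left.trans hDx) hF, ← restrict_withDensity hD,
          Measure.restrict_apply' hD, inter_comm, withDensity_apply _ (inter_comm D _ ▸ hDB)]

lemma exists_nhds_hasCoareaMajorant {u : M → ℝ} {Ω : Set M} (hΩ : IsOpen Ω)
    (hu : ContMDiffOn (𝓡 2) 𝓘(ℝ, ℝ) 1 u Ω) {p : M} (hp : p ∈ Ω)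
    (hreg : mfderiv (𝓡 2) 𝓘(ℝ, ℝ) u p ≠ 0) {c : ℝ} (hc : 1 < c) :
    ∃ U : Set M, IsOpen U ∧ p ∈ U ∧ U ⊆ Ω ∧ ∀ D ⊆ U, MeasurableSet D → HasCoareaMajorant u D
      (((area M).restrict D).withDensity fun q ↦
        ENNReal.ofReal c * ENNReal.ofReal (gradNorm Ω u q)) := by
  set e := extChartAt (𝓡 2) p
  have hpe := mem_extChartAt_source (I := 𝓡 2) p
  obtain ⟨K, hK, ε, hε, hball, hlevel, hupper⟩ := exists_isLevelCoordinate p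
    (isOpen_chartPreimage p hΩ) inter_subset_left (contDiffOn_comp_symm p hΩ (by norm_cast) hu)
    (mem_chartPreimage_of_mem hpe hp)
    (mt (mfderiv_eq_zero_iff hpe ((hu.contMDiffAt (hΩ.mem_nhds hp)).mdifferentiableAt
      one_ne_zero)).2 hreg) hc
  set U := e.source ∩ e ⁻¹' Metric.ball (e p) ε
  have hUN : chartPreimage p U ⊆ Metric.ball (e p) ε := fun y hy ↦ by
    have hey : e (e.symm y) ∈ Metric.ball (e p) ε := hy.2.2
    rwa [e.right_inv hy.1] at hey
  have hUΩ : U ⊆ Ω := fun q hq ↦ by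
    have hqΩ : e.symm (e q) ∈ Ω := (hball hq.2).2
    rwa [e.left_inv hq.1] at hqΩ
  refine ⟨U, isOpen_extChartAt_preimage' p Metric.isOpen_ball, ⟨hpe, Metric.mem_ball_self hε⟩, hUΩ,
    fun D hDU hD ↦ hlevel.hasCoareaMajorant hK.le hD (hDU.trans inter_subset_left)
      (fun y hy ↦ hUN ⟨hy.1, hDU hy.2⟩) (hu.continuousOn.mono (hDU.trans hUΩ))
      ((measurable_gradNorm hΩ hu).ennreal_ofReal.const_mul _) fun y hy ↦ ?_⟩
  have hyΩ : e.symm y ∈ Ω := hUΩ (hDU hy.2)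
  have huy := hu.contMDiffAt (hΩ.mem_nhds hyΩ)
  have hdens := (areaDensity_pos p hy.1).le
  have hgrad : gradNorm Ω u (e.symm y) = √(chartGradInner p u u y) := by
    rw [gradNorm, indicator_of_mem hyΩ,
      gradInner_eq_chartGradInner (e.map_target hy.1) huy huy, e.right_inv hy.1]
  rw [hgrad, ← ENNReal.ofReal_mul (by linarith), ← ENNReal.ofReal_mul hdens]
  refine ENNReal.ofReal_le_ofReal ((hupper y (hUN ⟨hy.1, hDU hy.2⟩)).trans_eq ?_)
  rw [norm_symmDeriv_levelDir hy.1, mul_left_comm]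

theorem hasCoareaMajorant_regular [SecondCountableTopology M] {u : M → ℝ} {Ω : Set M}
    (hΩ : IsOpen Ω) (hu : ContMDiffOn (𝓡 2) 𝓘(ℝ, ℝ) 1 u Ω) :
    HasCoareaMajorant u {p ∈ Ω | mfderiv (𝓡 2) 𝓘(ℝ, ℝ) u p ≠ 0}
      (((area M).restrict Ω).withDensity fun q ↦ ENNReal.ofReal (gradNorm Ω u q)) := by
  refine .of_forall_smul fun c hc ↦ .of_locally fun p hp ↦ ?_
  obtain ⟨U, hUo, hpU, hUΩ, hU⟩ := exists_nhds_hasCoareaMajorant hΩ hu hp.1 hp.2 hc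
  refine ⟨U, hUo, hpU, fun D hDU hD ↦ (hU D hDU hD).mono_measure (le_of_eq ?_)⟩
  rw [Measure.restrict_smul, restrict_withDensity hD,
    Measure.restrict_restrict_of_subset (hDU.trans hUΩ)]
  exact withDensity_smul _ (measurable_gradNorm hΩ hu).ennreal_ofReal

end Coarea

section Superlevel

lemma isClosed_connectedComponentIn {X : Type*} [TopologicalSpace X] {E : Set X} (hE : IsClosed E)
    (p : X) : IsClosed (connectedComponentIn E p) := by
  by_cases hp : p ∈ E
  · exact isClosed_of_closure_subset <|
      isPreconnected_connectedComponentIn.closure.subset_connectedComponentIn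
        (subset_closure (mem_connectedComponentIn hp))
        (closure_minimal (connectedComponentIn_subset E p) hE)
  · rw [connectedComponentIn_eq_empty hp]
    exact isClosed_empty

lemma exists_finset_connectedComponentIn {X : Type*} [TopologicalSpace X] {E : Set X}
    (hE : IsCompact E) (hnhds : ∀ p ∈ E, connectedComponentIn E p ∈ 𝓝[E] p) :
    ∃ F : Finset (Set X), (∀ C ∈ F, ∃ p ∈ E, connectedComponentIn E p = C) ∧
      (F : Set (Set X)).PairwiseDisjoint id ∧ E = ⋃ C ∈ F, C := by
  classical
  obtain ⟨s, hsE, hcov⟩ := hE.elim_nhdsWithin_subcover _ hnhds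
  have hF : ∀ C ∈ s.image (connectedComponentIn E), ∃ p ∈ E, connectedComponentIn E p = C := by
    simpa only [Finset.forall_mem_image] using fun p hp ↦ ⟨p, hsE p hp, rfl⟩
  refine ⟨s.image (connectedComponentIn E), hF, fun C hC C' hC' hne ↦ ?_,
    subset_antisymm (by simpa using hcov) (iUnion₂_subset fun C hC ↦ ?_)⟩
  · obtain ⟨p, -, rfl⟩ := hF C hC
    obtain ⟨p', -, rfl⟩ := hF C' hC'
    exact disjoint_left.2 fun q hq hq' ↦
      hne ((connectedComponentIn_eq hq).trans (connectedComponentIn_eq hq').symm)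
  · obtain ⟨p, -, rfl⟩ := hF C hC
    exact connectedComponentIn_subset E p

/-- A regular boundary point has arbitrarily small connected neighbourhoods in the superlevel set:
in the coordinates of the implicit function theorem these are half balls. -/
lemma exists_isPreconnected_mem_nhdsWithin_superlevel {E : Type*} [NormedAddCommGroup E]
    [NormedSpace ℝ E] [CompleteSpace E] {w : E → ℝ} {w' : E →L[ℝ] ℝ} {y : E} {t : ℝ}
    (hw : HasStrictFDerivAt w w' y) (hw' : w' ≠ 0) (ht : w y = t) {V : Set E} (hV : V ∈ 𝓝 y) :
    ∃ A ⊆ V ∩ {z | t ≤ w z}, y ∈ A ∧ IsPreconnected A ∧ A ∈ 𝓝[{z | t ≤ w z}] y := by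
  have hsurj : w'.range = ⊤ := LinearMap.range_eq_top.2 <| LinearMap.surjective <|
    mt (fun h ↦ ContinuousLinearMap.coe_injective h) hw'
  set φ := hw.implicitToOpenPartialHomeomorph w w' hsurj
  have hφ : ∀ z, (φ z).1 = w z := hw.implicitToOpenPartialHomeomorph_fst hsurj
  have hy : y ∈ φ.source := hw.mem_implicitToOpenPartialHomeomorph_source hsurj
  have hsymm : φ.target ∩ φ.symm ⁻¹' V ∈ 𝓝 (φ y) :=
    inter_mem (φ.open_target.mem_nhds (φ.map_source hy))
      ((φ.continuousAt_symm (φ.map_source hy)).preimage_mem_nhds (by rwa [φ.left_inv hy]))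
  obtain ⟨ε, hε, hball⟩ := Metric.mem_nhds_iff.1 hsymm
  set B := Metric.ball (φ y) ε ∩ {q | t ≤ q.1}
  have hB : Convex ℝ B := (convex_ball _ _).inter
    (convex_halfSpace_ge (LinearMap.fst ℝ ℝ _).isLinear t)
  refine ⟨φ.symm '' B, ?_, ⟨φ y, ⟨Metric.mem_ball_self hε, (ht.symm.trans (hφ y).symm).le⟩,
    φ.left_inv hy⟩, hB.isPreconnected.image _
    (φ.continuousOn_symm.mono fun q hq ↦ (hball hq.1).1), ?_⟩
  · rintro _ ⟨q, hq, rfl⟩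
    have hwq := hφ (φ.symm q)
    rw [φ.right_inv (hball hq.1).1] at hwq
    exact ⟨(hball hq.1).2, hq.2.trans_eq hwq⟩
  · have hpre : φ.source ∩ φ ⁻¹' Metric.ball (φ y) ε ∈ 𝓝 y :=
      inter_mem (φ.open_source.mem_nhds hy)
        ((φ.continuousAt hy).preimage_mem_nhds (Metric.ball_mem_nhds _ hε))
    filter_upwards [mem_nhdsWithin_of_mem_nhds hpre, self_mem_nhdsWithin] with z hz hzw
    exact ⟨φ z, ⟨hz.2, le_of_le_of_eq hzw (hφ z).symm⟩, φ.left_inv hz.1⟩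

variable {M : Type*} [TopologicalSpace M] [ChartedSpace Plane M] {u : M → ℝ} {Ω : Set M} {t : ℝ}

lemma isCompact_superlevel {X : Type*} [TopologicalSpace X] {u : X → ℝ} {Ω : Set X}
    (hΩ : IsOpen Ω) (hc : IsCompact (closure Ω)) (hu : ContinuousOn u (closure Ω))
    (hbd : ∀ x ∈ frontier Ω, u x = 0) {t : ℝ} (ht : 0 < t) : IsCompact {q ∈ Ω | t ≤ u q} := by
  have h : {q ∈ Ω | t ≤ u q} = closure Ω ∩ u ⁻¹' Ici t := by
    refine subset_antisymm (inter_subset_inter_left _ subset_closure) fun q hq ↦ ⟨?_, hq.2⟩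
    by_contra hqΩ
    have huq : t ≤ u q := hq.2
    rw [hbd q (hΩ.frontier_eq ▸ ⟨hq.1, hqΩ⟩)] at huq
    exact huq.not_gt ht
  rw [h]
  exact hc.of_isClosed_subset (hu.preimage_isClosed_of_isClosed isClosed_closure isClosed_Ici)
    inter_subset_left

lemma connectedComponentIn_superlevel_mem_nhds (hΩ : IsOpen Ω) (hu : ContinuousOn u Ω) {p : M}
    (hp : p ∈ Ω) (hpt : t < u p) : connectedComponentIn {q ∈ Ω | t ≤ u q} p ∈ 𝓝 p :=
  have := ChartedSpace.locallyConnectedSpace Plane M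
  connectedComponentIn_mem_nhds <| mem_of_superset
    ((hu.isOpen_inter_preimage hΩ isOpen_Ioi).mem_nhds ⟨hp, hpt⟩) fun _ hq ↦ ⟨hq.1, hq.2.le⟩

lemma frontier_connectedComponentIn_superlevel_subset (hΩ : IsOpen Ω) (hu : ContinuousOn u Ω)
    (hE : IsClosed {q ∈ Ω | t ≤ u q}) (p : M) :
    frontier (connectedComponentIn {q ∈ Ω | t ≤ u q} p) ⊆ Ω ∩ u ⁻¹' {t} := fun q hq ↦ by
  have hqC := (isClosed_connectedComponentIn hE p).frontier_subset hq
  have hqE := connectedComponentIn_subset _ p hqC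
  refine ⟨hqE.1, ?_⟩
  by_contra hne
  have hnhds := connectedComponentIn_superlevel_mem_nhds hΩ hu hqE.1
    (lt_of_le_of_ne hqE.2 (Ne.symm hne))
  rw [← connectedComponentIn_eq hqC] at hnhds
  exact hq.2 (mem_interior_iff_mem_nhds.2 hnhds)

variable [IsManifold (𝓡 2) ∞ M]

lemma connectedComponentIn_superlevel_mem_nhdsWithin_of_regular (hΩ : IsOpen Ω)
    (hu : ContMDiffOn (𝓡 2) 𝓘(ℝ, ℝ) 1 u Ω) {p : M} (hp : p ∈ Ω)
    (hreg : mfderiv (𝓡 2) 𝓘(ℝ, ℝ) u p ≠ 0) :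
    connectedComponentIn {q ∈ Ω | u p ≤ u q} p ∈ 𝓝[{q ∈ Ω | u p ≤ u q}] p := by
  set e := extChartAt (𝓡 2) p
  have hpe : p ∈ e.source := mem_extChartAt_source p
  have hinv : e.symm (e p) = p := e.left_inv hpe
  have hV := (isOpen_chartPreimage p hΩ).mem_nhds (mem_chartPreimage_of_mem hpe hp)
  have hup := hu.contMDiffAt (hΩ.mem_nhds hp)
  obtain ⟨A, hA, hpA, hconn, hnhds⟩ := exists_isPreconnected_mem_nhdsWithin_superlevel
    (((contDiffOn_comp_symm p hΩ (by norm_cast) hu).contDiffAt hV).hasStrictFDerivAt one_ne_zero)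
    (mt (mfderiv_eq_zero_iff hpe (hup.mdifferentiableAt one_ne_zero)).2 hreg)
    (congrArg u hinv) hV
  have hsub : e.symm '' A ⊆ connectedComponentIn {q ∈ Ω | u p ≤ u q} p :=
    (hconn.image _ ((continuousOn_extChartAt_symm p).mono fun z hz ↦
      (hA hz).1.1)).subset_connectedComponentIn
      ⟨e p, hpA, hinv⟩
      (image_subset_iff.2 fun z hz ↦ ⟨(hA hz).1.2, (hA hz).2⟩)
  have hmem : ∀ᶠ q in 𝓝 p, u p ≤ u (e.symm (e q)) → e q ∈ A :=
    (continuousAt_extChartAt p).eventually (mem_nhdsWithin_iff_eventually.1 hnhds)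
  filter_upwards [mem_nhdsWithin_of_mem_nhds hmem, self_mem_nhdsWithin,
    mem_nhdsWithin_of_mem_nhds (extChartAt_source_mem_nhds (I := 𝓡 2) p)] with q hqA hqE hq
  exact hsub ⟨e q, hqA (by rw [e.left_inv hq]; exact hqE.2), e.left_inv hq⟩

lemma connectedComponentIn_superlevel_mem_nhdsWithin (hΩ : IsOpen Ω)
    (hu : ContMDiffOn (𝓡 2) 𝓘(ℝ, ℝ) 1 u Ω)
    (hreg : ∀ p ∈ Ω, u p = t → mfderiv (𝓡 2) 𝓘(ℝ, ℝ) u p ≠ 0) :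
    ∀ p ∈ {q ∈ Ω | t ≤ u q},
      connectedComponentIn {q ∈ Ω | t ≤ u q} p ∈ 𝓝[{q ∈ Ω | t ≤ u q}] p := by
  intro p hp
  rcases hp.2.lt_or_eq with hlt | rfl
  · exact mem_nhdsWithin_of_mem_nhds
      (connectedComponentIn_superlevel_mem_nhds hΩ hu.continuousOn hp.1 hlt)
  · exact connectedComponentIn_superlevel_mem_nhdsWithin_of_regular hΩ hu hp.1 (hreg p hp.1 rfl)

lemma mfderiv_const_sub_ne_zero {p : M} (hu : MDifferentiableAt (𝓡 2) 𝓘(ℝ, ℝ) u p)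
    (h : mfderiv (𝓡 2) 𝓘(ℝ, ℝ) u p ≠ 0) (t : ℝ) :
    mfderiv (𝓡 2) 𝓘(ℝ, ℝ) (fun q ↦ t - u q) p ≠ 0 := by
  have hp := mem_extChartAt_source (I := 𝓡 2) p
  rw [Ne, mfderiv_eq_zero_iff hp hu] at h
  have hsub : MDifferentiableAt (𝓡 2) 𝓘(ℝ, ℝ) (fun q ↦ t - u q) p :=
    mdifferentiableAt_const.sub hu
  rw [Ne, mfderiv_eq_zero_iff hp hsub]
  change fderiv ℝ (fun y ↦ t - (u ∘ (extChartAt (𝓡 2) p).symm) y) _ ≠ 0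
  rwa [fderiv_const_sub, neg_ne_zero]

lemma isCompactSmoothDomain_connectedComponentIn_superlevel (hΩ : IsOpen Ω)
    (hu : ContMDiffOn (𝓡 2) 𝓘(ℝ, ℝ) ∞ u Ω) (hE : IsCompact {q ∈ Ω | t ≤ u q})
    (hEc : IsClosed {q ∈ Ω | t ≤ u q})
    (hreg : ∀ p ∈ Ω, u p = t → mfderiv (𝓡 2) 𝓘(ℝ, ℝ) u p ≠ 0) {p : M}
    (hp : p ∈ {q ∈ Ω | t ≤ u q}) :
    IsCompactSmoothDomain (connectedComponentIn {q ∈ Ω | t ≤ u q} p) := by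
  have hu1 : ContMDiffOn (𝓡 2) 𝓘(ℝ, ℝ) 1 u Ω := hu.of_le (by norm_cast)
  have hCE := connectedComponentIn_subset {q ∈ Ω | t ≤ u q} p
  refine ⟨hE.of_isClosed_subset (isClosed_connectedComponentIn hEc p) hCE,
    isConnected_connectedComponentIn_iff.2 hp, fun x hx ↦ ?_⟩
  have hxC := (isClosed_connectedComponentIn hEc p).frontier_subset hx
  obtain ⟨hxΩ, hxt⟩ :=
    frontier_connectedComponentIn_superlevel_subset hΩ hu.continuousOn hEc p hx
  have hnhds := connectedComponentIn_superlevel_mem_nhdsWithin hΩ hu1 hreg x (hCE hxC)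
  rw [← connectedComponentIn_eq hxC, mem_nhdsWithin] at hnhds
  obtain ⟨V, hV, hxV, hVC⟩ := hnhds
  refine ⟨V ∩ Ω, fun q ↦ t - u q, hV.inter hΩ, ⟨hxV, hxΩ⟩,
    contMDiffOn_const.sub (hu.mono inter_subset_right), mfderiv_const_sub_ne_zero
      ((hu1.contMDiffAt (hΩ.mem_nhds hxΩ)).mdifferentiableAt one_ne_zero) (hreg x hxΩ hxt) t, ?_⟩
  ext q
  exact ⟨fun hq ↦ ⟨hq.2, sub_nonpos.2 (hCE hq.1).2⟩,
    fun hq ↦ ⟨hVC ⟨hq.1.1, hq.1.2, sub_nonpos.1 hq.2⟩, hq.1⟩⟩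

end Superlevel

section Isoperimetric

/-- The isoperimetric inequality is superadditive: for `κ > 0` this is clear from
`m² + m'² ≤ (m + m')²`, and for `κ < 0` the cross terms are compared through
`√(-κ) m ≤ s` and `√(-κ) m' ≤ s'`. -/
lemma isoperimetric_add {A κ m s m' s' : ℝ} (hA : 0 ≤ A) (hm : 0 ≤ m) (hs : 0 ≤ s) (hm' : 0 ≤ m')
    (hs' : 0 ≤ s') (h : A * m - κ * m ^ 2 ≤ s ^ 2) (h' : A * m' - κ * m' ^ 2 ≤ s' ^ 2) :
    A * (m + m') - κ * (m + m') ^ 2 ≤ (s + s') ^ 2 := by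
  have hcross : -κ * (m * m') ≤ s * s' := by
    rcases le_or_gt 0 κ with hκ | hκ
    · nlinarith [mul_nonneg hs hs', mul_nonneg hκ (mul_nonneg hm hm')]
    · have hκm : -κ * m ^ 2 ≤ s ^ 2 := by nlinarith [mul_nonneg hA hm]
      have hκm' : -κ * m' ^ 2 ≤ s' ^ 2 := by nlinarith [mul_nonneg hA hm']
      refine le_of_sq_le_sq ?_ (mul_nonneg hs hs')
      calc (-κ * (m * m')) ^ 2 = -κ * m ^ 2 * (-κ * m' ^ 2) := by ring
        _ ≤ s ^ 2 * s' ^ 2 :=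
          mul_le_mul hκm hκm' (mul_nonneg (neg_pos.2 hκ).le (sq_nonneg m')) (sq_nonneg s)
        _ = (s * s') ^ 2 := (mul_pow _ _ _).symm
  nlinarith

lemma isoperimetric_sum {ι : Type*} (F : Finset ι) {A κ : ℝ} {m s : ι → ℝ} (hA : 0 ≤ A)
    (hm : ∀ i ∈ F, 0 ≤ m i) (hs : ∀ i ∈ F, 0 ≤ s i)
    (h : ∀ i ∈ F, A * m i - κ * m i ^ 2 ≤ s i ^ 2) :
    A * (∑ i ∈ F, m i) - κ * (∑ i ∈ F, m i) ^ 2 ≤ (∑ i ∈ F, s i) ^ 2 := by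
  classical
  induction F using Finset.induction_on with
  | empty => simp
  | insert i F hi ih =>
    rw [Finset.sum_insert hi, Finset.sum_insert hi]
    simp only [Finset.forall_mem_insert] at hm hs h
    exact isoperimetric_add hA hm.1 hs.1 (Finset.sum_nonneg hm.2) (Finset.sum_nonneg hs.2) h.1
      (ih hm.2 hs.2 h.2)

lemma isoperimetric_biUnion {X : Type*} [TopologicalSpace X] [MeasurableSpace X] [BorelSpace X]
    {μ ν : Measure X} {A κ : ℝ} (hA : 0 ≤ A) {F : Finset (Set X)} {Γ : Set X}
    (hdisj : (F : Set (Set X)).PairwiseDisjoint id) (hclosed : ∀ C ∈ F, IsClosed C)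
    (hμ : ∀ C ∈ F, μ C ≠ ⊤) (hΓ : ∀ C ∈ F, frontier C ⊆ Γ) (hν : ν Γ ≠ ⊤)
    (h : ∀ C ∈ F, A * μ.real C - κ * μ.real C ^ 2 ≤ ν.real (frontier C) ^ 2) :
    A * μ.real (⋃ C ∈ F, C) - κ * μ.real (⋃ C ∈ F, C) ^ 2 ≤ ν.real Γ ^ 2 := by
  have harea : μ.real (⋃ C ∈ F, C) = ∑ C ∈ F, μ.real C :=
    measureReal_biUnion_finset hdisj (fun C hC ↦ (hclosed C hC).measurableSet) hμ
  have hlength : ∑ C ∈ F, ν.real (frontier C) ≤ ν.real Γ := by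
    rw [← measureReal_biUnion_finset
      (fun C hC C' hC' hne ↦ (hdisj hC hC' hne).mono (hclosed C hC).frontier_subset
        (hclosed C' hC').frontier_subset)
      (fun C _ ↦ isClosed_frontier.measurableSet) fun C hC ↦ measure_ne_top_of_subset (hΓ C hC) hν]
    exact measureReal_mono (iUnion₂_subset hΓ) hν
  rw [harea]
  exact (isoperimetric_sum F hA (fun _ _ ↦ measureReal_nonneg) (fun _ _ ↦ measureReal_nonneg)
    h).trans (pow_le_pow_left₀ (Finset.sum_nonneg fun _ _ ↦ measureReal_nonneg) hlength 2)

variable {M : Type*} [EMetricSpace M] [ChartedSpace Plane M] [IsManifold (𝓡 2) ∞ M]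
  [RiemannianBundle (fun x : M ↦ TangentSpace (𝓡 2) x)]
  [IsContMDiffRiemannianBundle (𝓡 2) ∞ Plane (fun x : M ↦ TangentSpace (𝓡 2) x)]
  [MeasurableSpace M] [BorelSpace M]

theorem IsoperimetricInequality.superlevel {θ κ : ℝ} (hiso : IsoperimetricInequality M θ κ)
    (hθ : 0 ≤ θ) {u : M → ℝ} {Ω : Set M} (hΩ : IsOpen Ω) (hu : ContMDiffOn (𝓡 2) 𝓘(ℝ, ℝ) ∞ u Ω)
    {t : ℝ} (hE : IsCompact {q ∈ Ω | t ≤ u q})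
    (hreg : ∀ p ∈ Ω, u p = t → mfderiv (𝓡 2) 𝓘(ℝ, ℝ) u p ≠ 0)
    (hfin : μH[1] (Ω ∩ u ⁻¹' {t}) ≠ ⊤) :
    4 * Real.pi * θ * (area M).real {q ∈ Ω | t ≤ u q} -
      κ * (area M).real {q ∈ Ω | t ≤ u q} ^ 2 ≤
      (μH[1] : Measure M).real (Ω ∩ u ⁻¹' {t}) ^ 2 := by
  obtain ⟨F, hF, hdisj, hunion⟩ := exists_finset_connectedComponentIn hE
    (connectedComponentIn_superlevel_mem_nhdsWithin hΩ (hu.of_le (by norm_cast)) hreg)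
  rw [hunion]
  refine isoperimetric_biUnion (by positivity) hdisj (fun C hC ↦ ?_) (fun C hC ↦ ?_)
    (fun C hC ↦ ?_) hfin fun C hC ↦ ?_ <;> obtain ⟨p, hp, rfl⟩ := hF C hC
  · exact isClosed_connectedComponentIn hE.isClosed p
  · exact measure_ne_top_of_subset (connectedComponentIn_subset _ p) hE.measure_lt_top.ne
  · exact frontier_connectedComponentIn_superlevel_subset hΩ hu.continuousOn hE.isClosed p
  · exact hiso _
      (isCompactSmoothDomain_connectedComponentIn_superlevel hΩ hu hE hE.isClosed hreg hp)

end Isoperimetric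

section LayerCake

variable {X Y : Type*} [MeasurableSpace X] [MeasurableSpace Y] {μ : Measure X} {ν : Measure Y}

lemma measurable_setIntegral_preimage_mk [SFinite ν] {S : Set (X × Y)} (hS : MeasurableSet S)
    {b : Y → ℝ} (hb : Measurable b) : Measurable fun x ↦ ∫ y in Prod.mk x ⁻¹' S, b y ∂ν := by
  have h : StronglyMeasurable (S.indicator (b ∘ Prod.snd)) :=
    ((hb.comp measurable_snd).indicator hS).stronglyMeasurable
  convert (h.integral_prod_right' (ν := ν)).measurable using 2 with x
  exact (integral_indicator (measurable_prodMk_left hS)).symm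

lemma norm_setIntegral_le_integral_norm {b : X → ℝ} (hb : Integrable b μ) (s : Set X) :
    ‖∫ x in s, b x ∂μ‖ ≤ ∫ x, ‖b x‖ ∂μ :=
  (norm_integral_le_integral_norm _).trans
    (setIntegral_le_integral hb.norm (ae_of_all _ fun _ ↦ norm_nonneg _))

lemma integral_indicator_mul_prodMk {S : Set (X × Y)} (hS : MeasurableSet S) (w : X → ℝ)
    (b : Y → ℝ) (x : X) : ∫ y, S.indicator (fun p ↦ w p.1 * b p.2) (x, y) ∂ν =
      w x * ∫ y in Prod.mk x ⁻¹' S, b y ∂ν := by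
  rw [← integral_const_mul, ← integral_indicator (measurable_prodMk_left hS)]
  rfl

lemma integrable_mul_setIntegral_preimage_mk [SFinite ν] {S : Set (X × Y)}
    (hS : MeasurableSet S) {w : X → ℝ} {b : Y → ℝ} (hw : Integrable w μ) (hb : Integrable b ν) :
    Integrable (fun x ↦ w x * ∫ y in Prod.mk x ⁻¹' S, b y ∂ν) μ :=
  ((hw.mul_prod hb).indicator hS).integral_prod_left.congr
    (ae_of_all _ (integral_indicator_mul_prodMk hS w b))

lemma integral_mul_setIntegral_preimage_mk [SFinite μ] [SFinite ν] {S : Set (X × Y)}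
    (hS : MeasurableSet S) {w : X → ℝ} {b : Y → ℝ} (hw : Integrable w μ) (hb : Integrable b ν) :
    ∫ x, w x * ∫ y in Prod.mk x ⁻¹' S, b y ∂ν ∂μ = ∫ p in S, w p.1 * b p.2 ∂(μ.prod ν) := by
  rw [← integral_indicator hS, integral_prod _ ((hw.mul_prod hb).indicator hS)]
  simp only [integral_indicator_mul_prodMk hS]

lemma integral_mul_setIntegral_preimage_mk_swap [SFinite μ] [SFinite ν] {S : Set (X × Y)}
    (hS : MeasurableSet S) {w : X → ℝ} {b : Y → ℝ} (hw : Integrable w μ) (hb : Integrable b ν) :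
    ∫ y, b y * ∫ x in {x | (x, y) ∈ S}, w x ∂μ ∂ν = ∫ p in S, w p.1 * b p.2 ∂(μ.prod ν) := by
  rw [← integral_indicator hS, integral_prod_symm _ ((hw.mul_prod hb).indicator hS)]
  congr with y
  rw [mul_comm, ← integral_mul_const]
  exact (integral_indicator (measurable_prodMk_right hS)).symm

lemma integral_mul_intervalIntegral [SFinite μ] {u a : X → ℝ} {K : ℝ} (hu : Measurable u)
    (h0 : ∀ x, 0 ≤ u x) (hK : ∀ x, u x ≤ K) (ha : Integrable a μ) {g : ℝ → ℝ}
    (hg : Continuous g) :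
    ∫ x, a x * (∫ t in (0 : ℝ)..u x, g t) ∂μ =
      ∫ t in Ioc 0 K, g t * ∫ x in {x | t ≤ u x}, a x ∂μ := by
  have hS : MeasurableSet {p : X × ℝ | p.2 ≤ u p.1} :=
    measurableSet_le measurable_snd (hu.comp measurable_fst)
  have hgK : IntegrableOn g (Ioc 0 K) := hg.integrableOn_Ioc
  refine Eq.trans (integral_congr_ae <| ae_of_all _ fun x ↦ ?_)
    ((integral_mul_setIntegral_preimage_mk hS ha hgK).trans
      (integral_mul_setIntegral_preimage_mk_swap hS ha hgK).symm)
  have hsec : Prod.mk x ⁻¹' {p : X × ℝ | p.2 ≤ u p.1} ∩ Ioc 0 K = Ioc 0 (u x) := by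
    have hIic : Prod.mk x ⁻¹' {p : X × ℝ | p.2 ≤ u p.1} = Iic (u x) := rfl
    rw [hIic, inter_comm, Ioc_inter_Iic, inf_eq_right.2 (hK x)]
  simp only [intervalIntegral.integral_of_le (h0 x),
    Measure.restrict_restrict (measurable_prodMk_left hS), hsec]

lemma intervalIntegral_exp_two_mul (s : ℝ) :
    ∫ t in (0 : ℝ)..s, Real.exp (2 * t) = (Real.exp (2 * s) - 1) / 2 := by
  rw [intervalIntegral.integral_comp_mul_left (fun t ↦ Real.exp t) two_ne_zero, integral_exp,
    mul_zero, Real.exp_zero, smul_eq_mul]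
  ring

lemma integrable_exp_two_mul [IsFiniteMeasure μ] {u : X → ℝ} {K : ℝ} (hu : Measurable u)
    (hK : ∀ x, u x ≤ K) : Integrable (fun x ↦ Real.exp (2 * u x)) μ :=
  Integrable.of_bound (by fun_prop) (Real.exp (2 * K)) <| ae_of_all _ fun x ↦ by
    rw [Real.norm_eq_abs, Real.abs_exp]
    gcongr
    exact hK x

lemma integral_exp_two_mul_mul_measureReal [IsFiniteMeasure μ] {u : X → ℝ} {K : ℝ}
    (hu : Measurable u) (h0 : ∀ x, 0 ≤ u x) (hK : ∀ x, u x ≤ K) :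
    ∫ t in Ioc 0 K, Real.exp (2 * t) * μ.real {x | t ≤ u x} =
      ((∫ x, Real.exp (2 * u x) ∂μ) - μ.real univ) / 2 := by
  have h := integral_mul_intervalIntegral hu h0 hK (integrable_const (1 : ℝ)) (μ := μ)
    (g := fun t ↦ Real.exp (2 * t)) (by fun_prop)
  simp only [intervalIntegral_exp_two_mul, one_mul, integral_const, smul_eq_mul, mul_one,
    measureReal_restrict_apply_univ] at h
  rw [← h, integral_div, integral_sub (integrable_exp_two_mul hu hK) (integrable_const 1),
    integral_const, smul_eq_mul, mul_one]

lemma integral_exp_two_mul_mul_measureReal_sq [IsFiniteMeasure μ] {u : X → ℝ} {K : ℝ}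
    (hu : Measurable u) (h0 : ∀ x, 0 ≤ u x) (hK : ∀ x, u x ≤ K) :
    ∫ t in Ioc 0 K, Real.exp (2 * t) * μ.real {x | t ≤ u x} ^ 2 =
      ((∫ p, Real.exp (2 * min (u p.1) (u p.2)) ∂(μ.prod μ)) - μ.real univ ^ 2) / 2 := by
  have hsq (t : ℝ) : μ.real {x | t ≤ u x} ^ 2 =
      (μ.prod μ).real {p : X × X | t ≤ min (u p.1) (u p.2)} := by
    have hprod : {p : X × X | t ≤ min (u p.1) (u p.2)} = {x | t ≤ u x} ×ˢ {x | t ≤ u x} := by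
      ext p
      exact le_min_iff (c := t)
    rw [hprod, measureReal_prod_prod, sq]
  simp_rw [hsq]
  rw [integral_exp_two_mul_mul_measureReal (u := fun p : X × X ↦ min (u p.1) (u p.2))
    (by fun_prop) (fun p ↦ le_min (h0 _) (h0 _)) (fun p ↦ (min_le_left _ _).trans (hK _)),
    ← univ_prod_univ, measureReal_prod_prod, sq]

end LayerCake

section WeakSolution

variable {X : Type*} [MeasurableSpace X] {μ : Measure X}

/-- `u ≥ 0` is a weak solution of `-Δu = a` with energy density `D = |∇u|²`, as seen by the test
functions `ψ ∘ u` with `ψ` vanishing near zero (so that no boundary terms occur). Only the measure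
space and the three functions enter, the geometry being hidden in `D`. -/
structure IsWeakSolution (μ : Measure X) (u a D : X → ℝ) : Prop where
  measurable : Measurable u
  nonneg : ∀ x, 0 ≤ u x
  measurable_source : Measurable a
  integrable_source : Integrable a μ
  measurable_energy : Measurable D
  energy_nonneg : ∀ x, 0 ≤ D x
  integrableOn_energy : ∀ ε > 0, IntegrableOn D {x | ε ≤ u x} μ
  integral_deriv_comp_mul : ∀ (ψ ψ' : ℝ → ℝ) (ε : ℝ), 0 < ε → (∀ t, HasDerivAt ψ (ψ' t) t) →
    Continuous ψ' → (∀ t ≤ ε, ψ t = 0) → ∫ x, ψ' (u x) * D x ∂μ = ∫ x, a x * ψ (u x) ∂μ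

namespace IsWeakSolution

variable {u a D : X → ℝ} (h : IsWeakSolution μ u a D)
include h

lemma integral_mul_comp_nonneg {ψ : ℝ → ℝ} (hψ : ContDiff ℝ 1 ψ) (hm : Monotone ψ) {ε : ℝ}
    (hε : 0 < ε) (h0 : ∀ t ≤ ε, ψ t = 0) : 0 ≤ ∫ x, a x * ψ (u x) ∂μ := by
  rw [← h.integral_deriv_comp_mul ψ (deriv ψ) ε hε
    (fun t ↦ (hψ.differentiable one_ne_zero t).hasDerivAt) (hψ.continuous_deriv le_rfl) h0]
  exact integral_nonneg fun x ↦ mul_nonneg hm.deriv_nonneg (h.energy_nonneg x)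

lemma setIntegral_nonneg_of_tendsto {S : Set ℝ} (hS : MeasurableSet S) {ψ : ℕ → ℝ → ℝ}
    (hψ : ∀ n, ContDiff ℝ 1 (ψ n)) (hm : ∀ n, Monotone (ψ n)) (h01 : ∀ n s, ψ n s ∈ Icc 0 1)
    {ε : ℝ} (hε : 0 < ε) (h0 : ∀ n, ∀ t ≤ ε, ψ n t = 0)
    (hlim : ∀ s, Tendsto (fun n ↦ ψ n s) atTop (𝓝 (S.indicator 1 s))) :
    0 ≤ ∫ x in u ⁻¹' S, a x ∂μ := by
  rw [← integral_indicator (h.measurable hS)]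
  refine ge_of_tendsto' (tendsto_integral_of_dominated_convergence (fun x ↦ |a x|)
    (F := fun n x ↦ a x * ψ n (u x)) (fun n ↦ ?_) h.integrable_source.abs
    (fun n ↦ ae_of_all _ fun x ↦ ?_) (ae_of_all _ fun x ↦ ?_))
    fun n ↦ h.integral_mul_comp_nonneg (hψ n) (hm n) hε (h0 n)
  · exact h.integrable_source.aestronglyMeasurable.mul
      ((hψ n).continuous.measurable.comp h.measurable).aestronglyMeasurable
  · rw [norm_mul, Real.norm_eq_abs, Real.norm_of_nonneg (h01 n _).1]
    exact mul_le_of_le_one_right (abs_nonneg _) (h01 n _).2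
  · have hind : (u ⁻¹' S).indicator a x = a x * S.indicator 1 (u x) := by
      by_cases hx : u x ∈ S
      · rw [indicator_of_mem hx, indicator_of_mem (mem_preimage.2 hx), Pi.one_apply, mul_one]
      · rw [indicator_of_notMem hx, indicator_of_notMem (mt mem_preimage.1 hx), mul_zero]
    rw [hind]
    exact (hlim (u x)).const_mul (a x)

lemma setIntegral_ge_nonneg {t : ℝ} (ht : 0 < t) : 0 ≤ ∫ x in {x | t ≤ u x}, a x ∂μ := by
  refine h.setIntegral_nonneg_of_tendsto (S := Ici t) measurableSet_Ici
    (ψ := fun n s ↦ Real.smoothTransition ((n + 2 / t) * (s - t) + 1))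
    (fun n ↦ Real.smoothTransition.contDiff.comp (by fun_prop))
    (fun n r s hrs ↦ Real.smoothTransition.monotone (by gcongr))
    (fun n s ↦ ⟨Real.smoothTransition.nonneg _, Real.smoothTransition.le_one _⟩) (half_pos ht)
    (fun n s hs ↦ Real.smoothTransition.zero_of_nonpos ?_) fun s ↦ ?_
  · have hst : s - t ≤ -(t / 2) := by linarith
    calc (n + 2 / t) * (s - t) + 1 ≤ (n + 2 / t) * -(t / 2) + 1 := by gcongr
      _ = -(n * (t / 2)) := by field_simp; ring
      _ ≤ 0 := neg_nonpos.2 (by positivity)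
  · have hn : Tendsto (fun n : ℕ ↦ (n : ℝ) + 2 / t) atTop atTop :=
      tendsto_atTop_add_const_right _ _ tendsto_natCast_atTop_atTop
    rcases lt_or_ge s t with hs | hs
    · have hbot := tendsto_atBot_add_const_right _ 1 (hn.atTop_mul_const_of_neg (sub_neg.2 hs))
      rw [indicator_of_notMem (notMem_Ici.2 hs)]
      refine tendsto_const_nhds.congr' ?_
      filter_upwards [hbot.eventually_le_atBot 0] with n hns
      exact (Real.smoothTransition.zero_of_nonpos hns).symm
    · rw [indicator_of_mem (mem_Ici.2 hs), Pi.one_apply]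
      refine tendsto_const_nhds.congr fun n ↦ (Real.smoothTransition.one_of_one_le ?_).symm
      exact le_add_of_nonneg_left (mul_nonneg (by positivity) (sub_nonneg.2 hs))

lemma setIntegral_gt_nonneg {t : ℝ} (ht : 0 < t) : 0 ≤ ∫ x in {x | t < u x}, a x ∂μ := by
  have hunion : {x | t < u x} = ⋃ n : ℕ, {x | t + 1 / ((n : ℝ) + 1) ≤ u x} := by
    ext x
    simp only [mem_ofPred_eq, mem_iUnion, ← le_sub_iff_add_le']
    refine ⟨fun hx ↦ (exists_nat_one_div_lt (sub_pos.2 hx)).imp fun n hn ↦ hn.le, ?_⟩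
    rintro ⟨n, hn⟩
    exact sub_pos.1 (Nat.one_div_pos_of_nat.trans_le hn)
  rw [hunion]
  refine ge_of_tendsto' (tendsto_setIntegral_of_monotone
    (fun n ↦ measurableSet_le measurable_const h.measurable) (fun m n hmn x hx ↦ ?_)
    h.integrable_source.integrableOn)
    fun n ↦ h.setIntegral_ge_nonneg (add_pos ht Nat.one_div_pos_of_nat)
  exact (add_le_add_right (Nat.one_div_le_one_div hmn) t).trans hx

end IsWeakSolution

end WeakSolution

section Distribution

variable {X Y : Type*} [MeasurableSpace X] [MeasurableSpace Y] {μ : Measure X} {ν : Measure Y}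

lemma integral_withDensity_ofReal {D g : X → ℝ} (hD : AEMeasurable D μ) (h0 : 0 ≤ᵐ[μ] D) :
    ∫ x, g x ∂(μ.withDensity fun x ↦ ENNReal.ofReal (D x)) = ∫ x, g x * D x ∂μ := by
  rw [integral_withDensity_eq_integral_toReal_smul₀ hD.ennreal_ofReal
    (ae_of_all _ fun _ ↦ ENNReal.ofReal_lt_top)]
  refine integral_congr_ae (h0.mono fun x hx ↦ ?_)
  simp only [ENNReal.toReal_ofReal hx, smul_eq_mul, mul_comm]

lemma map_withDensity_ofReal_eq [TopologicalSpace Y] [BorelSpace Y] [HasOuterApproxClosed Y]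
    {u : X → Y} {D : X → ℝ} {G : Y → ℝ} (hu : Measurable u) (hD : Integrable D μ)
    (hG : Integrable G ν) (hD0 : 0 ≤ᵐ[μ] D) (hG0 : 0 ≤ᵐ[ν] G)
    (h : ∀ g : BoundedContinuousFunction Y ℝ, ∫ x, g (u x) * D x ∂μ = ∫ y, g y * G y ∂ν) :
    (μ.withDensity fun x ↦ ENNReal.ofReal (D x)).map u =
      ν.withDensity fun y ↦ ENNReal.ofReal (G y) := by
  have := isFiniteMeasure_withDensity_ofReal hD.2
  have := isFiniteMeasure_withDensity_ofReal hG.2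
  refine ext_of_forall_integral_eq_of_IsFiniteMeasure fun g ↦ ?_
  rw [integral_map hu.aemeasurable g.continuous.measurable.aestronglyMeasurable,
    integral_withDensity_ofReal hD.aemeasurable hD0,
    integral_withDensity_ofReal hG.aemeasurable hG0, h g]

lemma setLIntegral_preimage_eq_of_map_withDensity_eq {u : X → Y} {w G : Y → ℝ≥0∞}
    {D : X → ℝ≥0∞} (hu : Measurable u) (hw : Measurable w) (hG : Measurable G) (hD : Measurable D)
    (h : (μ.withDensity fun x ↦ w (u x) * D x).map u = ν.withDensity fun y ↦ w y * G y)
    {B : Set Y} (hB : MeasurableSet B) (hw0 : ∀ y ∈ B, w y ≠ 0) (hw1 : ∀ y, w y ≠ ⊤) :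
    ∫⁻ x in u ⁻¹' B, D x ∂μ = ∫⁻ y in B, G y ∂ν := by
  have hcancel {y : Y} (hy : y ∈ B) (d : ℝ≥0∞) : w y * d * (w y)⁻¹ = d := by
    rw [mul_right_comm, ENNReal.mul_inv_cancel (hw0 y hy) (hw1 y), one_mul]
  have hwinv : Measurable fun y ↦ (w y)⁻¹ := hw.inv
  calc ∫⁻ x in u ⁻¹' B, D x ∂μ
      = ∫⁻ x in u ⁻¹' B, w (u x) * D x * (w (u x))⁻¹ ∂μ :=
        setLIntegral_congr_fun (hu hB) fun x hx ↦ (hcancel hx (D x)).symm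
    _ = ∫⁻ y in B, (w y)⁻¹ ∂((μ.withDensity fun x ↦ w (u x) * D x).map u) := by
        rw [setLIntegral_map hB hwinv hu, restrict_withDensity (hu hB)]
        exact (lintegral_withDensity_eq_lintegral_mul _ ((hw.comp hu).mul hD)
          (hwinv.comp hu)).symm
    _ = ∫⁻ y in B, w y * G y * (w y)⁻¹ ∂ν := by
        rw [h, restrict_withDensity hB]
        exact lintegral_withDensity_eq_lintegral_mul _ (hw.mul hG) hwinv
    _ = ∫⁻ y in B, G y ∂ν := setLIntegral_congr_fun hB fun y hy ↦ hcancel hy (G y)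

lemma exists_measure_eq_setLIntegral_rnDeriv (μ ν : Measure X) [μ.HaveLebesgueDecomposition ν] :
    ∃ S, MeasurableSet S ∧ (∀ᵐ x ∂ν, x ∈ S) ∧
      ∀ B ⊆ S, MeasurableSet B → μ B = ∫⁻ x in B, μ.rnDeriv ν x ∂ν := by
  obtain ⟨S, hS, hsing, hν⟩ := Measure.mutuallySingular_singularPart μ ν
  refine ⟨S, hS, hν, fun B hBS hB ↦ ?_⟩
  conv_lhs => rw [Measure.haveLebesgueDecomposition_add μ ν]
  rw [Measure.add_apply, withDensity_apply _ hB, measure_mono_null hBS hsing, zero_add]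

lemma two_mul_lintegral_sqrt_le {D : X → ℝ} (hDm : Measurable D) (hD : ∀ x, 0 ≤ D x) {q : ℝ}
    (hq : 0 < q) (s : Set X) : 2 * ∫⁻ x in s, ENNReal.ofReal √(D x) ∂μ ≤
      ENNReal.ofReal q * ∫⁻ x in s, ENNReal.ofReal (D x) ∂μ + ENNReal.ofReal q⁻¹ * μ s := by
  have hpoint (x : X) : 2 * √(D x) ≤ q * D x + q⁻¹ := by
    have hsq : q * D x + q⁻¹ - 2 * √(D x) = q⁻¹ * (q * √(D x) - 1) ^ 2 := by
      rw [sub_sq, mul_pow, Real.sq_sqrt (hD x)]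
      field_simp
      ring
    exact sub_nonneg.1 (hsq ▸ by positivity)
  rw [← lintegral_const_mul _ (by fun_prop), ← lintegral_const_mul _ (by fun_prop),
    ← setLIntegral_const, ← lintegral_add_right _ measurable_const]
  refine lintegral_mono fun x ↦ ?_
  rw [← ENNReal.ofReal_mul hq.le, ← ENNReal.ofReal_add (mul_nonneg hq.le (hD x))
    (inv_nonneg.2 hq.le), ← ENNReal.ofReal_ofNat 2, ← ENNReal.ofReal_mul two_pos.le]
  exact ENNReal.ofReal_le_ofReal (hpoint x)

lemma sq_le_mul_of_forall_rat {l g r : ℝ} (hl : 0 ≤ l) (hg : 0 ≤ g) (hr : 0 ≤ r)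
    (h : ∀ q : ℚ, 0 < q → 2 * l ≤ q * g + (q : ℝ)⁻¹ * r) : l ^ 2 ≤ g * r := by
  have hquad (x : ℝ) : 0 ≤ g * (x * x) + -(2 * l) * x + r := by
    refine isClosed_property (p := fun x ↦ 0 ≤ g * (x * x) + -(2 * l) * x + r)
      Rat.denseRange_cast (isClosed_le continuous_const (by fun_prop)) (fun q ↦ ?_) x
    rcases le_or_gt q 0 with hq | hq
    · have hq' : 0 ≤ -(q : ℝ) := neg_nonneg.2 (Rat.cast_nonpos.2 hq)
      nlinarith [mul_nonneg hl hq', mul_nonneg hg (mul_self_nonneg (q : ℝ))]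
    · have hq' : (0 : ℝ) < q := Rat.cast_pos.2 hq
      have hmul := mul_le_mul_of_nonneg_left (h q hq) hq'.le
      rw [mul_add, mul_inv_cancel_left₀ hq'.ne'] at hmul
      linarith
  have hdiscrim := discrim_le_zero hquad
  rw [discrim] at hdiscrim
  linarith

lemma ennreal_sq_le_mul_of_forall_rat {l g r : ℝ≥0∞} (hg : g ≠ ⊤) (hr : r ≠ ⊤)
    (h : ∀ q : ℚ, 0 < q → 2 * l ≤ ENNReal.ofReal q * g + ENNReal.ofReal (q : ℝ)⁻¹ * r) :
    l ^ 2 ≤ g * r := by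
  have hl : l ≠ ⊤ := by
    rintro rfl
    have htop := h 1 one_pos
    rw [ENNReal.mul_top two_ne_zero] at htop
    exact absurd htop (not_le.2 (by finiteness))
  rw [← ENNReal.toReal_le_toReal (by finiteness) (by finiteness), ENNReal.toReal_pow,
    ENNReal.toReal_mul]
  refine sq_le_mul_of_forall_rat ENNReal.toReal_nonneg ENNReal.toReal_nonneg
    ENNReal.toReal_nonneg fun q hq ↦ ?_
  have hq' : (0 : ℝ) < q := Rat.cast_pos.2 hq
  have hreal := ENNReal.toReal_mono (by finiteness) (h q hq)
  rwa [ENNReal.toReal_add (by finiteness) (by finiteness), ENNReal.toReal_mul, ENNReal.toReal_mul,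
    ENNReal.toReal_mul, ENNReal.toReal_ofReal hq'.le, ENNReal.toReal_ofReal (inv_nonneg.2 hq'.le),
    ENNReal.toReal_ofNat] at hreal

lemma ae_sq_le_mul_of_forall_setLIntegral [SigmaFinite μ] {L G r : X → ℝ≥0∞} (hL : Measurable L)
    (hG : Measurable G) (hr : Measurable r) (hG' : ∀ᵐ x ∂μ, G x ≠ ⊤) (hr' : ∀ᵐ x ∂μ, r x ≠ ⊤)
    (h : ∀ q : ℝ, 0 < q → ∀ B, MeasurableSet B → 2 * ∫⁻ x in B, L x ∂μ ≤
      ENNReal.ofReal q * ∫⁻ x in B, G x ∂μ + ENNReal.ofReal q⁻¹ * ∫⁻ x in B, r x ∂μ) :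
    ∀ᵐ x ∂μ, L x ^ 2 ≤ G x * r x := by
  have hrat : ∀ᵐ x ∂μ, ∀ q : ℚ, 0 < q →
      2 * L x ≤ ENNReal.ofReal q * G x + ENNReal.ofReal (q : ℝ)⁻¹ * r x := by
    refine ae_all_iff.2 fun q ↦ ae_all_iff.2 fun hq ↦
      ae_le_of_forall_setLIntegral_le_of_sigmaFinite (hL.const_mul 2) fun B hB _ ↦ ?_
    rw [lintegral_const_mul _ hL, lintegral_add_right _ (hr.const_mul _), lintegral_const_mul _ hG,
      lintegral_const_mul _ hr]
    exact h q (Rat.cast_pos.2 hq) B hB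
  filter_upwards [hrat, hG', hr'] with x hx hGx hrx
  exact ennreal_sq_le_mul_of_forall_rat hGx hrx hx

namespace IsWeakSolution

variable {u a D : X → ℝ} (h : IsWeakSolution μ u a D)
include h

lemma integral_comp_mul_energy [SFinite μ] {K : ℝ} (hK : ∀ x, u x ≤ K) {g : ℝ → ℝ}
    (hg : Continuous g) {ε : ℝ} (hε : 0 < ε) (h0 : ∀ t ≤ ε, g t = 0) :
    ∫ x, g (u x) * D x ∂μ = ∫ t in Ioc 0 K, g t * ∫ x in {x | t ≤ u x}, a x ∂μ := by
  rw [← integral_mul_intervalIntegral h.measurable h.nonneg hK h.integrable_source hg]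
  refine h.integral_deriv_comp_mul (fun t ↦ ∫ s in (0 : ℝ)..t, g s) g ε hε
    (fun t ↦ intervalIntegral.integral_hasDerivAt_right (hg.intervalIntegrable _ _)
      (hg.stronglyMeasurableAtFilter _ _) hg.continuousAt) hg fun t ht ↦
    intervalIntegral.integral_zero_ae (ae_of_all _ fun s hs ↦ h0 s ?_)
  exact hs.2.trans (max_le hε.le ht)

lemma integrable_cutoff_mul_energy {K : ℝ} (hK : ∀ x, u x ≤ K) {ε : ℝ} (hε : 0 < ε) :
    Integrable (fun x ↦ max (u x - ε) 0 * D x) μ := by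
  have hind : (fun x ↦ max (u x - ε) 0 * D x) =
      fun x ↦ max (u x - ε) 0 * {x | ε ≤ u x}.indicator D x := by
    funext x
    rcases le_or_gt ε (u x) with hx | hx
    · rw [indicator_of_mem (show x ∈ {x | ε ≤ u x} from hx)]
    · rw [max_eq_right (sub_nonpos.2 hx.le), zero_mul, zero_mul]
  rw [hind]
  refine ((h.integrableOn_energy ε hε).integrable_indicator
    (measurableSet_le measurable_const h.measurable)).bdd_mul (c := K)
    ((h.measurable.sub_const ε).max measurable_const).aestronglyMeasurable
    (ae_of_all _ fun x ↦ ?_)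
  rw [Real.norm_of_nonneg (le_max_right _ _)]
  exact max_le (by linarith [hK x]) ((h.nonneg x).trans (hK x))

lemma measurable_flux [SFinite μ] : Measurable fun t ↦ ∫ x in {x | t ≤ u x}, a x ∂μ :=
  measurable_setIntegral_preimage_mk (S := {p : ℝ × X | p.1 ≤ u p.2})
    (measurableSet_le measurable_fst (h.measurable.comp measurable_snd)) h.measurable_source

lemma integrableOn_cutoff_mul_flux [SFinite μ] (K ε : ℝ) :
    IntegrableOn (fun t ↦ max (t - ε) 0 * ∫ x in {x | t ≤ u x}, a x ∂μ) (Ioc 0 K) :=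
  Integrable.mul_bdd (c := ∫ x, ‖a x‖ ∂μ) (Continuous.integrableOn_Ioc (by fun_prop))
    h.measurable_flux.aestronglyMeasurable <| ae_of_all _ fun _ ↦
      norm_setIntegral_le_integral_norm h.integrable_source _

/-- Test functions have to vanish near zero, whence the weight `max (t - ε) 0`. -/
lemma map_withDensity_cutoff_eq [SFinite μ] {K : ℝ} (hK : ∀ x, u x ≤ K) {ε : ℝ} (hε : 0 < ε) :
    (μ.withDensity fun x ↦ ENNReal.ofReal (max (u x - ε) 0 * D x)).map u =
      (volume.restrict (Ioc 0 K)).withDensity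
        fun t ↦ ENNReal.ofReal (max (t - ε) 0 * ∫ x in {x | t ≤ u x}, a x ∂μ) := by
  refine map_withDensity_ofReal_eq h.measurable (h.integrable_cutoff_mul_energy hK hε)
    (h.integrableOn_cutoff_mul_flux K ε)
    (ae_of_all _ fun x ↦ mul_nonneg (le_max_right _ _) (h.energy_nonneg x)) ?_ fun g ↦ ?_
  · filter_upwards [ae_restrict_mem measurableSet_Ioc] with t ht
    exact mul_nonneg (le_max_right _ _) (h.setIntegral_ge_nonneg ht.1)
  · simp only [← mul_assoc]
    refine h.integral_comp_mul_energy (g := fun t ↦ g t * max (t - ε) 0) hK (by fun_prop) hε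
      fun t ht ↦ ?_
    rw [max_eq_right (sub_nonpos.2 ht), mul_zero]

lemma lintegral_preimage_energy_le [SFinite μ] {K : ℝ} (hK : ∀ x, u x ≤ K) {ε : ℝ} (hε : 0 < ε)
    {B : Set ℝ} (hB : MeasurableSet B) (hBε : B ⊆ Ioi ε) :
    ∫⁻ x in u ⁻¹' B, ENNReal.ofReal (D x) ∂μ ≤
      ∫⁻ t in B, ENNReal.ofReal (∫ x in {x | t ≤ u x}, a x ∂μ) := by
  have hmap := h.map_withDensity_cutoff_eq hK hε
  simp only [ENNReal.ofReal_mul (le_max_right _ (0 : ℝ))] at hmap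
  rw [setLIntegral_preimage_eq_of_map_withDensity_eq
    (w := fun t ↦ ENNReal.ofReal (max (t - ε) 0)) h.measurable (by fun_prop)
    h.measurable_flux.ennreal_ofReal h.measurable_energy.ennreal_ofReal hmap hB
    (fun t ht ↦ (ENNReal.ofReal_pos.2 (lt_max_of_lt_left (sub_pos.2 (hBε ht)))).ne')
    fun _ ↦ ENNReal.ofReal_ne_top]
  exact lintegral_mono' (Measure.restrict_mono_measure Measure.restrict_le_self B) le_rfl

/-- Cauchy–Schwarz on the level sets of `u`, where `L` plays the role of the length of the level and
the integral of `a` that of the flux through it. -/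
theorem ae_sq_le [IsFiniteMeasure μ] {K : ℝ} (hK : ∀ x, u x ≤ K) {L : ℝ → ℝ≥0∞}
    (hL : Measurable L) (hcoarea : ∀ B, MeasurableSet B →
      ∫⁻ t in B, L t ≤ ∫⁻ x in u ⁻¹' B, ENNReal.ofReal √(D x) ∂μ) :
    ∀ᵐ t, 0 < t → L t ^ 2 ≤
      ENNReal.ofReal (∫ x in {x | t ≤ u x}, a x ∂μ) * (μ.map u).rnDeriv volume t := by
  obtain ⟨S, hS, hSae, hdensity⟩ := exists_measure_eq_setLIntegral_rnDeriv (μ.map u) volume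
  have hε {ε : ℝ} (hε : 0 < ε) : ∀ᵐ t ∂volume.restrict (Ioi ε ∩ S), L t ^ 2 ≤
      ENNReal.ofReal (∫ x in {x | t ≤ u x}, a x ∂μ) * (μ.map u).rnDeriv volume t := by
    refine ae_sq_le_mul_of_forall_setLIntegral hL h.measurable_flux.ennreal_ofReal
      (Measure.measurable_rnDeriv _ _) (ae_of_all _ fun _ ↦ ENNReal.ofReal_ne_top)
      (ae_restrict_of_ae (Measure.rnDeriv_ne_top _ _)) fun q hq B hB ↦ ?_
    have hB' : MeasurableSet (B ∩ (Ioi ε ∩ S)) := hB.inter (measurableSet_Ioi.inter hS)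
    rw [Measure.restrict_restrict hB, ← hdensity _ (fun t ht ↦ ht.2.2) hB',
      Measure.map_apply h.measurable hB']
    calc 2 * ∫⁻ t in B ∩ (Ioi ε ∩ S), L t
        ≤ 2 * ∫⁻ x in u ⁻¹' (B ∩ (Ioi ε ∩ S)), ENNReal.ofReal √(D x) ∂μ := by
          gcongr
          exact hcoarea _ hB'
      _ ≤ _ := two_mul_lintegral_sqrt_le h.measurable_energy h.energy_nonneg hq _
      _ ≤ _ := by
          gcongr
          exact h.lintegral_preimage_energy_le hK hε hB' fun t ht ↦ ht.2.1
  have hall := ae_all_iff.2 fun n : ℕ ↦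
    (ae_restrict_iff' (measurableSet_Ioi.inter hS)).1 (hε (Nat.one_div_pos_of_nat (n := n)))
  filter_upwards [hall, hSae] with t ht htS ht0
  obtain ⟨n, hn⟩ := exists_nat_one_div_lt ht0
  exact ht n ⟨hn, htS⟩

end IsWeakSolution

end Distribution

section Comparison

variable {X : Type*} [MeasurableSpace X] {μ : Measure X}

lemma setIntegral_le_add_setIntegral_lt_of_symm [SFinite μ] {u : X → ℝ} (hu : Measurable u)
    {F : X × X → ℝ} (hF : Integrable F (μ.prod μ)) (hsymm : ∀ p, F p.swap = F p) :
    (∫ p in {p | u p.1 ≤ u p.2}, F p ∂μ.prod μ) + ∫ p in {p | u p.1 < u p.2}, F p ∂μ.prod μ =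
      ∫ p, F p ∂μ.prod μ := by
  have hle : MeasurableSet {p : X × X | u p.1 ≤ u p.2} :=
    measurableSet_le (hu.comp measurable_fst) (hu.comp measurable_snd)
  have hcompl : {p : X × X | u p.1 ≤ u p.2}ᶜ = Prod.swap ⁻¹' {p | u p.1 < u p.2} := by
    ext p
    exact not_le (a := u p.1)
  have hswap := (Measure.measurePreserving_swap (μ := μ) (ν := μ)).setIntegral_preimage_emb
    MeasurableEquiv.prodComm.measurableEmbedding F {p | u p.1 < u p.2}
  simp only [hsymm, ← hcompl] at hswap
  rw [← hswap, integral_add_compl hle hF]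

/-- The mean of the two one-sided limits at `t` of the tail `s ↦ ∫_{u > s} b`. They differ where the
distribution of `u` has an atom, and only their mean makes `integral_mul_meanTail` symmetric. -/
def meanTail (μ : Measure X) (u b : X → ℝ) (t : ℝ) : ℝ :=
  ((∫ x in {x | t ≤ u x}, b x ∂μ) + ∫ x in {x | t < u x}, b x ∂μ) / 2

lemma measurable_meanTail [SFinite μ] {u b : X → ℝ} (hu : Measurable u) (hb : Measurable b) :
    Measurable (meanTail μ u b) :=
  ((measurable_setIntegral_preimage_mk (S := {p : ℝ × X | p.1 ≤ u p.2})
    (measurableSet_le measurable_fst (hu.comp measurable_snd)) hb).add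
      (measurable_setIntegral_preimage_mk (S := {p : ℝ × X | p.1 < u p.2})
        (measurableSet_lt measurable_fst (hu.comp measurable_snd)) hb)).div_const 2

lemma norm_meanTail_le {b : X → ℝ} (hb : Integrable b μ) (u : X → ℝ) (t : ℝ) :
    ‖meanTail μ u b t‖ ≤ ∫ x, ‖b x‖ ∂μ := by
  rw [meanTail, norm_div, Real.norm_ofNat, div_le_iff₀ two_pos, mul_two]
  exact norm_add_le_of_le (norm_setIntegral_le_integral_norm hb _)
    (norm_setIntegral_le_integral_norm hb _)

lemma ae_meanTail_eq [SFinite μ] {u : X → ℝ} (hu : Measurable u) (b : X → ℝ) :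
    ∀ᵐ t, meanTail μ u b t = ∫ x in {x | t ≤ u x}, b x ∂μ := by
  have hatom : ∀ᵐ t : ℝ, ¬0 < μ {x | u x = t} :=
    measure_eq_zero_iff_ae_notMem.1 ((Measure.countable_meas_level_set_pos hu).measure_zero _)
  filter_upwards [hatom] with t ht
  have hlt : ({x | t < u x} : Set X) =ᵐ[μ] {x | t ≤ u x} := by
    have hne : ∀ᵐ x ∂μ, x ∉ {x | u x = t} :=
      measure_eq_zero_iff_ae_notMem.1 (nonpos_iff_eq_zero.1 (not_lt.1 ht))
    filter_upwards [hne] with x hx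
    exact propext ⟨le_of_lt, fun h ↦ lt_of_le_of_ne h (Ne.symm hx)⟩
  rw [meanTail, setIntegral_congr_set hlt, add_self_div_two]

lemma integral_mul_meanTail [SFinite μ] {u w b : X → ℝ} (hu : Measurable u) (hw : Integrable w μ)
    (hb : Integrable b μ) :
    ∫ x, w x * meanTail μ u b (u x) ∂μ =
      ((∫ p in {p | u p.1 ≤ u p.2}, w p.1 * b p.2 ∂μ.prod μ) +
        ∫ p in {p | u p.1 < u p.2}, w p.1 * b p.2 ∂μ.prod μ) / 2 := by
  have hle : MeasurableSet {p : X × X | u p.1 ≤ u p.2} :=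
    measurableSet_le (hu.comp measurable_fst) (hu.comp measurable_snd)
  have hlt : MeasurableSet {p : X × X | u p.1 < u p.2} :=
    measurableSet_lt (hu.comp measurable_fst) (hu.comp measurable_snd)
  rw [← integral_mul_setIntegral_preimage_mk hle hw hb,
    ← integral_mul_setIntegral_preimage_mk hlt hw hb,
    ← integral_add (integrable_mul_setIntegral_preimage_mk hle hw hb)
      (integrable_mul_setIntegral_preimage_mk hlt hw hb), ← integral_div]
  congr with x
  rw [meanTail, mul_div_assoc', mul_add]
  rfl

lemma integral_exp_two_mul_mul_meanTail [IsFiniteMeasure μ] {u : X → ℝ} {K : ℝ}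
    (hu : Measurable u) (hK : ∀ x, u x ≤ K) (κ lam : ℝ) :
    ∫ x, Real.exp (2 * u x) * meanTail μ u (fun x ↦ lam * Real.exp (2 * u x) - κ) (u x) ∂μ =
      (lam * (∫ x, Real.exp (2 * u x) ∂μ) ^ 2 -
        κ * ∫ p, Real.exp (2 * min (u p.1) (u p.2)) ∂(μ.prod μ)) / 2 := by
  have hexp := integrable_exp_two_mul (μ := μ) hu hK
  have hmin : Integrable (fun p : X × X ↦ Real.exp (2 * min (u p.1) (u p.2))) (μ.prod μ) :=
    integrable_exp_two_mul (by fun_prop) fun p ↦ (min_le_left _ _).trans (hK p.1)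
  set F : X × X → ℝ := fun p ↦ lam * (Real.exp (2 * u p.1) * Real.exp (2 * u p.2)) -
    κ * Real.exp (2 * min (u p.1) (u p.2)) with hF
  have hFi : Integrable F (μ.prod μ) := ((hexp.mul_prod hexp).const_mul lam).sub (hmin.const_mul κ)
  have hle : EqOn (fun p ↦ Real.exp (2 * u p.1) * (lam * Real.exp (2 * u p.2) - κ)) F
      {p | u p.1 ≤ u p.2} := fun p hp ↦ by
    simp only [hF, min_eq_left (mem_ofPred_eq ▸ hp)]
    ring
  have hlt : EqOn (fun p ↦ Real.exp (2 * u p.1) * (lam * Real.exp (2 * u p.2) - κ)) F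
      {p | u p.1 < u p.2} := fun p hp ↦ hle (le_of_lt (mem_ofPred_eq ▸ hp))
  have hb : Integrable (fun x ↦ lam * Real.exp (2 * u x) - κ) μ :=
    (hexp.const_mul lam).sub (integrable_const κ)
  rw [integral_mul_meanTail hu hexp hb,
    setIntegral_congr_fun (measurableSet_le (by fun_prop) (by fun_prop)) hle,
    setIntegral_congr_fun (measurableSet_lt (by fun_prop) (by fun_prop)) hlt,
    setIntegral_le_add_setIntegral_lt_of_symm hu hFi fun p ↦ by
      simp only [hF, Prod.fst_swap, Prod.snd_swap, min_comm, mul_comm (Real.exp (2 * u p.2))],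
    integral_sub ((hexp.mul_prod hexp).const_mul lam) (hmin.const_mul κ), integral_const_mul,
    integral_const_mul, integral_prod_mul (fun x ↦ Real.exp (2 * u x)) fun x ↦ Real.exp (2 * u x),
    sq]

lemma integral_exp_two_mul_mul_const_add_meanTail [IsFiniteMeasure μ] {u : X → ℝ} {K : ℝ}
    (hu : Measurable u) (hK : ∀ x, u x ≤ K) (κ lam β : ℝ) :
    ∫ x, Real.exp (2 * u x) *
        (β + meanTail μ u (fun x ↦ lam * Real.exp (2 * u x) - κ) (u x)) ∂μ =
      (∫ x, Real.exp (2 * u x) ∂μ) * β + (lam * (∫ x, Real.exp (2 * u x) ∂μ) ^ 2 -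
        κ * ∫ p, Real.exp (2 * min (u p.1) (u p.2)) ∂(μ.prod μ)) / 2 := by
  have hexp := integrable_exp_two_mul (μ := μ) hu hK
  have hb : Integrable (fun x ↦ lam * Real.exp (2 * u x) - κ) μ :=
    (hexp.const_mul lam).sub (integrable_const κ)
  have hmean : Integrable (fun x ↦ Real.exp (2 * u x) *
      meanTail μ u (fun x ↦ lam * Real.exp (2 * u x) - κ) (u x)) μ := hexp.mul_bdd
    ((measurable_meanTail hu (by fun_prop)).comp hu).aestronglyMeasurable
    (ae_of_all _ fun x ↦ norm_meanTail_le hb u (u x))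
  simp only [mul_add]
  rw [integral_add (hexp.mul_const β) hmean, integral_mul_const]
  exact congrArg _ (integral_exp_two_mul_mul_meanTail hu hK κ lam)

lemma integrableOn_toReal_rnDeriv_mul {m ν : Measure X} [SigmaFinite m] {s : Set X}
    (hs : MeasurableSet s) {g : X → ℝ} (hg : IntegrableOn g s m) :
    IntegrableOn (fun x ↦ (m.rnDeriv ν x).toReal * g x) s ν := by
  have hdensity : Integrable g ((ν.withDensity (m.rnDeriv ν)).restrict s) :=
    hg.mono_measure (Measure.withDensity_rnDeriv_le m ν)
  rwa [restrict_withDensity hs, integrable_withDensity_iff_integrable_smul'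
    (Measure.measurable_rnDeriv m ν) (ae_restrict_of_ae (Measure.rnDeriv_lt_top m ν))] at hdensity

lemma setIntegral_toReal_rnDeriv_mul_le {m ν : Measure X} [SigmaFinite m] {s : Set X}
    (hs : MeasurableSet s) {g : X → ℝ} (hg : IntegrableOn g s m) (hg0 : ∀ x ∈ s, 0 ≤ g x) :
    ∫ x in s, (m.rnDeriv ν x).toReal * g x ∂ν ≤ ∫ x in s, g x ∂m := by
  have hdensity := setIntegral_withDensity_eq_setIntegral_toReal_smul
    (Measure.measurable_rnDeriv m ν) (ae_restrict_of_ae (Measure.rnDeriv_lt_top m ν)) g hs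
  simp only [smul_eq_mul] at hdensity
  rw [← hdensity]
  refine integral_mono_measure
    (Measure.restrict_mono_measure (Measure.withDensity_rnDeriv_le m ν) s) ?_ hg
  filter_upwards [ae_restrict_mem hs] with x hx using hg0 x hx

lemma integrableOn_exp_two_mul_mul {m : Measure ℝ} [IsLocallyFiniteMeasure m] {h : ℝ → ℝ}
    (hm : Measurable h) {C : ℝ} (hC : ∀ t, ‖h t‖ ≤ C) (K : ℝ) :
    IntegrableOn (fun t ↦ Real.exp (2 * t) * h t) (Ioc 0 K) m :=
  Integrable.mul_bdd (Continuous.integrableOn_Ioc (by fun_prop)) hm.aestronglyMeasurable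
    (ae_of_all _ hC)

lemma measurable_measureReal_ge [IsFiniteMeasure μ] {u : X → ℝ} (hu : Measurable u) :
    Measurable fun t ↦ μ.real {x | t ≤ u x} :=
  (measurable_measure_prodMk_left (measurableSet_le measurable_fst
    (hu.comp measurable_snd) : MeasurableSet {p : ℝ × X | p.1 ≤ u p.2})).ennreal_toReal

lemma integrableOn_exp_two_mul_mul_measureReal_pow [IsFiniteMeasure μ] {u : X → ℝ}
    (hu : Measurable u) (K : ℝ) (n : ℕ) :
    IntegrableOn (fun t ↦ Real.exp (2 * t) * μ.real {x | t ≤ u x} ^ n) (Ioc 0 K) := by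
  refine integrableOn_exp_two_mul_mul ((measurable_measureReal_ge hu).pow_const n)
    (C := μ.real univ ^ n) (fun t ↦ ?_) K
  rw [Real.norm_of_nonneg (by positivity)]
  exact pow_le_pow_left₀ measureReal_nonneg (measureReal_mono (subset_univ _)) n

lemma setIntegral_rnDeriv_map_mul_le [IsFiniteMeasure μ] {u : X → ℝ} (hu : Measurable u)
    {s : Set ℝ} (hs : MeasurableSet s) (hus : ∀ᵐ x ∂μ, u x ∈ s) {g : ℝ → ℝ} (hg : Measurable g)
    (hgi : IntegrableOn g s (μ.map u)) (hg0 : ∀ t ∈ s, 0 ≤ g t) :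
    ∫ t in s, ((μ.map u).rnDeriv volume t).toReal * g t ≤ ∫ x, g (u x) ∂μ := by
  refine (setIntegral_toReal_rnDeriv_mul_le hs hgi hg0).trans_eq ?_
  rw [setIntegral_map hs hg.aestronglyMeasurable hu.aemeasurable]
  rw [Measure.restrict_eq_self_of_ae_mem (s := u ⁻¹' s) hus]

lemma integrableOn_exp_two_mul_mul_isoperimetric [IsFiniteMeasure μ] {u : X → ℝ}
    (hu : Measurable u) (K T κ : ℝ) :
    IntegrableOn (fun t ↦ Real.exp (2 * t) *
      (T * μ.real {x | t ≤ u x} - κ * μ.real {x | t ≤ u x} ^ 2)) (Ioc 0 K) := by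
  refine (((integrableOn_exp_two_mul_mul_measureReal_pow (μ := μ) hu K 1).const_mul T).sub
    ((integrableOn_exp_two_mul_mul_measureReal_pow (μ := μ) hu K 2).const_mul κ)).congr
      (ae_of_all _ fun t ↦ ?_)
  simp only [Pi.sub_apply]
  ring

lemma integral_exp_two_mul_mul_isoperimetric [IsFiniteMeasure μ] {u : X → ℝ} {K : ℝ}
    (hu : Measurable u) (h0 : ∀ x, 0 ≤ u x) (hK : ∀ x, u x ≤ K) (T κ : ℝ) :
    ∫ t in Ioc 0 K, Real.exp (2 * t) *
        (T * μ.real {x | t ≤ u x} - κ * μ.real {x | t ≤ u x} ^ 2) =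
      (T * ((∫ x, Real.exp (2 * u x) ∂μ) - μ.real univ) -
        κ * ((∫ p, Real.exp (2 * min (u p.1) (u p.2)) ∂(μ.prod μ)) - μ.real univ ^ 2)) / 2 := by
  have hone := integrableOn_exp_two_mul_mul_measureReal_pow (μ := μ) hu K 1
  have htwo := integrableOn_exp_two_mul_mul_measureReal_pow (μ := μ) hu K 2
  simp only [pow_one] at hone
  simp only [mul_sub, mul_left_comm (Real.exp _)]
  rw [integral_sub (hone.const_mul T) (htwo.const_mul κ), integral_const_mul, integral_const_mul,
    integral_exp_two_mul_mul_measureReal hu h0 hK, integral_exp_two_mul_mul_measureReal_sq hu h0 hK]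
  ring

/-- The differential inequality `hiso` for the distribution function `t ↦ μ {u ≥ t}` is integrated
against `e^{2t}`; both sides are then computed by Fubini's theorem, and the terms containing the
integral of `e^{2 min (u x) (u y)}` cancel. -/
theorem exp_comparison [IsFiniteMeasure μ] {u : X → ℝ} {K T κ lam β : ℝ} (hu : Measurable u)
    (h0 : ∀ x, 0 ≤ u x) (hpos : ∀ᵐ x ∂μ, 0 < u x) (hK : ∀ x, u x ≤ K)
    (hge : ∀ t > 0, 0 ≤ β + ∫ x in {x | t ≤ u x}, (lam * Real.exp (2 * u x) - κ) ∂μ)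
    (hgt : ∀ t > 0, 0 ≤ β + ∫ x in {x | t < u x}, (lam * Real.exp (2 * u x) - κ) ∂μ)
    (hiso : ∀ᵐ t, 0 < t → T * μ.real {x | t ≤ u x} - κ * μ.real {x | t ≤ u x} ^ 2 ≤
      (β + ∫ x in {x | t ≤ u x}, (lam * Real.exp (2 * u x) - κ) ∂μ) *
        ((μ.map u).rnDeriv volume t).toReal) :
    T * ((∫ x, Real.exp (2 * u x) ∂μ) - μ.real univ) + κ * μ.real univ ^ 2 ≤
      2 * β * (∫ x, Real.exp (2 * u x) ∂μ) + lam * (∫ x, Real.exp (2 * u x) ∂μ) ^ 2 := by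
  set b : X → ℝ := fun x ↦ lam * Real.exp (2 * u x) - κ
  have hb : Integrable b μ :=
    ((integrable_exp_two_mul hu hK).const_mul lam).sub (integrable_const κ)
  set G : ℝ → ℝ := fun t ↦ β + meanTail μ u b t with hG
  have hGm : Measurable G := (measurable_meanTail hu (by fun_prop)).const_add β
  have hG0 (t : ℝ) (ht : t ∈ Ioc 0 K) : 0 ≤ Real.exp (2 * t) * G t := by
    refine mul_nonneg (Real.exp_nonneg _) ?_
    rw [hG]
    simp only [meanTail]
    linarith [hge t ht.1, hgt t ht.1]
  have hGi : IntegrableOn (fun t ↦ Real.exp (2 * t) * G t) (Ioc 0 K) (μ.map u) :=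
    integrableOn_exp_two_mul_mul hGm (fun t ↦ norm_add_le_of_le le_rfl (norm_meanTail_le hb u t)) K
  have hcompare := calc
    ∫ t in Ioc 0 K, Real.exp (2 * t) *
        (T * μ.real {x | t ≤ u x} - κ * μ.real {x | t ≤ u x} ^ 2)
      ≤ ∫ t in Ioc 0 K, ((μ.map u).rnDeriv volume t).toReal * (Real.exp (2 * t) * G t) := by
        refine integral_mono_ae (integrableOn_exp_two_mul_mul_isoperimetric hu K T κ)
          (integrableOn_toReal_rnDeriv_mul measurableSet_Ioc hGi) ?_
        filter_upwards [ae_restrict_mem measurableSet_Ioc, ae_restrict_of_ae hiso,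
          ae_restrict_of_ae (ae_meanTail_eq (μ := μ) hu b)] with t ht hisot hmeant
        rw [mul_left_comm, mul_comm (ENNReal.toReal _), hG]
        simp only [hmeant]
        exact mul_le_mul_of_nonneg_left (hisot ht.1) (Real.exp_nonneg _)
    _ ≤ ∫ x, Real.exp (2 * u x) * G (u x) ∂μ :=
        setIntegral_rnDeriv_map_mul_le hu measurableSet_Ioc
          (hpos.mono fun x hx ↦ ⟨hx, hK x⟩) (by fun_prop) hGi hG0
    _ = (∫ x, Real.exp (2 * u x) ∂μ) * β + (lam * (∫ x, Real.exp (2 * u x) ∂μ) ^ 2 -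
          κ * ∫ p, Real.exp (2 * min (u p.1) (u p.2)) ∂(μ.prod μ)) / 2 :=
        integral_exp_two_mul_mul_const_add_meanTail hu hK κ lam β
  rw [integral_exp_two_mul_mul_isoperimetric hu h0 hK] at hcompare
  linarith

end Comparison

section AbstractComparison

variable {X : Type*} [MeasurableSpace X] {μ : Measure X}

lemma setIntegral_le_integral_max_sub_add {a b : X → ℝ} (ha : Integrable a μ)
    (hb : Integrable b μ) (s : Set X) :
    ∫ x in s, a x ∂μ ≤ (∫ x, max (a x - b x) 0 ∂μ) + ∫ x in s, b x ∂μ := by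
  have hab : Integrable (fun x ↦ max (a x - b x) 0) μ := (ha.sub hb).pos_part
  calc ∫ x in s, a x ∂μ ≤ ∫ x in s, (max (a x - b x) 0 + b x) ∂μ :=
        integral_mono ha.integrableOn (hab.integrableOn.add hb.integrableOn)
          fun x ↦ sub_le_iff_le_add.1 (le_max_left _ _)
    _ = (∫ x in s, max (a x - b x) 0 ∂μ) + ∫ x in s, b x ∂μ :=
        integral_add hab.integrableOn hb.integrableOn
    _ ≤ _ := by
        gcongr
        · exact ae_of_all _ fun x ↦ le_max_right _ _
        · exact Measure.restrict_le_self

theorem IsWeakSolution.exp_comparison [IsFiniteMeasure μ] {u a D : X → ℝ} {K T κ lam : ℝ}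
    (h : IsWeakSolution μ u a D) (hpos : ∀ᵐ x ∂μ, 0 < u x) (hK : ∀ x, u x ≤ K)
    (hiso : ∀ᵐ t, 0 < t → T * μ.real {x | t ≤ u x} - κ * μ.real {x | t ≤ u x} ^ 2 ≤
      (∫ x in {x | t ≤ u x}, a x ∂μ) * ((μ.map u).rnDeriv volume t).toReal) :
    T * ((∫ x, Real.exp (2 * u x) ∂μ) - μ.real univ) + κ * μ.real univ ^ 2 ≤
      2 * (∫ x, max (a x - (lam * Real.exp (2 * u x) - κ)) 0 ∂μ) * (∫ x, Real.exp (2 * u x) ∂μ) +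
        lam * (∫ x, Real.exp (2 * u x) ∂μ) ^ 2 := by
  have hflux (s : Set X) := setIntegral_le_integral_max_sub_add h.integrable_source
    (((integrable_exp_two_mul h.measurable hK).const_mul lam).sub (integrable_const κ)) s
  refine SphereCovering.exp_comparison h.measurable h.nonneg hpos hK
    (fun t ht ↦ (h.setIntegral_ge_nonneg ht).trans (hflux _))
    (fun t ht ↦ (h.setIntegral_gt_nonneg ht).trans (hflux _)) ?_
  filter_upwards [hiso] with t hisot ht
  exact (hisot ht).trans (mul_le_mul_of_nonneg_right (hflux _) ENNReal.toReal_nonneg)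

end AbstractComparison

section SurfaceWeakSolution

lemma superlevel_indicator {X : Type*} (u : X → ℝ) (Ω : Set X) {t : ℝ} (ht : 0 < t) :
    {p | t ≤ Ω.indicator u p} = {q ∈ Ω | t ≤ u q} := by
  ext p
  by_cases hp : p ∈ Ω <;> simp [hp, ht]

lemma tsupport_indicator_comp_subset {X : Type*} [TopologicalSpace X] {u : X → ℝ} {Ω : Set X}
    {ε : ℝ} (hE : IsClosed {q ∈ Ω | ε ≤ u q}) {ψ : ℝ → ℝ} (hψ : ∀ t ≤ ε, ψ t = 0) :
    tsupport (Ω.indicator (ψ ∘ u)) ⊆ {q ∈ Ω | ε ≤ u q} := by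
  refine closure_minimal (fun q hq ↦ ?_) hE
  rw [support_indicator] at hq
  exact ⟨hq.1, le_of_not_ge fun h ↦ hq.2 (hψ _ h)⟩

variable {M : Type*} [TopologicalSpace M] [ChartedSpace Plane M] {u : M → ℝ} {Ω : Set M}

lemma contMDiff_indicator {φ : M → ℝ} {n : ℕ∞ω} (hΩ : IsOpen Ω)
    (hφ : ContMDiffOn (𝓡 2) 𝓘(ℝ, ℝ) n φ Ω) (hsub : tsupport (Ω.indicator φ) ⊆ Ω) :
    ContMDiff (𝓡 2) 𝓘(ℝ, ℝ) n (Ω.indicator φ) := by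
  refine contMDiff_of_tsupport fun p hp ↦ ?_
  exact (hφ.contMDiffAt (hΩ.mem_nhds (hsub hp))).congr_of_eventuallyEq
    (eqOn_indicator.eventuallyEq_of_mem (hΩ.mem_nhds (hsub hp)))

variable [RiemannianBundle (fun x : M ↦ TangentSpace (𝓡 2) x)]

lemma gradInner_congr {φ φ' : M → ℝ} {p : M} (h : φ =ᶠ[𝓝 p] φ') :
    gradInner u φ p = gradInner u φ' p := by
  have hcoord : φ ∘ (extChartAt (𝓡 2) p).symm =ᶠ[𝓝 (extChartAt (𝓡 2) p p)]
      φ' ∘ (extChartAt (𝓡 2) p).symm := by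
    have hsymm := continuousAt_extChartAt_symm (I := 𝓡 2) p
    rw [ContinuousAt, extChartAt_to_inv] at hsymm
    exact hsymm.eventually h
  simp only [gradInner, chartGradInner, partialDeriv, hcoord.fderiv_eq]

variable [IsManifold (𝓡 2) ∞ M]

lemma gradInner_indicator_comp (hΩ : IsOpen Ω) (hu : ContMDiffOn (𝓡 2) 𝓘(ℝ, ℝ) 1 u Ω)
    {ψ ψ' : ℝ → ℝ} (hψ : ∀ t, HasDerivAt ψ (ψ' t) t)
    (hsub : tsupport (Ω.indicator (ψ ∘ u)) ⊆ Ω) :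
    gradInner u (Ω.indicator (ψ ∘ u)) = Ω.indicator fun p ↦ ψ' (u p) * gradInner u u p := by
  funext p
  by_cases hp : p ∈ Ω
  · rw [indicator_of_mem hp, ← gradInner_comp (hu.contMDiffAt (hΩ.mem_nhds hp)) (hψ _)]
    exact gradInner_congr (eqOn_indicator.eventuallyEq_of_mem (hΩ.mem_nhds hp))
  · rw [indicator_of_notMem hp, gradInner_eq_zero fun h ↦ hp (hsub h)]

variable [T2Space M] [SecondCountableTopology M]
  [IsContMDiffRiemannianBundle (𝓡 2) ∞ Plane (fun x : M ↦ TangentSpace (𝓡 2) x)]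
  [MeasurableSpace M] [BorelSpace M]

lemma integral_deriv_comp_mul_gradInner (hΩ : IsOpen Ω)
    (hu : ContMDiffOn (𝓡 2) 𝓘(ℝ, ℝ) ∞ u Ω) {ε : ℝ} (hE : IsCompact {q ∈ Ω | ε ≤ u q})
    {ψ ψ' : ℝ → ℝ} (hψ : ∀ t, HasDerivAt ψ (ψ' t) t) (hψ' : Continuous ψ')
    (h0 : ∀ t ≤ ε, ψ t = 0) :
    ∫ p in Ω, ψ' (u p) * gradInner u u p ∂(area M) =
      ∫ p in Ω, -laplacian u p * ψ (u p) ∂(area M) := by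
  have htsupport := tsupport_indicator_comp_subset hE.isClosed h0
  have hsub : tsupport (Ω.indicator (ψ ∘ u)) ⊆ Ω := htsupport.trans (sep_subset _ _)
  have hu1 : ContMDiffOn (𝓡 2) 𝓘(ℝ, ℝ) 1 u Ω := hu.of_le (by norm_cast)
  have hψ1 : ContDiff ℝ 1 ψ :=
    contDiff_one_iff_deriv.2 ⟨fun t ↦ (hψ t).differentiableAt, by rwa [deriv_eq hψ]⟩
  have hgreen := integral_gradInner hΩ hu
    (contMDiff_indicator hΩ (hψ1.contMDiff.comp_contMDiffOn hu1) hsub)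
    (hE.of_isClosed_subset (isClosed_tsupport _) htsupport) hsub
  have hright : (fun p ↦ laplacian u p * Ω.indicator (ψ ∘ u) p) =
      Ω.indicator fun p ↦ laplacian u p * ψ (u p) :=
    funext fun p ↦ (indicator_mul_right Ω (laplacian u) (ψ ∘ u)).symm
  rw [gradInner_indicator_comp hΩ hu1 hψ hsub, hright, integral_indicator hΩ.measurableSet,
    integral_indicator hΩ.measurableSet, ← integral_neg] at hgreen
  simpa only [neg_mul] using hgreen

end SurfaceWeakSolution

section LevelLines

variable {M : Type*} [EMetricSpace M] [ChartedSpace Plane M]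
  [RiemannianBundle (fun x : M ↦ TangentSpace (𝓡 2) x)] {u : M → ℝ} {Ω : Set M}

lemma gradNorm_nonneg (Ω : Set M) (u : M → ℝ) (p : M) : 0 ≤ gradNorm Ω u p :=
  indicator_nonneg (fun _ _ ↦ Real.sqrt_nonneg _) p

variable [IsManifold (𝓡 2) ∞ M]

lemma gradNorm_sq {p : M} (hp : p ∈ Ω) : gradNorm Ω u p ^ 2 = gradInner u u p := by
  rw [gradNorm, indicator_of_mem hp, Real.sq_sqrt (gradInner_self_nonneg u p)]

variable [SecondCountableTopology M]
  [IsContMDiffRiemannianBundle (𝓡 2) ∞ Plane (fun x : M ↦ TangentSpace (𝓡 2) x)]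
  [MeasurableSpace M] [BorelSpace M]

theorem isWeakSolution_indicator (hΩ : IsOpen Ω) (hu : ContMDiffOn (𝓡 2) 𝓘(ℝ, ℝ) ∞ u Ω)
    (hpos : ∀ p ∈ Ω, 0 < u p) (hE : ∀ t > 0, IsCompact {q ∈ Ω | t ≤ u q})
    (hlap : IntegrableOn (laplacian u) Ω (area M)) :
    IsWeakSolution ((area M).restrict Ω) (Ω.indicator u) (Ω.indicator fun p ↦ -laplacian u p)
      (fun p ↦ gradNorm Ω u p ^ 2) where
  measurable := measurable_indicator_of_continuousOn hΩ.measurableSet hu.continuousOn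
  nonneg := indicator_nonneg fun p hp ↦ (hpos p hp).le
  measurable_source :=
    measurable_indicator_of_continuousOn hΩ.measurableSet (continuousOn_laplacian hΩ hu).neg
  integrable_source := hlap.neg.indicator hΩ.measurableSet
  measurable_energy := (measurable_gradNorm hΩ (hu.of_le (by norm_cast))).pow_const 2
  energy_nonneg _ := sq_nonneg _
  integrableOn_energy ε hε := by
    have hu1 : ContMDiffOn (𝓡 2) 𝓘(ℝ, ℝ) 1 u Ω := hu.of_le (by norm_cast)
    have hcont : ContinuousOn (fun p ↦ gradNorm Ω u p ^ 2) Ω :=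
      (continuousOn_gradInner hΩ hu1 hu1).congr fun p hp ↦ gradNorm_sq hp
    rw [superlevel_indicator u Ω hε]
    exact ((hcont.mono (sep_subset _ _)).integrableOn_compact (hE ε hε)).mono_measure
      Measure.restrict_le_self
  integral_deriv_comp_mul ψ ψ' ε hε hψ hψ' h0 := by
    refine (setIntegral_congr_fun hΩ.measurableSet fun p hp ↦ ?_).trans
      ((integral_deriv_comp_mul_gradInner hΩ hu (hE ε hε) hψ hψ' h0).trans
        (setIntegral_congr_fun hΩ.measurableSet fun p hp ↦ ?_))
    · simp only [indicator_of_mem hp, gradNorm_sq hp]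
    · simp only [indicator_of_mem hp]

lemma withDensity_gradNorm_preimage (hΩ : IsOpen Ω) (hu : ContinuousOn u Ω) {B : Set ℝ}
    (hB : MeasurableSet B) :
    ((area M).restrict Ω).withDensity (fun p ↦ ENNReal.ofReal (gradNorm Ω u p)) (u ⁻¹' B) =
      ∫⁻ p in Ω.indicator u ⁻¹' B, ENNReal.ofReal √(gradNorm Ω u p ^ 2) ∂(area M).restrict Ω := by
  have hset : u ⁻¹' B ∩ Ω = Ω.indicator u ⁻¹' B ∩ Ω := by
    ext p
    exact and_congr_left fun hp ↦ by simp only [mem_preimage, indicator_of_mem hp]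
  have hm := measurable_indicator_of_continuousOn hΩ.measurableSet hu hB
  simp only [Real.sqrt_sq (gradNorm_nonneg Ω u _)]
  rw [withDensity_apply', Measure.restrict_restrict' hΩ.measurableSet, hset,
    Measure.restrict_restrict hm]

variable [IsRiemannianManifold (𝓡 2) M]

/-- Here Sard's theorem enters: only the regular points of `u` contribute to almost every level. -/
theorem ae_length_sq_le [IsFiniteMeasure ((area M).restrict Ω)] {K : ℝ} (hΩ : IsOpen Ω)
    (hu : ContMDiffOn (𝓡 2) 𝓘(ℝ, ℝ) ∞ u Ω) (hpos : ∀ p ∈ Ω, 0 < u p)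
    (hK : ∀ p, Ω.indicator u p ≤ K) (hE : ∀ t > 0, IsCompact {q ∈ Ω | t ≤ u q})
    (hlap : IntegrableOn (laplacian u) Ω (area M)) :
    ∀ᵐ t, 0 < t → (∀ p ∈ Ω, u p = t → mfderiv (𝓡 2) 𝓘(ℝ, ℝ) u p ≠ 0) ∧
      μH[1] (Ω ∩ u ⁻¹' {t}) ≠ ⊤ ∧
      (μH[1] : Measure M).real (Ω ∩ u ⁻¹' {t}) ^ 2 ≤
        (∫ p in {p | t ≤ Ω.indicator u p}, Ω.indicator (fun p ↦ -laplacian u p) p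
          ∂((area M).restrict Ω)) *
        ((((area M).restrict Ω).map (Ω.indicator u)).rnDeriv volume t).toReal := by
  have hweak := isWeakSolution_indicator hΩ hu hpos hE hlap
  obtain ⟨L, hLm, hL, hLint⟩ := hasCoareaMajorant_regular hΩ (hu.of_le (by norm_cast))
  have hLsq := hweak.ae_sq_le hK hLm fun B hB ↦
    (hLint B hB).trans_eq (withDensity_gradNorm_preimage hΩ hu.continuousOn hB)
  have hsard := measure_eq_zero_iff_ae_notMem.1 (volume_image_mfderiv_eq_zero hΩ hu)
  filter_upwards [hLsq, hsard, Measure.rnDeriv_ne_top (((area M).restrict Ω).map (Ω.indicator u))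
    volume] with t hLt hcrit htop ht
  have hreg : ∀ p ∈ Ω, u p = t → mfderiv (𝓡 2) 𝓘(ℝ, ℝ) u p ≠ 0 :=
    fun p hp hpt h ↦ hcrit ⟨p, ⟨hp, h⟩, hpt⟩
  have hsubset : Ω ∩ u ⁻¹' {t} ⊆ {p ∈ Ω | mfderiv (𝓡 2) 𝓘(ℝ, ℝ) u p ≠ 0} ∩ u ⁻¹' {t} :=
    fun p hp ↦ ⟨⟨hp.1, hreg p hp.1 hp.2⟩, hp.2⟩
  have hlength : μH[1] (Ω ∩ u ⁻¹' {t}) ≤ L t := (measure_mono hsubset).trans (hL t)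
  have hsq := (pow_le_pow_left' hlength 2).trans (hLt ht)
  have hrhs := ENNReal.mul_ne_top (ENNReal.ofReal_ne_top (r := ∫ p in {p | t ≤ Ω.indicator u p},
    Ω.indicator (fun p ↦ -laplacian u p) p ∂((area M).restrict Ω))) htop
  refine ⟨hreg, fun h ↦ ne_top_of_le_ne_top hrhs hsq (by rw [h, ENNReal.top_pow two_ne_zero]), ?_⟩
  have hreal := ENNReal.toReal_mono hrhs hsq
  rwa [ENNReal.toReal_pow, ENNReal.toReal_mul,
    ENNReal.toReal_ofReal (hweak.setIntegral_ge_nonneg ht)] at hreal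

end LevelLines

section Comparison

lemma exists_indicator_le {X : Type*} [TopologicalSpace X] {Ω : Set X} {u : X → ℝ}
    (hc : IsCompact (closure Ω)) (hu : ContinuousOn u (closure Ω)) :
    ∃ K, ∀ p, Ω.indicator u p ≤ K := by
  obtain ⟨K, hK⟩ := hc.bddAbove_image hu
  refine ⟨max K 0, indicator_le' (fun p hp ↦ ?_) fun _ _ ↦ le_max_right _ _⟩
  exact (hK (mem_image_of_mem u (subset_closure hp))).trans (le_max_left _ _)

lemma integrableOn_exp_two_mul {X : Type*} [TopologicalSpace X] [T2Space X] [MeasurableSpace X]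
    [OpensMeasurableSpace X] {μ : Measure X} [IsFiniteMeasureOnCompacts μ] {Ω : Set X} {u : X → ℝ}
    (hc : IsCompact (closure Ω)) (hu : ContinuousOn u (closure Ω)) :
    IntegrableOn (fun x ↦ Real.exp (2 * u x)) Ω μ :=
  (ContinuousOn.integrableOn_compact hc (by fun_prop)).mono_set subset_closure

variable {M : Type*} [EMetricSpace M] [ChartedSpace Plane M] [IsManifold (𝓡 2) ∞ M]
  [RiemannianBundle (fun x : M ↦ TangentSpace (𝓡 2) x)]
  [IsContMDiffRiemannianBundle (𝓡 2) ∞ Plane (fun x : M ↦ TangentSpace (𝓡 2) x)]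
  [MeasurableSpace M] [BorelSpace M] {u f : M → ℝ} {Ω : Set M} {κ lam : ℝ}

lemma integrableOn_laplacian (hΩ : IsOpen Ω) (hc : IsCompact (closure Ω))
    (hu : ContinuousOn u (closure Ω)) (hf : IntegrableOn f Ω (area M))
    (heq : ∀ x ∈ Ω, -laplacian u x + κ = lam * Real.exp (2 * u x) + f x) :
    IntegrableOn (laplacian u) Ω (area M) := by
  have hconst : IntegrableOn (fun _ ↦ κ) Ω (area M) :=
    integrableOn_const ((measure_mono subset_closure).trans_lt hc.measure_lt_top).ne
  refine ((hconst.sub ((integrableOn_exp_two_mul hc hu).const_mul lam)).sub hf).congr_fun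
    (fun x hx ↦ ?_) hΩ.measurableSet
  simp only [Pi.sub_apply]
  linarith [heq x hx]

lemma area_lt_integral_exp (hΩ : IsOpen Ω) (hΩne : Ω.Nonempty) (hc : IsCompact (closure Ω))
    (hu : ContinuousOn u (closure Ω)) (hpos : ∀ x ∈ Ω, 0 < u x) :
    (area M).real Ω < ∫ x in Ω, Real.exp (2 * u x) ∂(area M) := by
  have hexp : ∀ x ∈ Ω, 0 < Real.exp (2 * u x) - 1 := fun x hx ↦
    sub_pos.2 (Real.one_lt_exp_iff.2 (mul_pos two_pos (hpos x hx)))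
  have hone : IntegrableOn (fun _ ↦ (1 : ℝ)) Ω (area M) :=
    integrableOn_const ((measure_mono subset_closure).trans_lt hc.measure_lt_top).ne
  have hint := integrableOn_exp_two_mul (μ := area M) hc hu
  have hlt : 0 < ∫ x in Ω, (Real.exp (2 * u x) - 1) ∂(area M) := by
    have hsupport : Ω ⊆ Function.support fun x ↦ Real.exp (2 * u x) - 1 :=
      fun x hx ↦ (hexp x hx).ne'
    rw [setIntegral_pos_iff_support_of_nonneg_ae
      (ae_restrict_of_forall_mem hΩ.measurableSet fun x hx ↦ (hexp x hx).le) (hint.sub hone),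
      inter_eq_right.2 hsupport]
    exact hΩ.measure_pos _ hΩne
  rw [integral_sub hint hone, setIntegral_const, smul_eq_mul, mul_one] at hlt
  exact sub_pos.1 hlt

variable [SecondCountableTopology M]

lemma SmoothOnClosure.integrableOn_of_laplacian_eq (hu : SmoothOnClosure Ω u) (hΩ : IsOpen Ω)
    (hc : IsCompact (closure Ω))
    (heq : ∀ x ∈ Ω, -laplacian u x + κ = lam * Real.exp (2 * u x) + f x) :
    IntegrableOn f Ω (area M) := by
  have hfin : area M Ω < ⊤ := (measure_mono subset_closure).trans_lt hc.measure_lt_top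
  obtain ⟨C, hC⟩ := exists_bound_laplacian hΩ hc hu
  have hlap : IntegrableOn (laplacian u) Ω (area M) :=
    .of_bound hfin ((continuousOn_laplacian hΩ hu.contMDiffOn).aestronglyMeasurable
      hΩ.measurableSet) C (ae_restrict_of_forall_mem hΩ.measurableSet hC)
  have hconst : IntegrableOn (fun _ ↦ κ) Ω (area M) := integrableOn_const hfin.ne
  refine ((hconst.sub hlap).sub
    ((integrableOn_exp_two_mul hc hu.continuousOn).const_mul lam)).congr_fun
    (fun x hx ↦ ?_) hΩ.measurableSet
  simp only [Pi.sub_apply]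
  linarith [heq x hx]

theorem liouville_comparison [IsRiemannianManifold (𝓡 2) M] {θ : ℝ} (hθ : 0 ≤ θ)
    (hiso : IsoperimetricInequality M θ κ) (hΩ : IsOpen Ω) (hc : IsCompact (closure Ω))
    (hu : ContMDiffOn (𝓡 2) 𝓘(ℝ, ℝ) ∞ u Ω) (hucl : ContinuousOn u (closure Ω))
    (hf : IntegrableOn f Ω (area M))
    (heq : ∀ x ∈ Ω, -laplacian u x + κ = lam * Real.exp (2 * u x) + f x)
    (hbd : ∀ x ∈ frontier Ω, u x = 0) (hpos : ∀ x ∈ Ω, 0 < u x) :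
    4 * Real.pi * θ * ((∫ x in Ω, Real.exp (2 * u x) ∂(area M)) - (area M).real Ω) +
        κ * (area M).real Ω ^ 2 ≤
      2 * (∫ x in Ω, max (f x) 0 ∂(area M)) * (∫ x in Ω, Real.exp (2 * u x) ∂(area M)) +
        lam * (∫ x in Ω, Real.exp (2 * u x) ∂(area M)) ^ 2 := by
  have hfin : IsFiniteMeasure ((area M).restrict Ω) :=
    isFiniteMeasure_restrict.2 ((measure_mono subset_closure).trans_lt hc.measure_lt_top).ne
  obtain ⟨K, hK⟩ := exists_indicator_le hc hucl
  have hE : ∀ t > 0, IsCompact {q ∈ Ω | t ≤ u q} := fun t ↦ isCompact_superlevel hΩ hc hucl hbd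
  have hlap := integrableOn_laplacian hΩ hc hucl hf heq
  have hweak := isWeakSolution_indicator hΩ hu hpos hE hlap
  have hv : ∀ p ∈ Ω, Ω.indicator u p = u p := fun p hp ↦ indicator_of_mem hp u
  have hexp : ∫ x in Ω, Real.exp (2 * u x) ∂(area M) =
      ∫ x in Ω, Real.exp (2 * Ω.indicator u x) ∂(area M) :=
    setIntegral_congr_fun hΩ.measurableSet fun p hp ↦ by simp only [hv p hp]
  have hflux : ∫ x in Ω, max (f x) 0 ∂(area M) = ∫ x in Ω, max (Ω.indicator
      (fun p ↦ -laplacian u p) x - (lam * Real.exp (2 * Ω.indicator u x) - κ)) 0 ∂(area M) :=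
    setIntegral_congr_fun hΩ.measurableSet fun p hp ↦ by
      simp only [indicator_of_mem hp]
      congr 1
      linarith [heq p hp]
  rw [hexp, hflux, ← measureReal_restrict_apply_univ]
  refine hweak.exp_comparison ?_ hK ?_
  · filter_upwards [ae_restrict_mem hΩ.measurableSet] with p hp
    exact (hpos p hp).trans_eq (hv p hp).symm
  · filter_upwards [ae_length_sq_le hΩ hu hpos hK hE hlap] with t hlength ht
    obtain ⟨hreg, htop, hle⟩ := hlength ht
    rw [measureReal_restrict_apply' hΩ.measurableSet, superlevel_indicator u Ω ht,
      inter_eq_left.2 (sep_subset _ _)]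
    rw [superlevel_indicator u Ω ht] at hle
    exact (hiso.superlevel hθ hΩ hu (hE t ht) hreg htop).trans hle

end Comparison

end SphereCovering

end

theorem theorem3p1_general {M : Type*} [EMetricSpace M] [SecondCountableTopology M]
    [ChartedSpace SphereCovering.Plane M] [IsManifold (𝓡 2) ∞ M]
    [RiemannianBundle (fun x : M ↦ TangentSpace (𝓡 2) x)]
    [IsContMDiffRiemannianBundle (𝓡 2) ∞ SphereCovering.Plane
      (fun x : M ↦ TangentSpace (𝓡 2) x)]
    [IsRiemannianManifold (𝓡 2) M] [MeasurableSpace M] [BorelSpace M]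
    (θ κ lam : ℝ) (hθ : 0 ≤ θ) (hiso : SphereCovering.IsoperimetricInequality M θ κ)
    (Ω : Set M) (hΩ : IsOpen Ω) (hΩne : Ω.Nonempty) (hΩc : IsCompact (closure Ω))
    (u f : M → ℝ) (hu : ContMDiffOn (𝓡 2) 𝓘(ℝ, ℝ) ∞ u Ω) (hucl : ContinuousOn u (closure Ω))
    (hf : IntegrableOn f Ω (SphereCovering.area M))
    (heq : ∀ x ∈ Ω, -SphereCovering.laplacian u x + κ = lam * Real.exp (2 * u x) + f x)
    (hbd : ∀ x ∈ frontier Ω, u x = 0) (hpos : ∀ x ∈ Ω, 0 < u x)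
    (Θ : ℝ) (hΘ : Θ = 1 / (2 * Real.pi) * ∫ x in Ω, max (f x) 0 ∂(SphereCovering.area M)) :
    (4 * Real.pi * (θ - Θ) * (∫ x in Ω, Real.exp (2 * u x) ∂(SphereCovering.area M))
        - lam * (∫ x in Ω, Real.exp (2 * u x) ∂(SphereCovering.area M)) ^ 2
      ≤ 4 * Real.pi * θ * (SphereCovering.area M).real Ω
        - κ * (SphereCovering.area M).real Ω ^ 2) ∧
    (Θ = 0 → 0 < lam → lam ≤ κ →
      4 * Real.pi * θ / lam
        ≤ (∫ x in Ω, Real.exp (2 * u x) ∂(SphereCovering.area M))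
          + (SphereCovering.area M).real Ω) := by
  have hcompare := SphereCovering.liouville_comparison hθ hiso hΩ hΩc hu hucl hf heq hbd hpos
  have hlt := SphereCovering.area_lt_integral_exp hΩ hΩne hΩc hucl hpos
  have hflux : ∫ x in Ω, max (f x) 0 ∂(SphereCovering.area M) = 2 * Real.pi * Θ := by
    rw [hΘ]
    field_simp
  rw [hflux] at hcompare
  set A := ∫ x in Ω, Real.exp (2 * u x) ∂(SphereCovering.area M)
  set m := (SphereCovering.area M).real Ω
  refine ⟨by linarith, fun hΘ0 hlam hκ ↦ ?_⟩
  subst hΘ0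
  have hcurv : lam * m ^ 2 ≤ κ * m ^ 2 := by gcongr
  have hmul : (A - m) * (4 * Real.pi * θ) ≤ (A - m) * ((A + m) * lam) := by linarith
  exact (div_le_iff₀ hlam).2 (le_of_mul_le_mul_left hmul (sub_pos.2 hlt))

theorem theorem3p1 {M : Type*} [EMetricSpace M] [SecondCountableTopology M]
    [ChartedSpace SphereCovering.Plane M] [IsManifold (𝓡 2) ∞ M]
    [RiemannianBundle (fun x : M ↦ TangentSpace (𝓡 2) x)]
    [IsContMDiffRiemannianBundle (𝓡 2) ∞ SphereCovering.Plane
      (fun x : M ↦ TangentSpace (𝓡 2) x)]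
    [IsRiemannianManifold (𝓡 2) M] [MeasurableSpace M] [BorelSpace M]
    (θ κ lam : ℝ) (hθ0 : 0 < θ) (hθ1 : θ ≤ 1)
    (hiso : SphereCovering.IsoperimetricInequality M θ κ)
    (Ω : Set M) (hΩ : IsOpen Ω) (hΩne : Ω.Nonempty) (hΩc : IsCompact (closure Ω))
    (u f : M → ℝ) (hu : SphereCovering.SmoothOnClosure Ω u)
    (heq : ∀ x ∈ Ω, -SphereCovering.laplacian u x + κ = lam * Real.exp (2 * u x) + f x)
    (hbd : ∀ x ∈ frontier Ω, u x = 0) (hpos : ∀ x ∈ Ω, 0 < u x)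
    (Θ : ℝ) (hΘ : Θ = 1 / (2 * Real.pi) * ∫ x in Ω, max (f x) 0 ∂(SphereCovering.area M)) :
    (4 * Real.pi * (θ - Θ) * (∫ x in Ω, Real.exp (2 * u x) ∂(SphereCovering.area M))
        - lam * (∫ x in Ω, Real.exp (2 * u x) ∂(SphereCovering.area M)) ^ 2
      ≤ 4 * Real.pi * θ * (SphereCovering.area M).real Ω
        - κ * (SphereCovering.area M).real Ω ^ 2) ∧
    (Θ = 0 → 0 < lam → lam ≤ κ →
      4 * Real.pi * θ / lam
        ≤ (∫ x in Ω, Real.exp (2 * u x) ∂(SphereCovering.area M))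
          + (SphereCovering.area M).real Ω) :=
  theorem3p1_general θ κ lam hθ0.le hiso Ω hΩ hΩne hΩc u f hu.contMDiffOn hu.continuousOn
    (hu.integrableOn_of_laplacian_eq hΩ hΩc heq) heq hbd hpos Θ hΘ
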